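/- **Setting.** Let $\mathbb L$ be a finite or countable set, $u_k\in\mathbb Z^n$ $(k\in\mathbb L)$ primitive vectors spanning $\mathbb R^n$, and $\Lambda\in\mathbb H^{\mathbb L}$. Put $\lambda_k=-\tfrac12\overline{\Lambda}_k i\Lambda_k=\lambda^1_k i+\lambda^2_k j+\lambda^3_k k\in\operatorname{Im}\mathbb H$ and assume $\sum_k(1+|\lambda_k|)^{-1}<\infty$. Let $M_\Lambda=\Lambda+L^2(\mathbb H)$, let $T_\lambda$ (resp. $T_\lambda^{\mathbb C}$) be the group of $g\in(S^1)^{\mathbb L}$ (resp. $(\mathbb C^*)^{\mathbb L}$) with $\sum_k(1+|\lambda_k|)|1-g_k|^2<\infty$, and let $\mathfrak t_\lambda$ be the Hilbert space of $t\in\mathbb R^{\mathbb L}$ with $\|t\|^2=\sum_k(1+|\lambda_k|)t_k^2<\infty$. Assume that $\beta:\mathfrak t_\lambda\to\mathbb R^n$, $\beta(e_k)=u_k$, is continuous (for instance, that the $u_k$ are bounded). Let $\mathfrak n=\ker\beta$, $N=\ker(\exp\circ\beta\circ\exp^{-1}:T_\lambda\to T^n)$ with complexification $N^{\mathbb C}=\ker(\exp\circ\beta\circ\exp^{-1}:T^{\mathbb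 C}_\lambda\to(\mathbb C^*)^n)$. The group $N$ acts on $M_\Lambda$ by left multiplication, with hyperkähler moment map $\mu(x)(\eta)=\sum_k\eta_k(\lambda_k+\tfrac12\overline x_k i x_k)$, $\eta\in\mathfrak n$; let $M(\lambda)=M(\beta,\lambda)=\mu^{-1}(0)/N$ (up to diffeomorphism this depends only on $\lambda$, and below $M(\lambda')$ stands for the quotient formed with any $\Lambda'$ that induces $\lambda'$). Let $q\in\operatorname{Im}\mathbb H$, $|q|=1$; right multiplication by $q$ is one of the complex structures. With respect to it, $\mathbb H=\mathbb C\oplus\mathbb C$, $x=(z,w)$, where $z$, $w$ are the parts of $x$ with $ix=xq$, $ix=-xq$ respectively ($x=z+jw$ for $q=i$), and $N^{\mathbb C}$ acts by $g\cdot(z,w)=(gz,\overline g^{-1}w)$ with left multiplication in $\mathbb H$ (for $q=i$, in complex coordinates, $(gz,g^{-1}w)$). Let $\mu^{\mathbb R}=\langle\mu,q\rangle$ be the real, and the component $\mu^{\mathbb C}$ of $\mu$ orthogonal to $q$ the complex moment map; likewise write $\lambda_k=(\lambda_k^{\mathbb R},\lambda_k^{\mathbb C})$. The complex flats are $H_{k,\mathbb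 C}=\{b\in\mathbb C\otimes(\mathbb R^n)^*: b(u_k)=\lambda^{\mathbb C}_k\}$. Say that $(\Lambda,q)$ is *admissible* if the flats $H_{k,\mathbb C}$ for any $n+1$ distinct indices $k$ have empty intersection, and there are $C_1,C_2>0$ with $C_1|(\Lambda_w)_k|\le|(\Lambda_z)_k|\le C_2|(\Lambda_w)_k|$ for all but finitely many $k$. Smooth functions on a quotient are those which pull back to functions that are locally restrictions of $C^\infty$ functions on open subsets of $M_\Lambda$; a diffeomorphism of quotients is a homeomorphism which identifies smooth functions on open sets (the usual notion when the quotients are manifolds with these smooth functions). **Theorem.** 1. Let $(\Lambda,q)$ be admissible, let $(z,w)\in(\mu^{\mathbb C})^{-1}(0)$, and define $\tilde\mu:\mathfrak n\to\mathfrak n^*$ by $\tilde\mu(y)=\mu^{\mathbb R}(e^{y}z,e^{-y}w)$. Then $\tilde\mu$ is the derivative of the convex functional $$F(y)=\tfrac14\sum_k\bigl(|z_k|^2e^{2y_k}+|w_k|^2e^{-2y_k}-(|z_k|^2+|w_k|^2)+4\lambda^{\mathbb R}_ky_k\bigr)$$ (a convergent sum), $\tilde\mu$ is monotone, maps bounded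 sets to bounded sets, is coercive ($\tilde\mu(y)(y)/\|y\|\to\infty$ as $\|y\|\to\infty$) and surjective. The $N^{\mathbb C}$-orbit of $(z,w)$ meets each level set $\{\mu^{\mathbb R}=\xi\}$, $\xi\in\mathfrak n^*$, in exactly one $N$-orbit. The inclusion $\mu^{-1}(0)\subset(\mu^{\mathbb C})^{-1}(0)$ induces a diffeomorphism $M(\lambda)=\mu^{-1}(0)/N\to(\mu^{\mathbb C})^{-1}(0)/N^{\mathbb C}$. 2. If $(\Lambda,q)$ is admissible, then $M(\lambda)$ is diffeomorphic to $M(\lambda')$, where $\lambda'_k=\lambda_k-\langle\lambda_k,q\rangle q$. 3. In particular, if $(\Lambda,k)$ is admissible (here $k$ is the quaternion unit), then $M(\lambda^1,\lambda^2,\lambda^3)$ is diffeomorphic to $M(\lambda^1,\lambda^2,0)$; if moreover $(\Lambda',j)$ is admissible, where $\Lambda'$ induces $(\lambda^1,\lambda^2,0)$, then both are diffeomorphic to $M(\lambda^1,0,0)$. -/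

import Mathlib

open Filter Topology
open scoped Quaternion ContDiff

noncomputable section

namespace Hypertoric

/-! ### Quaternions, complex structures and the parameters -/

/-- The quaternion units `i`, `j`, `k`. -/
def unitI : ℍ[ℝ] := ⟨0, 1, 0, 0⟩

def unitJ : ℍ[ℝ] := ⟨0, 0, 1, 0⟩

def unitK : ℍ[ℝ] := ⟨0, 0, 0, 1⟩

@[simp] theorem unitI_re : unitI.re = 0 := rfl
@[simp] theorem unitI_imI : unitI.imI = 1 := rfl
@[simp] theorem unitI_imJ : unitI.imJ = 0 := rfl
@[simp] theorem unitI_imK : unitI.imK = 0 := rfl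
@[simp] theorem unitJ_re : unitJ.re = 0 := rfl
@[simp] theorem unitJ_imI : unitJ.imI = 0 := rfl
@[simp] theorem unitJ_imJ : unitJ.imJ = 1 := rfl
@[simp] theorem unitJ_imK : unitJ.imK = 0 := rfl
@[simp] theorem unitK_re : unitK.re = 0 := rfl
@[simp] theorem unitK_imI : unitK.imI = 0 := rfl
@[simp] theorem unitK_imJ : unitK.imJ = 0 := rfl
@[simp] theorem unitK_imK : unitK.imK = 1 := rfl

/-- The 2-sphere of complex structures of the flat hyperkähler structure: the unit imaginary
quaternions `q`, each acting on `ℍ` (a right module over itself) by right multiplication. -/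
abbrev ComplexStructure : Type := {q : ℍ[ℝ] // q * q = -1}

def structI : ComplexStructure := ⟨unitI, by ext <;> simp⟩

def structJ : ComplexStructure := ⟨unitJ, by ext <;> simp⟩

def structK : ComplexStructure := ⟨unitK, by ext <;> simp⟩

theorem norm_complexStructure (q : ComplexStructure) : ‖(q : ℍ[ℝ])‖ = 1 := by
  have h : ‖(q : ℍ[ℝ])‖ * ‖(q : ℍ[ℝ])‖ = 1 := by rw [← norm_mul, q.2]; simp
  nlinarith [norm_nonneg (q : ℍ[ℝ])]

theorem unitI_mul_unitI : unitI * unitI = -1 := structI.2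

theorem norm_unitI : ‖unitI‖ = 1 := norm_complexStructure structI

/-- The `z`-part of `x ∈ ℍ` for the complex structure `q`: the component of `x` on which left
multiplication by `i` coincides with right multiplication by `q`. For `q = i` and `x = z + j w`
with `z, w ∈ ℂ` this is `z`. -/
def zPart (q : ComplexStructure) (x : ℍ[ℝ]) : ℍ[ℝ] := (1 / 2 : ℝ) • (x - unitI * x * q)

/-- The `w`-part of `x ∈ ℍ` for the complex structure `q`: the component of `x` on which left
multiplication by `i` is minus right multiplication by `q`. For `q = i` and `x = z + j w`
with `z, w ∈ ℂ` this is `j w`. -/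
def wPart (q : ComplexStructure) (x : ℍ[ℝ]) : ℍ[ℝ] := (1 / 2 : ℝ) • (x + unitI * x * q)

theorem zPart_structI (z w : ℂ) : zPart structI ((z : ℍ[ℝ]) + unitJ * (w : ℍ[ℝ])) = z := by
  rw [zPart]
  ext <;> simp only [Quaternion.re_smul, Quaternion.imI_smul, Quaternion.imJ_smul,
    Quaternion.imK_smul, smul_eq_mul] <;> simp [structI] <;> ring

theorem wPart_structI (z w : ℂ) :
    wPart structI ((z : ℍ[ℝ]) + unitJ * (w : ℍ[ℝ])) = unitJ * (w : ℍ[ℝ]) := by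
  rw [wPart]
  ext <;> simp only [Quaternion.re_smul, Quaternion.imI_smul, Quaternion.imJ_smul,
    Quaternion.imK_smul, smul_eq_mul] <;> simp [structI] <;> ring

/-- The action of `c ∈ ℂ*` on `ℍ` which complexifies, for the complex structure `q`, the left
multiplication by unit complex numbers. For `q = i` it is `(z, w) ↦ (c z, c⁻¹ w)`. -/
def complexAct (q : ComplexStructure) (c : ℂˣ) (x : ℍ[ℝ]) : ℍ[ℝ] :=
  ((c : ℂ) : ℍ[ℝ]) * zPart q x + ((star ((c⁻¹ : ℂˣ) : ℂ) : ℂ) : ℍ[ℝ]) * wPart q x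

theorem complexAct_structI (c : ℂˣ) (z w : ℂ) :
    complexAct structI c ((z : ℍ[ℝ]) + unitJ * (w : ℍ[ℝ])) =
      ((c * z : ℂ) : ℍ[ℝ]) + unitJ * (((c⁻¹ : ℂˣ) * w : ℂ) : ℍ[ℝ]) := by
  rw [complexAct, zPart_structI, wPart_structI]
  ext <;> simp <;> ring

theorem coeComplex_mul_unitI (c : ℂ) : unitI * (c : ℍ[ℝ]) = (c : ℍ[ℝ]) * unitI := by
  ext <;> simp

theorem zPart_add_wPart (q : ComplexStructure) (x : ℍ[ℝ]) : zPart q x + wPart q x = x := by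
  rw [zPart, wPart, ← smul_add]
  have h : x - unitI * x * q + (x + unitI * x * q) = (2 : ℝ) • x := by rw [two_smul]; abel
  rw [h, smul_smul]; norm_num

theorem zPart_coe_mul (q : ComplexStructure) (c : ℂ) (x : ℍ[ℝ]) :
    zPart q ((c : ℍ[ℝ]) * x) = (c : ℍ[ℝ]) * zPart q x := by
  rw [zPart, zPart, mul_smul_comm, mul_sub, ← mul_assoc, coeComplex_mul_unitI]
  simp only [mul_assoc]

theorem wPart_coe_mul (q : ComplexStructure) (c : ℂ) (x : ℍ[ℝ]) :
    wPart q ((c : ℍ[ℝ]) * x) = (c : ℍ[ℝ]) * wPart q x := by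
  rw [wPart, wPart, mul_smul_comm, mul_add, ← mul_assoc, coeComplex_mul_unitI]
  simp only [mul_assoc]

theorem zPart_add (q : ComplexStructure) (x y : ℍ[ℝ]) :
    zPart q (x + y) = zPart q x + zPart q y := by
  rw [zPart, zPart, zPart, ← smul_add]; congr 1; noncomm_ring

theorem wPart_add (q : ComplexStructure) (x y : ℍ[ℝ]) :
    wPart q (x + y) = wPart q x + wPart q y := by
  rw [wPart, wPart, wPart, ← smul_add]; congr 1; noncomm_ring

theorem unitI_mul_mul (q : ComplexStructure) (x : ℍ[ℝ]) :
    unitI * (unitI * x * q) * q = x := by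
  calc unitI * (unitI * x * q) * q = (unitI * unitI) * x * ((q : ℍ[ℝ]) * q) := by noncomm_ring
    _ = x := by rw [unitI_mul_unitI, q.2]; simp

theorem zPart_zPart (q : ComplexStructure) (x : ℍ[ℝ]) : zPart q (zPart q x) = zPart q x := by
  conv_lhs => rw [zPart]
  have h : unitI * zPart q x * q = - zPart q x := by
    rw [zPart, mul_smul_comm, smul_mul_assoc, mul_sub, sub_mul, unitI_mul_mul, ← smul_neg]
    congr 1; abel
  rw [h, sub_neg_eq_add, ← two_smul ℝ, smul_smul]; norm_num

theorem wPart_wPart (q : ComplexStructure) (x : ℍ[ℝ]) : wPart q (wPart q x) = wPart q x := by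
  conv_lhs => rw [wPart]
  have h : unitI * wPart q x * q = wPart q x := by
    rw [wPart, mul_smul_comm, smul_mul_assoc, mul_add, add_mul, unitI_mul_mul]
    congr 1; abel
  rw [h, ← two_smul ℝ, smul_smul]; norm_num

theorem zPart_wPart (q : ComplexStructure) (x : ℍ[ℝ]) : zPart q (wPart q x) = 0 := by
  have h := zPart_add q (zPart q x) (wPart q x)
  rw [zPart_add_wPart, zPart_zPart] at h
  simpa using h

theorem wPart_zPart (q : ComplexStructure) (x : ℍ[ℝ]) : wPart q (zPart q x) = 0 := by
  have h := wPart_add q (zPart q x) (wPart q x)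
  rw [zPart_add_wPart, wPart_wPart] at h
  simpa using h

theorem complexAct_one (q : ComplexStructure) (x : ℍ[ℝ]) : complexAct q 1 x = x := by
  simp [complexAct, zPart_add_wPart]

theorem complexAct_mul (q : ComplexStructure) (c d : ℂˣ) (x : ℍ[ℝ]) :
    complexAct q (c * d) x = complexAct q c (complexAct q d x) := by
  simp only [complexAct]
  simp only [zPart_add, wPart_add, zPart_coe_mul, wPart_coe_mul, zPart_zPart, wPart_wPart,
    zPart_wPart, wPart_zPart, mul_zero, add_zero, zero_add]
  rw [← mul_assoc, ← mul_assoc, ← Quaternion.coeComplex_mul, ← Quaternion.coeComplex_mul]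
  simp [mul_comm]

theorem norm_zPart_le (q : ComplexStructure) (x : ℍ[ℝ]) : ‖zPart q x‖ ≤ ‖x‖ := by
  have h : ‖unitI * x * q‖ = ‖x‖ := by
    rw [norm_mul, norm_mul, norm_unitI, norm_complexStructure]; ring
  have := norm_sub_le x (unitI * x * q)
  rw [zPart, norm_smul, Real.norm_of_nonneg (by norm_num)]; linarith

theorem norm_wPart_le (q : ComplexStructure) (x : ℍ[ℝ]) : ‖wPart q x‖ ≤ ‖x‖ := by
  have h : ‖unitI * x * q‖ = ‖x‖ := by
    rw [norm_mul, norm_mul, norm_unitI, norm_complexStructure]; ring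
  have := norm_add_le x (unitI * x * q)
  rw [wPart, norm_smul, Real.norm_of_nonneg (by norm_num)]; linarith

/-- The part of an imaginary quaternion `p` which is complementary to `q`. If `p` is a value of
the hyperkähler moment map, `⟪q, p⟫` is its real and `transverse q p` its complex part with
respect to the complex structure `q`; for `q = i` and `p = p₁ i + p₂ j + p₃ k` these are
`p₁` and `p₂ j + p₃ k`. -/
def transverse (q : ComplexStructure) (p : ℍ[ℝ]) : ℍ[ℝ] := p - inner ℝ (q : ℍ[ℝ]) p • (q : ℍ[ℝ])

/-- The complex line of imaginary quaternions orthogonal to `q`. -/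
def complexLine (q : ComplexStructure) : Submodule ℝ ℍ[ℝ] :=
  (Submodule.span ℝ {1, (q : ℍ[ℝ])})ᗮ

/-- `λ_k = -½ Λ̄_k i Λ_k`, an imaginary quaternion. -/
def lam {𝕃 : Type*} (Λ : 𝕃 → ℍ[ℝ]) (k : 𝕃) : ℍ[ℝ] :=
  -((1 / 2 : ℝ) • (star (Λ k) * unitI * Λ k))

/-- The weight `1 + |λ_k|`. -/
def weight {𝕃 : Type*} (Λ : 𝕃 → ℍ[ℝ]) (k : 𝕃) : ℝ := 1 + ‖lam Λ k‖

theorem one_le_weight {𝕃 : Type*} (Λ : 𝕃 → ℍ[ℝ]) (k : 𝕃) : 1 ≤ weight Λ k := by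
  simp [weight]

theorem norm_sq_le_weight {𝕃 : Type*} (Λ : 𝕃 → ℍ[ℝ]) (k : 𝕃) :
    ‖Λ k‖ ^ 2 ≤ 2 * weight Λ k := by
  have h : ‖lam Λ k‖ = 1 / 2 * ‖Λ k‖ ^ 2 := by
    rw [lam, norm_neg, norm_smul, norm_mul, norm_mul, norm_unitI, norm_star,
      Real.norm_of_nonneg (by norm_num)]
    ring
  rw [weight, h]; linarith

/-! ### Square-summable sequences, the Hilbert manifold and the Lie algebras -/

theorem mem_ltwo_iff {𝕃 E : Type*} [NormedAddCommGroup E] (f : 𝕃 → E) :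
    Memℓp f 2 ↔ Summable fun k => ‖f k‖ ^ 2 := by
  rw [memℓp_gen_iff (by norm_num)]
  simp

/-- `L²(ℍ)`. The Hilbert manifold `M_Λ = Λ + L²(ℍ)` is parametrised by the global chart
`v ↦ Λ + v` with `v ∈ L²(ℍ)`. -/
abbrev LTwo (𝕃 : Type*) : Type _ := lp (fun _ : 𝕃 => ℍ[ℝ]) 2

/-- The point `x = Λ + v` of `M_Λ`. -/
def point {𝕃 : Type*} (Λ : 𝕃 → ℍ[ℝ]) (v : LTwo 𝕃) (k : 𝕃) : ℍ[ℝ] := Λ k + v k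

/-- The sequences `t ∈ ℝ^𝕃` with `∑ (1 + |λ_k|) |t_k|² < ∞`. -/
def lieSubmodule {𝕃 : Type*} (Λ : 𝕃 → ℍ[ℝ]) : Submodule ℝ (𝕃 → ℝ) where
  carrier := {t | Memℓp (fun k => Real.sqrt (weight Λ k) * t k) 2}
  zero_mem' := by
    have e : (fun k => Real.sqrt (weight Λ k) * (0 : 𝕃 → ℝ) k) = 0 := by ext k; simp
    change Memℓp (fun k => Real.sqrt (weight Λ k) * (0 : 𝕃 → ℝ) k) 2
    rw [e]
    exact zero_memℓp
  add_mem' := by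
    intro a b ha hb
    have h := ha.add hb
    simpa [Pi.add_def, mul_add] using h
  smul_mem' := by
    intro c a ha
    have h := ha.const_smul c
    have e : (fun k => Real.sqrt (weight Λ k) * (c • a) k) =
        c • fun k => Real.sqrt (weight Λ k) * a k := by
      ext k; simp; ring
    change Memℓp (fun k => Real.sqrt (weight Λ k) * (c • a) k) 2
    rw [e]
    exact h

theorem mem_lieSubmodule_iff {𝕃 : Type*} (Λ : 𝕃 → ℍ[ℝ]) (t : 𝕃 → ℝ) :
    t ∈ lieSubmodule Λ ↔ Summable fun k => weight Λ k * |t k| ^ 2 := by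
  change Memℓp (fun k => Real.sqrt (weight Λ k) * t k) 2 ↔ _
  rw [mem_ltwo_iff]
  refine iff_of_eq (congrArg Summable (funext fun k => ?_))
  have := one_le_weight Λ k
  rw [Real.norm_eq_abs, abs_mul, mul_pow, sq_abs, sq_abs, Real.sq_sqrt (by linarith)]

/-- The Hilbert space `𝔱_λ` of all `t ∈ ℝ^𝕃` with `∑ (1 + |λ_k|) |t_k|² < ∞`; its norm is
`‖t‖² = ∑ (1 + |λ_k|) |t_k|²`. -/
def TLie {𝕃 : Type*} (Λ : 𝕃 → ℍ[ℝ]) : Type _ := lieSubmodule Λ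

instance {𝕃 : Type*} (Λ : 𝕃 → ℍ[ℝ]) : AddCommGroup (TLie Λ) :=
  inferInstanceAs (AddCommGroup (lieSubmodule Λ))

instance {𝕃 : Type*} (Λ : 𝕃 → ℍ[ℝ]) : Module ℝ (TLie Λ) :=
  inferInstanceAs (Module ℝ (lieSubmodule Λ))

/-- The sequence underlying an element of `𝔱_λ`. -/
def TLie.seq {𝕃 : Type*} {Λ : 𝕃 → ℍ[ℝ]} (t : TLie Λ) : 𝕃 → ℝ := Subtype.val t

@[simp] theorem TLie.seq_add {𝕃 : Type*} {Λ : 𝕃 → ℍ[ℝ]} (s t : TLie Λ) (k : 𝕃) :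
    (s + t).seq k = s.seq k + t.seq k := rfl

@[simp] theorem TLie.seq_smul {𝕃 : Type*} {Λ : 𝕃 → ℍ[ℝ]} (c : ℝ) (t : TLie Λ) (k : 𝕃) :
    (c • t).seq k = c * t.seq k := rfl

@[simp] theorem TLie.seq_neg {𝕃 : Type*} {Λ : 𝕃 → ℍ[ℝ]} (t : TLie Λ) (k : 𝕃) :
    (-t).seq k = -t.seq k := rfl

@[simp] theorem TLie.seq_zero {𝕃 : Type*} {Λ : 𝕃 → ℍ[ℝ]} (k : 𝕃) :
    (0 : TLie Λ).seq k = 0 := rfl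

/-- The isometric embedding `t ↦ ((1 + |λ_k|)^{1/2} t_k)_k` of `𝔱_λ` in `ℓ²`. -/
def toLTwo {𝕃 : Type*} (Λ : 𝕃 → ℍ[ℝ]) : TLie Λ →ₗ[ℝ] lp (fun _ : 𝕃 => ℝ) 2 where
  toFun t := ⟨fun k => Real.sqrt (weight Λ k) * t.seq k, t.2⟩
  map_add' s t := by
    ext k
    exact mul_add _ _ _
  map_smul' c t := by
    ext k
    simp; ring

theorem toLTwo_injective {𝕃 : Type*} (Λ : 𝕃 → ℍ[ℝ]) : Function.Injective (toLTwo Λ) := by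
  intro s t h
  apply Subtype.ext
  funext k
  have hk : Real.sqrt (weight Λ k) * s.seq k = Real.sqrt (weight Λ k) * t.seq k :=
    congrFun (congrArg Subtype.val h) k
  have hw := one_le_weight Λ k
  exact mul_left_cancel₀ (Real.sqrt_ne_zero'.2 (by linarith)) hk

instance {𝕃 : Type*} (Λ : 𝕃 → ℍ[ℝ]) : NormedAddCommGroup (TLie Λ) :=
  NormedAddCommGroup.induced (TLie Λ) (lp (fun _ : 𝕃 => ℝ) 2) (toLTwo Λ) (toLTwo_injective Λ)

instance {𝕃 : Type*} (Λ : 𝕃 → ℍ[ℝ]) : NormedSpace ℝ (TLie Λ) :=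
  NormedSpace.induced ℝ (TLie Λ) (lp (fun _ : 𝕃 => ℝ) 2) (toLTwo Λ)

theorem TLie.norm_eq {𝕃 : Type*} {Λ : 𝕃 → ℍ[ℝ]} (t : TLie Λ) : ‖t‖ = ‖toLTwo Λ t‖ := rfl

theorem TLie.norm_sq {𝕃 : Type*} {Λ : 𝕃 → ℍ[ℝ]} (t : TLie Λ) :
    ‖t‖ ^ 2 = ∑' k, weight Λ k * |t.seq k| ^ 2 := by
  have h := lp.norm_rpow_eq_tsum (p := 2) (by norm_num) (toLTwo Λ t)
  rw [TLie.norm_eq]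
  simp only [ENNReal.toReal_ofNat, Real.rpow_ofNat] at h
  rw [h]
  refine tsum_congr fun k => ?_
  have := one_le_weight Λ k
  change ‖Real.sqrt (weight Λ k) * t.seq k‖ ^ 2 = _
  rw [Real.norm_eq_abs, abs_mul, mul_pow, sq_abs, sq_abs, Real.sq_sqrt (by linarith)]

theorem TLie.abs_seq_le {𝕃 : Type*} {Λ : 𝕃 → ℍ[ℝ]} (t : TLie Λ) (k : 𝕃) :
    |t.seq k| ≤ ‖t‖ := by
  have h := lp.norm_apply_le_norm (p := 2) (by norm_num) (toLTwo Λ t) k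
  rw [TLie.norm_eq]
  refine le_trans ?_ h
  change _ ≤ ‖Real.sqrt (weight Λ k) * t.seq k‖
  rw [norm_mul, Real.norm_eq_abs, Real.norm_eq_abs, abs_of_nonneg (Real.sqrt_nonneg _)]
  have h1 : 1 ≤ Real.sqrt (weight Λ k) := Real.one_le_sqrt.2 (one_le_weight Λ k)
  nlinarith [abs_nonneg (t.seq k)]

/-- The basis vector `e_k` of `𝔱_λ`. -/
def basisVec {𝕃 : Type*} [DecidableEq 𝕃] (Λ : 𝕃 → ℍ[ℝ]) (k : 𝕃) : TLie Λ :=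
  ⟨Pi.single k 1, by
    rw [mem_lieSubmodule_iff]
    refine summable_of_ne_finset_zero (s := {k}) fun l hl => ?_
    have : l ≠ k := by simpa using hl
    simp [this]⟩

/-- The vector `u_k ∈ ℤⁿ` in `ℝⁿ`. -/
def realVec {𝕃 : Type*} {n : ℕ} (u : 𝕃 → Fin n → ℤ) (k : 𝕃) : Fin n → ℝ := fun i => (u k i : ℝ)

/-- The linear map `β : 𝔱_λ → ℝⁿ`, `β(e_k) = u_k`, is well defined and continuous. -/
def BetaContinuous {𝕃 : Type*} {n : ℕ} (Λ : 𝕃 → ℍ[ℝ]) (u : 𝕃 → Fin n → ℤ) : Prop :=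
  open Classical in ∃ β : TLie Λ →L[ℝ] (Fin n → ℝ), ∀ k, β (basisVec Λ k) = realVec u k

/-- The Lie algebra `𝔫 = ker β` where `β(t) = ∑ t_k u_k`. -/
def nLie {𝕃 : Type*} {n : ℕ} (Λ : 𝕃 → ℍ[ℝ]) (u : 𝕃 → Fin n → ℤ) : Submodule ℝ (TLie Λ) where
  carrier := {t | HasSum (fun k => t.seq k • realVec u k) 0}
  zero_mem' := by simpa using (hasSum_zero : HasSum (fun _ : 𝕃 => (0 : Fin n → ℝ)) 0)
  add_mem' := by
    intro a b ha hb
    simpa [add_smul] using HasSum.add ha hb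
  smul_mem' := by
    intro c a ha
    simpa [mul_smul] using HasSum.const_smul c ha

/-! ### Moment maps -/

/-- The `k`-th component `λ_k + ½ x̄_k i x_k` of the hyperkähler moment map for `T_λ` at the
point `x = Λ + v`. -/
def momentCoeff {𝕃 : Type*} (Λ : 𝕃 → ℍ[ℝ]) (v : LTwo 𝕃) (k : 𝕃) : ℍ[ℝ] :=
  lam Λ k + (1 / 2 : ℝ) • (star (point Λ v k) * unitI * point Λ v k)

theorem norm_le_sqrt_weight {𝕃 : Type*} (Λ : 𝕃 → ℍ[ℝ]) (k : 𝕃) :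
    ‖Λ k‖ ≤ 2 * Real.sqrt (weight Λ k) := by
  have hw := one_le_weight Λ k
  refine abs_le_of_sq_le_sq' ?_ (by positivity) |>.2
  rw [mul_pow, Real.sq_sqrt (by linarith)]
  linarith [norm_sq_le_weight Λ k]

theorem norm_momentCoeff_le {𝕃 : Type*} (Λ : 𝕃 → ℍ[ℝ]) (v : LTwo 𝕃) (k : 𝕃) :
    ‖momentCoeff Λ v k‖ ≤ Real.sqrt (weight Λ k) * ((2 + ‖v‖) * ‖v k‖) := by
  have e : momentCoeff Λ v k = (1 / 2 : ℝ) • (star (v k) * unitI * Λ k +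
      star (Λ k) * unitI * v k + star (v k) * unitI * v k) := by
    rw [momentCoeff, lam, point, ← smul_neg, ← smul_add, star_add]
    congr 1; noncomm_ring
  have hs : 1 ≤ Real.sqrt (weight Λ k) := Real.one_le_sqrt.2 (one_le_weight Λ k)
  have hΛ := norm_le_sqrt_weight Λ k
  have hv : ‖v k‖ ≤ ‖v‖ := lp.norm_apply_le_norm (by norm_num) v k
  have h1 : ‖star (v k) * unitI * Λ k + star (Λ k) * unitI * v k + star (v k) * unitI * v k‖ ≤
      ‖v k‖ * ‖Λ k‖ + ‖Λ k‖ * ‖v k‖ + ‖v k‖ * ‖v k‖ := by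
    refine (norm_add₃_le).trans ?_
    simp [norm_unitI]
  rw [e, norm_smul, Real.norm_of_nonneg (by norm_num)]
  have h0 := norm_nonneg (v k)
  have h2 : ‖v k‖ * ‖Λ k‖ ≤ ‖v k‖ * (2 * Real.sqrt (weight Λ k)) :=
    mul_le_mul_of_nonneg_left hΛ h0
  have h3 : ‖v k‖ * ‖v k‖ ≤ ‖v‖ * ‖v k‖ := mul_le_mul_of_nonneg_right hv h0
  have h4 : ‖v‖ * ‖v k‖ ≤ Real.sqrt (weight Λ k) * (‖v‖ * ‖v k‖) :=
    le_mul_of_one_le_left (by positivity) hs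
  nlinarith [mul_nonneg (norm_nonneg v) h0]

theorem moment_summable_and_bound {𝕃 : Type*} (Λ : 𝕃 → ℍ[ℝ]) (v : LTwo 𝕃) (t : TLie Λ) :
    (Summable fun k => ‖t.seq k • momentCoeff Λ v k‖) ∧
      ∑' k, ‖t.seq k • momentCoeff Λ v k‖ ≤ ((2 + ‖v‖) * ‖v‖) * ‖t‖ := by
  have hA : Summable fun k => ‖toLTwo Λ t k‖ ^ (2 : ℝ) := by
    simpa using (mem_ltwo_iff _).1 (lp.memℓp (toLTwo Λ t))
  have hB : Summable fun k => ‖v k‖ ^ (2 : ℝ) := by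
    simpa using (mem_ltwo_iff _).1 (lp.memℓp v)
  obtain ⟨hs, hle⟩ := Real.summable_and_inner_le_Lp_mul_Lq_tsum_of_nonneg
    Real.HolderConjugate.two_two (fun k => norm_nonneg (toLTwo Λ t k))
    (fun k => norm_nonneg (v k)) hA hB
  have e1 : (∑' k, ‖toLTwo Λ t k‖ ^ (2 : ℝ)) ^ (1 / (2 : ℝ)) = ‖t‖ := by
    rw [TLie.norm_eq, lp.norm_eq_tsum_rpow (by norm_num)]; simp
  have e2 : (∑' k, ‖v k‖ ^ (2 : ℝ)) ^ (1 / (2 : ℝ)) = ‖v‖ := by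
    rw [lp.norm_eq_tsum_rpow (by norm_num)]; simp
  rw [e1, e2] at hle
  have hb : ∀ k, ‖t.seq k • momentCoeff Λ v k‖ ≤ (2 + ‖v‖) * (‖toLTwo Λ t k‖ * ‖v k‖) := by
    intro k
    have e : ‖toLTwo Λ t k‖ = Real.sqrt (weight Λ k) * |t.seq k| := by
      change ‖Real.sqrt (weight Λ k) * t.seq k‖ = _
      rw [norm_mul, Real.norm_eq_abs, Real.norm_eq_abs, abs_of_nonneg (Real.sqrt_nonneg _)]
    rw [norm_smul, Real.norm_eq_abs, e]
    calc |t.seq k| * ‖momentCoeff Λ v k‖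
        ≤ |t.seq k| * (Real.sqrt (weight Λ k) * ((2 + ‖v‖) * ‖v k‖)) :=
          mul_le_mul_of_nonneg_left (norm_momentCoeff_le Λ v k) (abs_nonneg _)
      _ = _ := by ring
  have hs' := hs.mul_left (2 + ‖v‖)
  have hsum := Summable.of_nonneg_of_le (fun k => norm_nonneg _) hb hs'
  refine ⟨hsum, (hsum.tsum_le_tsum hb hs').trans ?_⟩
  rw [tsum_mul_left]
  calc (2 + ‖v‖) * ∑' k, ‖toLTwo Λ t k‖ * ‖v k‖ ≤ (2 + ‖v‖) * (‖t‖ * ‖v‖) :=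
        mul_le_mul_of_nonneg_left hle (by positivity)
    _ = _ := by ring

/-- The hyperkähler moment map for `T_λ` at the point `x = Λ + v`, as an element of
`Im ℍ ⊗ 𝔱_λ*`: it sends `t` to `∑ t_k (λ_k + ½ x̄_k i x_k)`. -/
def hyperMoment {𝕃 : Type*} (Λ : 𝕃 → ℍ[ℝ]) (v : LTwo 𝕃) : TLie Λ →L[ℝ] ℍ[ℝ] :=
  LinearMap.mkContinuous
    { toFun := fun t => ∑' k, t.seq k • momentCoeff Λ v k
      map_add' := by
        intro s t
        rw [← Summable.tsum_add (moment_summable_and_bound Λ v s).1.of_norm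
          (moment_summable_and_bound Λ v t).1.of_norm]
        simp [add_smul]
      map_smul' := by
        intro c t
        rw [RingHom.id_apply, ← Summable.tsum_const_smul c
          (moment_summable_and_bound Λ v t).1.of_norm]
        simp [mul_smul] }
    ((2 + ‖v‖) * ‖v‖)
    (fun t => (norm_tsum_le_tsum_norm (moment_summable_and_bound Λ v t).1).trans
      (moment_summable_and_bound Λ v t).2)

/-- The hyperkähler moment map for `N`, an element of `Im ℍ ⊗ 𝔫*`. -/
def nMoment {𝕃 : Type*} {n : ℕ} (Λ : 𝕃 → ℍ[ℝ]) (u : 𝕃 → Fin n → ℤ) (v : LTwo 𝕃) :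
    nLie Λ u →L[ℝ] ℍ[ℝ] :=
  (hyperMoment Λ v).comp (nLie Λ u).subtypeL

/-- The real moment map `μ^ℝ : M_Λ → 𝔫*` for `N` with respect to the complex structure `q`. -/
def realMoment {𝕃 : Type*} {n : ℕ} (q : ComplexStructure) (Λ : 𝕃 → ℍ[ℝ]) (u : 𝕃 → Fin n → ℤ)
    (v : LTwo 𝕃) : StrongDual ℝ (nLie Λ u) :=
  (innerSL ℝ (q : ℍ[ℝ])).comp (nMoment Λ u v)

/-- The zero locus `μ⁻¹(0)` of the hyperkähler moment map for `N`. -/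
def hyperZero {𝕃 : Type*} {n : ℕ} (Λ : 𝕃 → ℍ[ℝ]) (u : 𝕃 → Fin n → ℤ) : Set (LTwo 𝕃) :=
  {v | nMoment Λ u v = 0}

/-- The zero locus of the complex moment map for `N` with respect to the complex
structure `q`. -/
def complexZero {𝕃 : Type*} {n : ℕ} (q : ComplexStructure) (Λ : 𝕃 → ℍ[ℝ])
    (u : 𝕃 → Fin n → ℤ) : Set (LTwo 𝕃) :=
  {v | ∀ η, transverse q (nMoment Λ u v η) = 0}

theorem hyperZero_subset_complexZero {𝕃 : Type*} {n : ℕ} (q : ComplexStructure)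
    (Λ : 𝕃 → ℍ[ℝ]) (u : 𝕃 → Fin n → ℤ) : hyperZero Λ u ⊆ complexZero q Λ u := by
  intro v hv η
  have h : nMoment Λ u v = 0 := hv
  simp [h, transverse]

/-! ### The groups and their orbits -/

/-- The complexified Hilbert group `T_λ^ℂ`. -/
def torusC {𝕃 : Type*} (Λ : 𝕃 → ℍ[ℝ]) : Subgroup (𝕃 → ℂˣ) where
  carrier := {g | Summable fun k => weight Λ k * ‖1 - (g k : ℂ)‖ ^ 2}
  one_mem' := by simpa using (summable_zero : Summable fun _ : 𝕃 => (0 : ℝ))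
  mul_mem' := by
    intro g h hg hh
    have hh' : Summable fun k => weight Λ k * ‖1 - (h k : ℂ)‖ ^ 2 := hh
    have hg' : Summable fun k => weight Λ k * ‖1 - (g k : ℂ)‖ ^ 2 := hg
    have hev : ∀ᶠ k in cofinite, weight Λ k * ‖1 - (g k : ℂ)‖ ^ 2 < 1 :=
      hg'.tendsto_cofinite_zero.eventually (gt_mem_nhds one_pos)
    refine Summable.of_norm_bounded_eventually ((hg'.mul_left 2).add (hh'.mul_left 8)) ?_
    filter_upwards [hev] with k hk
    have hw := one_le_weight Λ k
    have h1 : ‖1 - (g k : ℂ)‖ ≤ 1 := by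
      nlinarith [norm_nonneg (1 - (g k : ℂ)), sq_nonneg ‖1 - (g k : ℂ)‖]
    have h2 : ‖(g k : ℂ)‖ ≤ 2 := by
      calc ‖(g k : ℂ)‖ = ‖1 - (1 - (g k : ℂ))‖ := by simp
        _ ≤ ‖(1 : ℂ)‖ + ‖1 - (g k : ℂ)‖ := norm_sub_le _ _
        _ ≤ 2 := by rw [norm_one]; linarith
    have h3 : ‖1 - ((g * h) k : ℂ)‖ ≤ ‖1 - (g k : ℂ)‖ + 2 * ‖1 - (h k : ℂ)‖ := by
      calc ‖1 - ((g * h) k : ℂ)‖ = ‖(1 - (g k : ℂ)) + g k * (1 - (h k : ℂ))‖ := by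
            congr 1; simp; ring
        _ ≤ ‖1 - (g k : ℂ)‖ + ‖(g k : ℂ)‖ * ‖1 - (h k : ℂ)‖ := by
            rw [← norm_mul]; exact norm_add_le _ _
        _ ≤ _ := by
            have := mul_le_mul_of_nonneg_right h2 (norm_nonneg (1 - (h k : ℂ)))
            linarith
    have h4 : ‖1 - ((g * h) k : ℂ)‖ ^ 2 ≤ 2 * ‖1 - (g k : ℂ)‖ ^ 2 + 8 * ‖1 - (h k : ℂ)‖ ^ 2 := by
      have := pow_le_pow_left₀ (norm_nonneg _) h3 2
      nlinarith [sq_nonneg (‖1 - (g k : ℂ)‖ - 2 * ‖1 - (h k : ℂ)‖)]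
    rw [Real.norm_of_nonneg (by positivity)]
    nlinarith
  inv_mem' := by
    intro g hg
    have hg' : Summable fun k => weight Λ k * ‖1 - (g k : ℂ)‖ ^ 2 := hg
    have hev : ∀ᶠ k in cofinite, weight Λ k * ‖1 - (g k : ℂ)‖ ^ 2 < 1 / 4 :=
      hg'.tendsto_cofinite_zero.eventually (gt_mem_nhds (by norm_num))
    refine Summable.of_norm_bounded_eventually (hg'.mul_left 4) ?_
    filter_upwards [hev] with k hk
    have hw := one_le_weight Λ k
    have h1 : ‖1 - (g k : ℂ)‖ ≤ 1 / 2 := by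
      nlinarith [norm_nonneg (1 - (g k : ℂ)), sq_nonneg ‖1 - (g k : ℂ)‖]
    have h2 : 1 / 2 ≤ ‖(g k : ℂ)‖ := by
      have : ‖(1 : ℂ)‖ ≤ ‖1 - (g k : ℂ)‖ + ‖(g k : ℂ)‖ := by
        simpa using norm_add_le (1 - (g k : ℂ)) (g k : ℂ)
      rw [norm_one] at this
      linarith
    have h3 : ‖1 - ((g⁻¹) k : ℂ)‖ * ‖(g k : ℂ)‖ = ‖1 - (g k : ℂ)‖ := by
      rw [← norm_mul, sub_mul, Pi.inv_apply, Units.inv_mul, one_mul, norm_sub_rev]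
    have h4 : ‖1 - ((g⁻¹) k : ℂ)‖ ≤ 2 * ‖1 - (g k : ℂ)‖ := by
      nlinarith [norm_nonneg (1 - ((g⁻¹) k : ℂ))]
    have h5 := pow_le_pow_left₀ (norm_nonneg _) h4 2
    rw [Real.norm_of_nonneg (by positivity)]
    nlinarith

/-- The Hilbert group `T_λ`. -/
def torus {𝕃 : Type*} (Λ : 𝕃 → ℍ[ℝ]) : Subgroup (𝕃 → ℂˣ) :=
  torusC Λ ⊓
    { carrier := {g | ∀ k, ‖(g k : ℂ)‖ = 1}
      one_mem' := by simp
      mul_mem' := by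
        intro g h hg hh k
        simp [hg k, hh k]
      inv_mem' := by
        intro g hg k
        simp [hg k] }

/-- The group `N = ker (exp ∘ β ∘ exp⁻¹ : T_λ → Tⁿ)`: the `g = (exp (i θ_k))_k ∈ T_λ` with
`θ ∈ 𝔱_λ` and `β(θ) = ∑ θ_k u_k ∈ 2πℤⁿ`. -/
def groupN {𝕃 : Type*} {n : ℕ} (Λ : 𝕃 → ℍ[ℝ]) (u : 𝕃 → Fin n → ℤ) : Subgroup (𝕃 → ℂˣ) where
  carrier := {g | g ∈ torus Λ ∧ ∃ θ : TLie Λ,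
    (∀ k, (g k : ℂ) = Complex.exp (Complex.I * (θ.seq k : ℂ))) ∧
    ∃ m : Fin n → ℤ, HasSum (fun k => θ.seq k • realVec u k) (fun i => 2 * Real.pi * m i)}
  one_mem' := by
    refine ⟨one_mem _, 0, by simp, 0, ?_⟩
    have e : (fun i : Fin n => 2 * Real.pi * ((0 : Fin n → ℤ) i : ℝ)) = 0 := by ext; simp
    rw [e]
    simpa using (hasSum_zero : HasSum (fun _ : 𝕃 => (0 : Fin n → ℝ)) 0)
  mul_mem' := by
    rintro g h ⟨hg, θ, hθ, m, hm⟩ ⟨hh, θ', hθ', m', hm'⟩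
    refine ⟨mul_mem hg hh, θ + θ', fun k => ?_, m + m', ?_⟩
    · rw [Pi.mul_apply, Units.val_mul, hθ, hθ', ← Complex.exp_add]
      congr 1; push_cast [TLie.seq_add]; ring
    · have e : (fun i : Fin n => 2 * Real.pi * ((m + m') i : ℝ)) =
          (fun i => 2 * Real.pi * (m i : ℝ)) + fun i => 2 * Real.pi * (m' i : ℝ) := by
        ext i; simp; ring
      rw [e]
      simpa [add_smul] using hm.add hm'
  inv_mem' := by
    rintro g ⟨hg, θ, hθ, m, hm⟩
    refine ⟨inv_mem hg, (-1 : ℝ) • θ, fun k => ?_, -m, ?_⟩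
    · rw [Pi.inv_apply, Units.val_inv_eq_inv_val, hθ, ← Complex.exp_neg]
      congr 1; push_cast [TLie.seq_smul]; ring
    · have e : (fun i : Fin n => 2 * Real.pi * ((-m) i : ℝ)) =
          -(fun i => 2 * Real.pi * (m i : ℝ)) := by
        ext i; simp
      rw [e]
      simpa using hm.neg

/-- The complexification `N^ℂ = ker (exp ∘ β ∘ exp⁻¹ : T_λ^ℂ → (ℂ*)ⁿ)`: the
`g = (exp (i ζ_k))_k ∈ T_λ^ℂ` with `ζ ∈ 𝔱_λ ⊗ ℂ` and `β(ζ) = ∑ ζ_k u_k ∈ 2πℤⁿ`. -/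
def groupNC {𝕃 : Type*} {n : ℕ} (Λ : 𝕃 → ℍ[ℝ]) (u : 𝕃 → Fin n → ℤ) :
    Subgroup (𝕃 → ℂˣ) where
  carrier := {g | g ∈ torusC Λ ∧ ∃ θ s : TLie Λ,
    (∀ k, (g k : ℂ) = Complex.exp (Complex.I * ((θ.seq k : ℂ) + Complex.I * (s.seq k : ℂ)))) ∧
    ∃ m : Fin n → ℤ, HasSum (fun k => θ.seq k • realVec u k) (fun i => 2 * Real.pi * m i) ∧
      HasSum (fun k => s.seq k • realVec u k) 0}
  one_mem' := by
    refine ⟨one_mem _, 0, 0, by simp, 0, ?_, ?_⟩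
    · have e : (fun i : Fin n => 2 * Real.pi * ((0 : Fin n → ℤ) i : ℝ)) = 0 := by ext; simp
      rw [e]
      simpa using (hasSum_zero : HasSum (fun _ : 𝕃 => (0 : Fin n → ℝ)) 0)
    · simpa using (hasSum_zero : HasSum (fun _ : 𝕃 => (0 : Fin n → ℝ)) 0)
  mul_mem' := by
    rintro g h ⟨hg, θ, s, hθ, m, hm, hs⟩ ⟨hh, θ', s', hθ', m', hm', hs'⟩
    refine ⟨mul_mem hg hh, θ + θ', s + s', fun k => ?_, m + m', ?_, ?_⟩
    · rw [Pi.mul_apply, Units.val_mul, hθ, hθ', ← Complex.exp_add]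
      congr 1; push_cast [TLie.seq_add]; ring
    · have e : (fun i : Fin n => 2 * Real.pi * ((m + m') i : ℝ)) =
          (fun i => 2 * Real.pi * (m i : ℝ)) + fun i => 2 * Real.pi * (m' i : ℝ) := by
        ext i; simp; ring
      rw [e]
      simpa [add_smul] using hm.add hm'
    · simpa [add_smul] using hs.add hs'
  inv_mem' := by
    rintro g ⟨hg, θ, s, hθ, m, hm, hs⟩
    refine ⟨inv_mem hg, (-1 : ℝ) • θ, (-1 : ℝ) • s, fun k => ?_, -m, ?_, ?_⟩
    · rw [Pi.inv_apply, Units.val_inv_eq_inv_val, hθ, ← Complex.exp_neg]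
      congr 1; push_cast [TLie.seq_smul]; ring
    · have e : (fun i : Fin n => 2 * Real.pi * ((-m) i : ℝ)) =
          -(fun i => 2 * Real.pi * (m i : ℝ)) := by
        ext i; simp
      rw [e]
      simpa using hm.neg
    · simpa using hs.neg

/-- The points `Λ + v` and `Λ + v'` of `M_Λ` lie in the same `N`-orbit, where `g x = (g_k x_k)_k`. -/
def NRel {𝕃 : Type*} {n : ℕ} (Λ : 𝕃 → ℍ[ℝ]) (u : 𝕃 → Fin n → ℤ) (v v' : LTwo 𝕃) : Prop :=
  ∃ g ∈ groupN Λ u, ∀ k, point Λ v' k = ((g k : ℂ) : ℍ[ℝ]) * point Λ v k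

/-- The points `Λ + v` and `Λ + v'` of `M_Λ` lie in the same `N^ℂ`-orbit, for the complex
structure `q`. -/
def NCRel {𝕃 : Type*} {n : ℕ} (q : ComplexStructure) (Λ : 𝕃 → ℍ[ℝ]) (u : 𝕃 → Fin n → ℤ)
    (v v' : LTwo 𝕃) : Prop :=
  ∃ g ∈ groupNC Λ u, ∀ k, point Λ v' k = complexAct q (g k) (point Λ v k)

theorem NRel.equivalence {𝕃 : Type*} {n : ℕ} (Λ : 𝕃 → ℍ[ℝ]) (u : 𝕃 → Fin n → ℤ) :
    Equivalence (NRel Λ u) where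
  refl v := ⟨1, one_mem _, by simp⟩
  symm := by
    rintro v v' ⟨g, hg, h⟩
    refine ⟨g⁻¹, inv_mem hg, fun k => ?_⟩
    rw [h, ← mul_assoc, ← Quaternion.coeComplex_mul]
    simp
  trans := by
    rintro v v' v'' ⟨g, hg, h⟩ ⟨g', hg', h'⟩
    refine ⟨g' * g, mul_mem hg' hg, fun k => ?_⟩
    rw [h', h, ← mul_assoc, ← Quaternion.coeComplex_mul]
    simp

theorem NCRel.equivalence {𝕃 : Type*} {n : ℕ} (q : ComplexStructure) (Λ : 𝕃 → ℍ[ℝ])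
    (u : 𝕃 → Fin n → ℤ) : Equivalence (NCRel q Λ u) where
  refl v := ⟨1, one_mem _, fun k => by rw [Pi.one_apply, complexAct_one]⟩
  symm := by
    rintro v v' ⟨g, hg, h⟩
    refine ⟨g⁻¹, inv_mem hg, fun k => ?_⟩
    rw [h, ← complexAct_mul, Pi.inv_apply, inv_mul_cancel, complexAct_one]
  trans := by
    rintro v v' v'' ⟨g, hg, h⟩ ⟨g', hg', h'⟩
    refine ⟨g' * g, mul_mem hg' hg, fun k => ?_⟩
    rw [h', h, ← complexAct_mul, Pi.mul_apply]

/-- The exponential `e^y ∈ ℂ*` of a real number. -/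
def expUnit (y : ℝ) : ℂˣ := Units.mk0 (Complex.exp y) (Complex.exp_ne_zero _)

theorem abs_exp_sub_one_le_mul {y c : ℝ} (h : |y| ≤ c) :
    |Real.exp y - 1| ≤ Real.exp c * |y| := by
  have h1 := Real.add_one_le_exp y
  have h2 := Real.add_one_le_exp (-y)
  have h3 : Real.exp (-y) * Real.exp y = 1 := by rw [← Real.exp_add]; simp
  have hp := Real.exp_pos y
  have hc : 1 ≤ Real.exp c := Real.one_le_exp ((abs_nonneg y).trans h)
  have hyc : Real.exp y ≤ Real.exp c := Real.exp_le_exp.2 ((le_abs_self y).trans h)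
  rcases le_total 0 y with hy | hy
  · rw [abs_of_nonneg (by linarith), abs_of_nonneg hy]
    nlinarith
  · rw [abs_of_nonpos (by linarith [Real.exp_le_one_iff.2 hy]), abs_of_nonpos hy]
    nlinarith

/-- The point `e^y · x` of `M_Λ`, where `x = Λ + v` and `y ∈ 𝔱_λ`, identified with `i 𝔱_λ`. For
`q = i` it is `(e^{y_k} z_k, e^{-y_k} w_k)_k`. -/
def expMove {𝕃 : Type*} (q : ComplexStructure) (Λ : 𝕃 → ℍ[ℝ]) (v : LTwo 𝕃) (y : TLie Λ) :
    LTwo 𝕃 :=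
  ⟨fun k => complexAct q (expUnit (y.seq k)) (point Λ v k) - Λ k, by
    have hform : ∀ (r : ℝ) (x : ℍ[ℝ]), complexAct q (expUnit r) x =
        Real.exp r • zPart q x + Real.exp (-r) • wPart q x := by
      intro r x
      have e1 : ((Complex.exp r : ℂ) : ℍ[ℝ]) = ((Real.exp r : ℝ) : ℍ[ℝ]) := by
        rw [← Complex.ofReal_exp, Quaternion.coeComplex_coe]
      have e2 : ((star ((expUnit r)⁻¹ : ℂˣ).val : ℂ) : ℍ[ℝ]) =
          ((Real.exp (-r) : ℝ) : ℍ[ℝ]) := by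
        have : (star ((expUnit r)⁻¹ : ℂˣ).val : ℂ) = ((Real.exp (-r) : ℝ) : ℂ) := by
          rw [Units.val_inv_eq_inv_val, expUnit, Units.val_mk0, ← Complex.exp_neg,
            ← Complex.ofReal_neg, ← Complex.ofReal_exp]
          exact Complex.conj_ofReal _
        rw [this, Quaternion.coeComplex_coe]
      rw [complexAct, e2, expUnit, Units.val_mk0, e1, Quaternion.coe_mul_eq_smul,
        Quaternion.coe_mul_eq_smul]
    have hdiff : ∀ k, complexAct q (expUnit (y.seq k)) (point Λ v k) - Λ k = v k +
        ((Real.exp (y.seq k) - 1) • zPart q (point Λ v k) +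
          (Real.exp (-y.seq k) - 1) • wPart q (point Λ v k)) := by
      intro k
      have hzw := zPart_add_wPart q (point Λ v k)
      have hp : Λ k = zPart q (point Λ v k) + wPart q (point Λ v k) - v k := by
        rw [hzw, point]; abel
      rw [hform]
      conv_lhs => rw [hp]
      module
    have hbound : ∀ k, ‖(Real.exp (y.seq k) - 1) • zPart q (point Λ v k) +
        (Real.exp (-y.seq k) - 1) • wPart q (point Λ v k)‖ ≤
        (2 * Real.exp ‖y‖ * (2 + ‖v‖)) * ‖toLTwo Λ y k‖ := by
      intro k
      have hy := TLie.abs_seq_le y k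
      have h1 := abs_exp_sub_one_le_mul hy
      have h2 := abs_exp_sub_one_le_mul (y := -y.seq k) (c := ‖y‖) (by rwa [abs_neg])
      rw [abs_neg] at h2
      have hs : 1 ≤ Real.sqrt (weight Λ k) := Real.one_le_sqrt.2 (one_le_weight Λ k)
      have hv : ‖v k‖ ≤ ‖v‖ := lp.norm_apply_le_norm (by norm_num) v k
      have hx : ‖point Λ v k‖ ≤ (2 + ‖v‖) * Real.sqrt (weight Λ k) := by
        refine (norm_add_le _ _).trans ?_
        have := norm_le_sqrt_weight Λ k
        nlinarith [norm_nonneg v]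
      have e : ‖toLTwo Λ y k‖ = Real.sqrt (weight Λ k) * |y.seq k| := by
        change ‖Real.sqrt (weight Λ k) * y.seq k‖ = _
        rw [norm_mul, Real.norm_eq_abs, Real.norm_eq_abs, abs_of_nonneg (Real.sqrt_nonneg _)]
      refine (norm_add_le _ _).trans ?_
      rw [norm_smul, norm_smul, Real.norm_eq_abs, Real.norm_eq_abs, e]
      have h3 := mul_le_mul h1 ((norm_zPart_le q _).trans hx) (norm_nonneg _) (by positivity)
      have h4 := mul_le_mul h2 ((norm_wPart_le q _).trans hx) (norm_nonneg _) (by positivity)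
      calc _ ≤ _ := add_le_add h3 h4
        _ = _ := by ring
    have hmem : Memℓp (fun k => (Real.exp (y.seq k) - 1) • zPart q (point Λ v k) +
        (Real.exp (-y.seq k) - 1) • wPart q (point Λ v k)) 2 := by
      rw [mem_ltwo_iff]
      have hy2 := ((mem_ltwo_iff _).1 (lp.memℓp (toLTwo Λ y))).mul_left
        ((2 * Real.exp ‖y‖ * (2 + ‖v‖)) ^ 2)
      refine Summable.of_nonneg_of_le (fun k => by positivity) (fun k => ?_) hy2
      rw [← mul_pow]
      exact pow_le_pow_left₀ (norm_nonneg _) (hbound k) 2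
    have := (lp.memℓp v).add hmem
    change Memℓp (fun k => complexAct q (expUnit (y.seq k)) (point Λ v k) - Λ k) 2
    rw [funext hdiff]
    exact this⟩

/-- The map `𝔫 → 𝔫*`, `y ↦ μ^ℝ(e^y · x)`, where `x = Λ + v`. -/
def orbitMoment {𝕃 : Type*} {n : ℕ} (q : ComplexStructure) (Λ : 𝕃 → ℍ[ℝ])
    (u : 𝕃 → Fin n → ℤ) (v : LTwo 𝕃) (y : nLie Λ u) : StrongDual ℝ (nLie Λ u) :=
  realMoment q Λ u (expMove q Λ v (y : TLie Λ))

/-! ### Quotients and diffeomorphisms -/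

/-- The `N`-orbits in the hyperkähler zero locus. -/
def hyperSetoid {𝕃 : Type*} {n : ℕ} (Λ : 𝕃 → ℍ[ℝ]) (u : 𝕃 → Fin n → ℤ) :
    Setoid (hyperZero Λ u) where
  r v v' := NRel Λ u v v'
  iseqv := ⟨fun v => (NRel.equivalence Λ u).refl v, fun h => (NRel.equivalence Λ u).symm h,
    fun h h' => (NRel.equivalence Λ u).trans h h'⟩

/-- The `N^ℂ`-orbits in the complex zero locus. -/
def complexSetoid {𝕃 : Type*} {n : ℕ} (q : ComplexStructure) (Λ : 𝕃 → ℍ[ℝ])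
    (u : 𝕃 → Fin n → ℤ) : Setoid (complexZero q Λ u) where
  r v v' := NCRel q Λ u v v'
  iseqv := ⟨fun v => (NCRel.equivalence q Λ u).refl v,
    fun h => (NCRel.equivalence q Λ u).symm h,
    fun h h' => (NCRel.equivalence q Λ u).trans h h'⟩

/-- The hyperkähler quotient `M(β, λ) = μ⁻¹(0) / N`, with the quotient topology. -/
abbrev HyperQuotient {𝕃 : Type*} {n : ℕ} (Λ : 𝕃 → ℍ[ℝ]) (u : 𝕃 → Fin n → ℤ) : Type _ :=
  Quotient (hyperSetoid Λ u)

/-- The complex quotient `(μ^ℂ)⁻¹(0) / N^ℂ` for the complex structure `q`, with the quotient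
topology. -/
abbrev ComplexQuotient {𝕃 : Type*} {n : ℕ} (q : ComplexStructure) (Λ : 𝕃 → ℍ[ℝ])
    (u : 𝕃 → Fin n → ℤ) : Type _ :=
  Quotient (complexSetoid q Λ u)

/-- The smooth structure of a quotient of a subset `S` of a normed space `V`: a function `f` on
the quotient is smooth on `U` if its pull-back to the part of `S` over `U` is smooth, that is,
locally the restriction of a `C^∞` function on an open subset of `V`. -/
def QuotSmoothOn {V : Type*} [NormedAddCommGroup V] [NormedSpace ℝ V] {S : Set V}
    (s : Setoid S) (f : Quotient s → ℝ) (U : Set (Quotient s)) : Prop :=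
  ∀ x : S, Quotient.mk s x ∈ U → ∃ W : Set V, IsOpen W ∧ (x : V) ∈ W ∧
    ∃ F : V → ℝ, ContDiffOn ℝ ∞ F W ∧
      ∀ y : S, (y : V) ∈ W → Quotient.mk s y ∈ U → f (Quotient.mk s y) = F y

/-- A homeomorphism of quotients is a diffeomorphism if, over every open set, it identifies the
smooth functions. -/
def IsDiffeo {V V' : Type*} [NormedAddCommGroup V] [NormedSpace ℝ V] [NormedAddCommGroup V']
    [NormedSpace ℝ V'] {S : Set V} {S' : Set V'} {s : Setoid S} {s' : Setoid S'}
    (φ : Quotient s ≃ₜ Quotient s') : Prop :=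
  ∀ U : Set (Quotient s'), IsOpen U → ∀ f : Quotient s' → ℝ,
    QuotSmoothOn s' f U ↔ QuotSmoothOn s (f ∘ φ) (φ ⁻¹' U)

/-- When the quotients carry structures of smooth manifolds with these smooth functions, as a
hyperkähler quotient by a free action does, this is the usual notion of a diffeomorphism. -/
theorem IsDiffeo.contMDiff {V V' : Type*} [NormedAddCommGroup V] [NormedSpace ℝ V]
    [NormedAddCommGroup V'] [NormedSpace ℝ V'] {S : Set V} {S' : Set V'} {s : Setoid S}
    {s' : Setoid S'} {φ : Quotient s ≃ₜ Quotient s'} (hφ : IsDiffeo φ) {m : ℕ}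
    [ChartedSpace (EuclideanSpace ℝ (Fin m)) (Quotient s)]
    [ChartedSpace (EuclideanSpace ℝ (Fin m)) (Quotient s')]
    [IsManifold (modelWithCornersSelf ℝ (EuclideanSpace ℝ (Fin m))) ∞ (Quotient s)]
    [IsManifold (modelWithCornersSelf ℝ (EuclideanSpace ℝ (Fin m))) ∞ (Quotient s')]
    (hs : ∀ (f : Quotient s → ℝ) (U : Set (Quotient s)), IsOpen U →
      (ContMDiffOn (modelWithCornersSelf ℝ (EuclideanSpace ℝ (Fin m)))
        (modelWithCornersSelf ℝ ℝ) ∞ f U ↔ QuotSmoothOn s f U))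
    (hs' : ∀ (f : Quotient s' → ℝ) (U : Set (Quotient s')), IsOpen U →
      (ContMDiffOn (modelWithCornersSelf ℝ (EuclideanSpace ℝ (Fin m)))
        (modelWithCornersSelf ℝ ℝ) ∞ f U ↔ QuotSmoothOn s' f U)) :
    ContMDiff (modelWithCornersSelf ℝ (EuclideanSpace ℝ (Fin m)))
      (modelWithCornersSelf ℝ (EuclideanSpace ℝ (Fin m))) ∞ φ := by
  intro p
  rw [contMDiffAt_iff_target]
  refine ⟨φ.continuous.continuousAt, ?_⟩
  set e := extChartAt (modelWithCornersSelf ℝ (EuclideanSpace ℝ (Fin m))) (φ p) with he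
  have hopen : IsOpen e.source := isOpen_extChartAt_source (φ p)
  have hp : φ p ∈ e.source := mem_extChartAt_source (φ p)
  have hcomp : ∀ i : Fin m, ContMDiffAt (modelWithCornersSelf ℝ (EuclideanSpace ℝ (Fin m)))
      (modelWithCornersSelf ℝ ℝ) ∞ (fun x => e (φ x) i) p := by
    intro i
    have h1 : ContMDiffOn (modelWithCornersSelf ℝ (EuclideanSpace ℝ (Fin m)))
        (modelWithCornersSelf ℝ ℝ) ∞ (fun x => e x i) e.source := by
      have h2 := contMDiffOn_extChartAt (I := modelWithCornersSelf ℝ (EuclideanSpace ℝ (Fin m)))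
        (n := ∞) (x := φ p)
      have h3 : ContMDiff (modelWithCornersSelf ℝ (EuclideanSpace ℝ (Fin m)))
          (modelWithCornersSelf ℝ ℝ) ∞ (fun x : EuclideanSpace ℝ (Fin m) => x i) :=
        (EuclideanSpace.proj (𝕜 := ℝ) i).contDiff.contMDiff
      rw [he, extChartAt_source]
      exact h3.comp_contMDiffOn h2
    have h4 := (hs _ _ (hopen.preimage φ.continuous)).2
      ((hφ _ hopen _).1 ((hs' _ _ hopen).1 h1))
    exact h4.contMDiffAt ((hopen.preimage φ.continuous).mem_nhds hp)
  have h5 : ContMDiffAt (modelWithCornersSelf ℝ (EuclideanSpace ℝ (Fin m)))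
      (modelWithCornersSelf ℝ (Fin m → ℝ)) ∞ (fun x => fun i => e (φ x) i) p :=
    contMDiffAt_pi_space.2 hcomp
  exact ((EuclideanSpace.equiv (Fin m) ℝ).symm.contDiff.contMDiff.contMDiffAt).comp p h5

theorem IsDiffeo.symm {V V' : Type*} [NormedAddCommGroup V] [NormedSpace ℝ V]
    [NormedAddCommGroup V'] [NormedSpace ℝ V'] {S : Set V} {S' : Set V'} {s : Setoid S}
    {s' : Setoid S'} {φ : Quotient s ≃ₜ Quotient s'} (hφ : IsDiffeo φ) : IsDiffeo φ.symm := by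
  intro U hU f
  have h := hφ (φ.symm ⁻¹' U) (hU.preimage φ.symm.continuous) (f ∘ φ.symm)
  have e1 : (f ∘ φ.symm) ∘ φ = f := by ext x; simp
  have e2 : φ ⁻¹' (φ.symm ⁻¹' U) = U := by ext x; simp
  rw [e1, e2] at h
  exact h.symm

/-- `M(β, λ)` and `M(β, λ')` are diffeomorphic. -/
def Diffeomorphic {𝕃 : Type*} {n : ℕ} (Λ Λ' : 𝕃 → ℍ[ℝ]) (u : 𝕃 → Fin n → ℤ) : Prop :=
  ∃ φ : HyperQuotient Λ u ≃ₜ HyperQuotient Λ' u, IsDiffeo φ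

/-! ### Hypotheses -/

/-- The complex flat `H_{k,ℂ}` for the complex structure `q`: the `ℝ`-linear maps `b` from `ℝⁿ`
to the complex line orthogonal to `q` such that `b(u_k)` is the complex part of `λ_k`. -/
def complexFlat {𝕃 : Type*} {n : ℕ} (q : ComplexStructure) (Λ : 𝕃 → ℍ[ℝ])
    (u : 𝕃 → Fin n → ℤ) (k : 𝕃) : Set ((Fin n → ℝ) →ₗ[ℝ] complexLine q) :=
  {b | (b (realVec u k) : ℍ[ℝ]) = transverse q (lam Λ k)}

/-- Each set of `n + 1` complex flats has empty intersection. -/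
def FlatsGeneric {𝕃 : Type*} {n : ℕ} (q : ComplexStructure) (Λ : 𝕃 → ℍ[ℝ])
    (u : 𝕃 → Fin n → ℤ) : Prop :=
  ∀ J : Finset 𝕃, J.card = n + 1 → ⋂ k ∈ J, complexFlat q Λ u k = ∅

/-- The growth rates of `Λ_z` and `Λ_w` are commensurable. -/
def Commensurable {𝕃 : Type*} (q : ComplexStructure) (Λ : 𝕃 → ℍ[ℝ]) : Prop :=
  ∃ C₁ C₂ : ℝ, 0 < C₁ ∧ 0 < C₂ ∧ ∀ᶠ k in cofinite,
    C₁ * ‖wPart q (Λ k)‖ ≤ ‖zPart q (Λ k)‖ ∧ ‖zPart q (Λ k)‖ ≤ C₂ * ‖wPart q (Λ k)‖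

/-- `u` is a primitive vector of `ℤⁿ`. -/
def Primitive {n : ℕ} (u : Fin n → ℤ) : Prop :=
  u ≠ 0 ∧ ∀ m : ℤ, 1 < m → ¬ ∃ v : Fin n → ℤ, u = m • v

end Hypertoric

end

/-!
Write `x = z + w` for the decomposition of `x ∈ ℍ` with respect to the complex structure `q`. The
real part of `x̄ i x` is `|z|² - |w|²` and its complex part is `2 w̄ z q`, so that the real moment
map at `e^y · x` is the sum over `k` of `λ_k^ℝ + ½ (|z_k|² e^{2 y_k} - |w_k|² e^{-2 y_k})`.

Everything rests on one inequality: along the `N^ℂ`-orbit of a point of the complex zero locus,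
`y ↦ μ^ℝ(e^y · x)` is *strongly* monotone (`exists_stronglyMonotone`). Termwise, the sum is bounded
below by `min(|z_k|², |w_k|²) (y_k - y'_k)²`. Since `Λ_z` and `Λ_w` have commensurable growth, this
minimum is comparable with the weight `1 + |λ_k|` up to finitely many `k`
(`exists_eventually_weight_le`), and it vanishes only if `z_k = 0` or `w_k = 0`. As the complex
moment map vanishes on `𝔫 = ker β`, it factors through a linear map `b` on `ℝⁿ`
(`exists_linearMap_of_mem_complexZero`), and the indices with `z_k = 0` or `w_k = 0` are those for
which the flat `H_{k,ℂ}` contains `b`. General position makes the corresponding `u_k` linearly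
independent (`linearIndepOn_of_flatsGeneric`); hence for `y ∈ 𝔫` the coordinates at these finitely
many indices are controlled by the others through `β(y) = 0`, and the quadratic form
`∑ min(|z_k|², |w_k|²) y_k²` is coercive on `𝔫` (`exists_coercive`).

The action and the moment map are smooth on the Hilbert space `L²(ℍ)`, because `y ↦ e^y - 1` is a
smooth map of `𝔱_λ` and everything else is built from bounded bilinear maps (`contDiff_expMove`,
`contDiff_realMoment`). A smooth strongly monotone map from a Hilbert space to its dual is
bijective: its derivative is invertible by the Lax–Milgram theorem, so that its range is open, and
the range is closed by monotonicity (`surjective_of_stronglyMonotone`). Together with the polar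
decomposition `N^ℂ = N · exp(i 𝔫)`, this shows that each `N^ℂ`-orbit in the complex zero locus meets
each level set of the real moment map in exactly one `N`-orbit. By the implicit function theorem the
solution of `μ^ℝ(e^y · x) = 0` extends to a smooth function of `x ∈ M_Λ`. Moving along the orbits by
this solution is a local smooth map to the hyperkähler zero locus (`exists_smooth_retraction`), and
therefore the bijection of the quotients is a diffeomorphism (`isDiffeo_quotientHomeo`).

The complex quotient depends, up to diffeomorphism, only on the complex part of the parameters: if
`λ'` is the complex part of `λ`, then `Λ'` is, up to finitely many terms, the transform of `Λ` by a
bounded sequence in `ℂ*` (`exists_gauge_of_lam_eq_transverse`). This sequence acts on the ambient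
spaces by an invertible affine map which carries the complex zero loci and the orbits into each
other, and the diffeomorphism of the hyperkähler quotients results from those with the complex
quotients (`diffeomorphic_of_lam_eq_transverse`).
-/

noncomputable section

namespace Hypertoric

section

/-! ### Quaternionic algebra of a complex structure -/

theorem complexStructure_re (q : ComplexStructure) : (q : ℍ[ℝ]).re = 0 := by
  have h := q.2
  have h0 := congrArg (·.re) h
  have h1 := congrArg (·.imI) h
  have h2 := congrArg (·.imJ) h
  have h3 := congrArg (·.imK) h
  simp only [Quaternion.re_mul, Quaternion.imI_mul, Quaternion.imJ_mul, Quaternion.imK_mul,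
    Quaternion.re_neg, Quaternion.imI_neg, Quaternion.imJ_neg, Quaternion.imK_neg,
    Quaternion.re_one, Quaternion.imI_one, Quaternion.imJ_one, Quaternion.imK_one] at h0 h1 h2 h3
  by_contra hne
  have e1 : (q : ℍ[ℝ]).imI = 0 := by
    have : (q : ℍ[ℝ]).re * (q : ℍ[ℝ]).imI = 0 := by linarith
    exact (mul_eq_zero.1 this).resolve_left hne
  have e2 : (q : ℍ[ℝ]).imJ = 0 := by
    have : (q : ℍ[ℝ]).re * (q : ℍ[ℝ]).imJ = 0 := by linarith
    exact (mul_eq_zero.1 this).resolve_left hne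
  have e3 : (q : ℍ[ℝ]).imK = 0 := by
    have : (q : ℍ[ℝ]).re * (q : ℍ[ℝ]).imK = 0 := by linarith
    exact (mul_eq_zero.1 this).resolve_left hne
  rw [e1, e2, e3] at h0
  nlinarith [sq_nonneg (q : ℍ[ℝ]).re]

theorem star_complexStructure (q : ComplexStructure) : star (q : ℍ[ℝ]) = -(q : ℍ[ℝ]) :=
  Quaternion.star_eq_neg.2 (complexStructure_re q)

theorem star_unitI : star unitI = -unitI := star_complexStructure structI

theorem unitI_mul_zPart (q : ComplexStructure) (x : ℍ[ℝ]) :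
    unitI * zPart q x = zPart q x * q := by
  rw [zPart, mul_smul_comm, smul_mul_assoc]
  congr 1
  calc unitI * (x - unitI * x * q) = unitI * x - (unitI * unitI) * x * q := by noncomm_ring
    _ = x * q - unitI * x * (q * q : ℍ[ℝ]) := by rw [unitI_mul_unitI, q.2]; noncomm_ring
    _ = _ := by noncomm_ring

theorem unitI_mul_wPart (q : ComplexStructure) (x : ℍ[ℝ]) :
    unitI * wPart q x = -(wPart q x * q) := by
  rw [wPart, mul_smul_comm, smul_mul_assoc, ← smul_neg]
  congr 1
  calc unitI * (x + unitI * x * q) = unitI * x + (unitI * unitI) * x * q := by noncomm_ring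
    _ = -(x * q + unitI * x * (q * q : ℍ[ℝ])) := by rw [unitI_mul_unitI, q.2]; noncomm_ring
    _ = _ := by noncomm_ring

theorem zPart_smul (q : ComplexStructure) (c : ℝ) (x : ℍ[ℝ]) : zPart q (c • x) = c • zPart q x := by
  rw [← Quaternion.coe_mul_eq_smul, ← Quaternion.coe_mul_eq_smul, ← Quaternion.coeComplex_coe,
    zPart_coe_mul]

theorem wPart_smul (q : ComplexStructure) (c : ℝ) (x : ℍ[ℝ]) : wPart q (c • x) = c • wPart q x := by
  rw [← Quaternion.coe_mul_eq_smul, ← Quaternion.coe_mul_eq_smul, ← Quaternion.coeComplex_coe,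
    wPart_coe_mul]

theorem norm_unitI_mul_mul (q : ComplexStructure) (x : ℍ[ℝ]) : ‖unitI * x * q‖ = ‖x‖ := by
  rw [norm_mul, norm_mul, norm_unitI, norm_complexStructure]; ring

/-- The decomposition `x = z + w` is orthogonal. -/
theorem inner_zPart_wPart (q : ComplexStructure) (x : ℍ[ℝ]) :
    inner ℝ (zPart q x) (wPart q x) = 0 := by
  rw [zPart, wPart, inner_smul_left, inner_smul_right, inner_sub_left, inner_add_right,
    inner_add_right, real_inner_self_eq_norm_sq, real_inner_self_eq_norm_sq,
    norm_unitI_mul_mul, real_inner_comm x]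
  simp only [map_div₀, map_one, conj_trivial]
  ring

theorem norm_sq_zPart_add_norm_sq_wPart (q : ComplexStructure) (x : ℍ[ℝ]) :
    ‖zPart q x‖ ^ 2 + ‖wPart q x‖ ^ 2 = ‖x‖ ^ 2 := by
  conv_rhs => rw [← zPart_add_wPart q x]
  rw [norm_add_sq_real, inner_zPart_wPart]; ring

/-- `w̄ z` is an imaginary quaternion, as `z` and `w` are orthogonal. -/
theorem star_zPart_mul_wPart (q : ComplexStructure) (x : ℍ[ℝ]) :
    star (zPart q x) * wPart q x = -(star (wPart q x) * zPart q x) := by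
  have h : (star (wPart q x) * zPart q x).re = 0 := by
    have := inner_zPart_wPart q x
    rw [Quaternion.inner_def] at this
    refine Eq.trans ?_ this
    simp; ring
  have h2 := Quaternion.star_eq_neg.2 h
  rwa [star_mul, star_star] at h2

/-- The quadratic map of the moment map in terms of `x = z + w`. -/
theorem star_mul_unitI_mul (q : ComplexStructure) (x : ℍ[ℝ]) :
    star x * unitI * x = (‖zPart q x‖ ^ 2 - ‖wPart q x‖ ^ 2) • (q : ℍ[ℝ]) +
      (2 : ℝ) • (star (wPart q x) * zPart q x * q) := by
  have hz : star (zPart q x) * zPart q x = ((‖zPart q x‖ ^ 2 : ℝ) : ℍ[ℝ]) := by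
    rw [Quaternion.star_mul_self, Quaternion.normSq_eq_norm_mul_self, sq]
  have hw : star (wPart q x) * wPart q x = ((‖wPart q x‖ ^ 2 : ℝ) : ℍ[ℝ]) := by
    rw [Quaternion.star_mul_self, Quaternion.normSq_eq_norm_mul_self, sq]
  have hzw := star_zPart_mul_wPart q x
  set z := zPart q x with hzdef
  set w := wPart q x with hwdef
  have hx : x = z + w := (zPart_add_wPart q x).symm
  have h1 : unitI * z = z * q := unitI_mul_zPart q x
  have h2 : unitI * w = -(w * q) := unitI_mul_wPart q x
  calc star x * unitI * x = (star z + star w) * (unitI * z + unitI * w) := by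
        rw [hx, star_add]; noncomm_ring
    _ = star z * z * q - star w * w * q - star z * w * q + star w * z * q := by
        rw [h1, h2]; noncomm_ring
    _ = _ := by
        rw [hz, hw, hzw, Quaternion.coe_mul_eq_smul, Quaternion.coe_mul_eq_smul, sub_smul,
          two_smul]
        noncomm_ring

theorem inner_mul_complexStructure (q : ComplexStructure) (p : ℍ[ℝ]) :
    inner ℝ (q : ℍ[ℝ]) (p * q) = p.re := by
  rw [Quaternion.inner_def, star_mul, ← mul_assoc, star_complexStructure, mul_neg, q.2]
  simp

/-- The real part of the quadratic map is `|z|² - |w|²`. -/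
theorem inner_star_mul_unitI_mul (q : ComplexStructure) (x : ℍ[ℝ]) :
    inner ℝ (q : ℍ[ℝ]) (star x * unitI * x) = ‖zPart q x‖ ^ 2 - ‖wPart q x‖ ^ 2 := by
  have h : (star (wPart q x) * zPart q x).re = 0 := by
    have := star_zPart_mul_wPart q x
    apply Quaternion.star_eq_neg.1
    rw [star_mul, star_star, this]
  rw [star_mul_unitI_mul q x, inner_add_right, inner_smul_right, inner_smul_right,
    inner_mul_complexStructure, h, real_inner_self_eq_norm_sq, norm_complexStructure]
  ring

/-- The complex part of the quadratic map is `2 w̄ z q`. -/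
theorem transverse_star_mul_unitI_mul (q : ComplexStructure) (x : ℍ[ℝ]) :
    transverse q (star x * unitI * x) = (2 : ℝ) • (star (wPart q x) * zPart q x * q) := by
  rw [transverse, inner_star_mul_unitI_mul]
  nth_rewrite 1 [star_mul_unitI_mul q x]
  abel

theorem transverse_add (q : ComplexStructure) (a b : ℍ[ℝ]) :
    transverse q (a + b) = transverse q a + transverse q b := by
  rw [transverse, transverse, transverse, inner_add_right, add_smul]; abel

theorem transverse_smul (q : ComplexStructure) (c : ℝ) (a : ℍ[ℝ]) :
    transverse q (c • a) = c • transverse q a := by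
  rw [transverse, transverse, inner_smul_right, smul_sub, smul_smul]

theorem inner_transverse (q : ComplexStructure) (p : ℍ[ℝ]) :
    inner ℝ (q : ℍ[ℝ]) (transverse q p) = 0 := by
  rw [transverse, inner_sub_right, inner_smul_right, real_inner_self_eq_norm_sq,
    norm_complexStructure]
  ring

theorem transverse_transverse (q : ComplexStructure) (p : ℍ[ℝ]) :
    transverse q (transverse q p) = transverse q p := by
  conv_lhs => rw [transverse, inner_transverse]
  simp

theorem transverse_mem_complexLine (q : ComplexStructure) {p : ℍ[ℝ]} (hp : p.re = 0) :
    transverse q p ∈ complexLine q := by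
  rw [complexLine, Submodule.mem_orthogonal]
  intro y hy
  rw [Submodule.mem_span_pair] at hy
  obtain ⟨a, b, rfl⟩ := hy
  rw [inner_add_left, inner_smul_left, inner_smul_left, inner_transverse]
  have : inner ℝ (1 : ℍ[ℝ]) (transverse q p) = 0 := by
    rw [Quaternion.inner_def, one_mul, Quaternion.re_star, transverse, Quaternion.re_sub,
      Quaternion.re_smul, complexStructure_re, hp]
    simp
  rw [this]; simp

theorem star_mul_unitI_mul_re (x : ℍ[ℝ]) : (star x * unitI * x).re = 0 := by
  apply Quaternion.star_eq_neg.1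
  rw [star_mul, star_mul, star_star, star_unitI]
  noncomm_ring

theorem lam_re {𝕃 : Type*} (Λ : 𝕃 → ℍ[ℝ]) (k : 𝕃) : (lam Λ k).re = 0 := by
  rw [lam, Quaternion.re_neg, Quaternion.re_smul, star_mul_unitI_mul_re]; simp

theorem norm_lam {𝕃 : Type*} (Λ : 𝕃 → ℍ[ℝ]) (k : 𝕃) : ‖lam Λ k‖ = 1 / 2 * ‖Λ k‖ ^ 2 := by
  rw [lam, norm_neg, norm_smul, norm_mul, norm_mul, norm_unitI, norm_star,
    Real.norm_of_nonneg (by norm_num)]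
  ring

theorem momentCoeff_re {𝕃 : Type*} (Λ : 𝕃 → ℍ[ℝ]) (v : LTwo 𝕃) (k : 𝕃) :
    (momentCoeff Λ v k).re = 0 := by
  rw [momentCoeff, Quaternion.re_add, lam_re, Quaternion.re_smul, star_mul_unitI_mul_re]; simp

theorem inner_momentCoeff {𝕃 : Type*} (q : ComplexStructure) (Λ : 𝕃 → ℍ[ℝ]) (v : LTwo 𝕃)
    (k : 𝕃) : inner ℝ (q : ℍ[ℝ]) (momentCoeff Λ v k) = inner ℝ (q : ℍ[ℝ]) (lam Λ k) +
      1 / 2 * (‖zPart q (point Λ v k)‖ ^ 2 - ‖wPart q (point Λ v k)‖ ^ 2) := by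
  rw [momentCoeff, inner_add_right, inner_smul_right, inner_star_mul_unitI_mul]

theorem transverse_momentCoeff {𝕃 : Type*} (q : ComplexStructure) (Λ : 𝕃 → ℍ[ℝ])
    (v : LTwo 𝕃) (k : 𝕃) : transverse q (momentCoeff Λ v k) = transverse q (lam Λ k) +
      star (wPart q (point Λ v k)) * zPart q (point Λ v k) * q := by
  rw [momentCoeff, transverse_add, transverse_smul, transverse_star_mul_unitI_mul, smul_smul]
  norm_num

theorem transverse_lam {𝕃 : Type*} (q : ComplexStructure) (Λ : 𝕃 → ℍ[ℝ]) (k : 𝕃) :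
    transverse q (lam Λ k) = -(star (wPart q (Λ k)) * zPart q (Λ k) * q) := by
  have h : lam Λ k = (-(1 / 2) : ℝ) • (star (Λ k) * unitI * Λ k) := by rw [lam, neg_smul]
  rw [h, transverse_smul, transverse_star_mul_unitI_mul, smul_smul]
  norm_num

theorem inner_lam {𝕃 : Type*} (q : ComplexStructure) (Λ : 𝕃 → ℍ[ℝ]) (k : 𝕃) :
    inner ℝ (q : ℍ[ℝ]) (lam Λ k) =
      -(1 / 2) * (‖zPart q (Λ k)‖ ^ 2 - ‖wPart q (Λ k)‖ ^ 2) := by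
  have h : lam Λ k = (-(1 / 2) : ℝ) • (star (Λ k) * unitI * Λ k) := by rw [lam, neg_smul]
  rw [h, inner_smul_right, inner_star_mul_unitI_mul]

/-! ### The complexified action on a single quaternion -/

theorem zPart_complexAct (q : ComplexStructure) (c : ℂˣ) (x : ℍ[ℝ]) :
    zPart q (complexAct q c x) = ((c : ℂ) : ℍ[ℝ]) * zPart q x := by
  rw [complexAct, zPart_add, zPart_coe_mul, zPart_coe_mul, zPart_zPart, zPart_wPart]; simp

theorem wPart_complexAct (q : ComplexStructure) (c : ℂˣ) (x : ℍ[ℝ]) :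
    wPart q (complexAct q c x) = ((star ((c⁻¹ : ℂˣ) : ℂ) : ℂ) : ℍ[ℝ]) * wPart q x := by
  rw [complexAct, wPart_add, wPart_coe_mul, wPart_coe_mul, wPart_wPart, wPart_zPart]; simp

theorem star_coeComplex (c : ℂ) : star (c : ℍ[ℝ]) = ((star c : ℂ) : ℍ[ℝ]) := by
  ext <;> simp

theorem norm_coeComplex (c : ℂ) : ‖(c : ℍ[ℝ])‖ = ‖c‖ := by
  have h : ‖(c : ℍ[ℝ])‖ ^ 2 = ‖c‖ ^ 2 := by
    rw [sq, ← Quaternion.normSq_eq_norm_mul_self, ← Complex.normSq_eq_norm_sq,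
      Quaternion.normSq_def', Complex.normSq_apply]
    simp; ring
  exact (sq_eq_sq₀ (norm_nonneg _) (norm_nonneg _)).1 h

/-- The complexified action preserves the complex moment map. -/
theorem star_wPart_mul_zPart_complexAct (q : ComplexStructure) (c : ℂˣ) (x : ℍ[ℝ]) :
    star (wPart q (complexAct q c x)) * zPart q (complexAct q c x) =
      star (wPart q x) * zPart q x := by
  rw [zPart_complexAct, wPart_complexAct, star_mul, star_coeComplex, star_star, mul_assoc,
    ← mul_assoc (((c⁻¹ : ℂˣ) : ℂ) : ℍ[ℝ]), ← Quaternion.coeComplex_mul]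
  simp

theorem complexAct_expUnit (q : ComplexStructure) (r : ℝ) (x : ℍ[ℝ]) :
    complexAct q (expUnit r) x = Real.exp r • zPart q x + Real.exp (-r) • wPart q x := by
  have e1 : ((Complex.exp r : ℂ) : ℍ[ℝ]) = ((Real.exp r : ℝ) : ℍ[ℝ]) := by
    rw [← Complex.ofReal_exp, Quaternion.coeComplex_coe]
  have e2 : ((star ((expUnit r)⁻¹ : ℂˣ).val : ℂ) : ℍ[ℝ]) = ((Real.exp (-r) : ℝ) : ℍ[ℝ]) := by
    have : (star ((expUnit r)⁻¹ : ℂˣ).val : ℂ) = ((Real.exp (-r) : ℝ) : ℂ) := by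
      rw [Units.val_inv_eq_inv_val, expUnit, Units.val_mk0, ← Complex.exp_neg,
        ← Complex.ofReal_neg, ← Complex.ofReal_exp]
      exact Complex.conj_ofReal _
    rw [this, Quaternion.coeComplex_coe]
  rw [complexAct, e2, expUnit, Units.val_mk0, e1, Quaternion.coe_mul_eq_smul,
    Quaternion.coe_mul_eq_smul]

/-- For unit complex numbers the complexified action is left multiplication. -/
theorem complexAct_of_norm_eq_one (q : ComplexStructure) {c : ℂˣ} (hc : ‖(c : ℂ)‖ = 1)
    (x : ℍ[ℝ]) : complexAct q c x = ((c : ℂ) : ℍ[ℝ]) * x := by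
  have h : star ((c⁻¹ : ℂˣ) : ℂ) = (c : ℂ) := by
    rw [Units.val_inv_eq_inv_val, Complex.inv_def, Complex.normSq_eq_norm_sq, hc]
    simp
  rw [complexAct, h, ← mul_add, zPart_add_wPart]

theorem complexAct_add (q : ComplexStructure) (c : ℂˣ) (x y : ℍ[ℝ]) :
    complexAct q c (x + y) = complexAct q c x + complexAct q c y := by
  simp only [complexAct, zPart_add, wPart_add, mul_add]
  abel

theorem norm_complexAct_le (q : ComplexStructure) (c : ℂˣ) (x : ℍ[ℝ]) :
    ‖complexAct q c x‖ ≤ (‖(c : ℂ)‖ + ‖(c : ℂ)‖⁻¹) * ‖x‖ := by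
  rw [complexAct]
  refine (norm_add_le _ _).trans ?_
  rw [norm_mul, norm_mul, norm_coeComplex, norm_coeComplex, norm_star,
    Units.val_inv_eq_inv_val, norm_inv, add_mul]
  gcongr
  · exact norm_zPart_le q x
  · exact norm_wPart_le q x

/-- Two points with nonzero `z`- and `w`-parts and the same complex moment lie in the same
`ℂ*`-orbit. -/
theorem exists_complexAct_eq (q : ComplexStructure) {x x' : ℍ[ℝ]} (hz : zPart q x ≠ 0)
    (hz' : zPart q x' ≠ 0)
    (h : star (wPart q x') * zPart q x' = star (wPart q x) * zPart q x) :
    ∃ c : ℂˣ, complexAct q c x = x' ∧ ‖(c : ℂ)‖ * ‖zPart q x‖ = ‖zPart q x'‖ := by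
  set p : ℍ[ℝ] := zPart q x' * (zPart q x)⁻¹ with hp
  have hpz : p * zPart q x = zPart q x' := by rw [hp, inv_mul_cancel_right₀ hz]
  have hcomm : unitI * p = p * unitI := by
    apply mul_right_cancel₀ hz
    rw [mul_assoc, hpz, unitI_mul_zPart, mul_assoc, unitI_mul_zPart, ← mul_assoc, hpz]
  have hJ : p.imJ = 0 := by
    have := congrArg (·.imK) hcomm
    simp at this; linarith
  have hK : p.imK = 0 := by
    have := congrArg (·.imJ) hcomm
    simp at this; linarith
  obtain ⟨c, hc⟩ : ∃ c : ℂ, (c : ℍ[ℝ]) = p :=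
    ⟨⟨p.re, p.imI⟩, by ext <;> simp [hJ, hK]⟩
  have hp0 : p ≠ 0 := mul_ne_zero hz' (inv_ne_zero hz)
  have hc0 : c ≠ 0 := by
    rintro rfl
    exact hp0 (by rw [← hc]; simp)
  refine ⟨Units.mk0 c hc0, ?_, ?_⟩
  · have hw : ((star (c⁻¹) : ℂ) : ℍ[ℝ]) * wPart q x = wPart q x' := by
      apply star_injective
      apply mul_right_cancel₀ hz'
      rw [h, star_mul, star_coeComplex, star_star, mul_assoc, ← hpz, ← hc,
        ← mul_assoc ((c⁻¹ : ℂ) : ℍ[ℝ]), ← Quaternion.coeComplex_mul, inv_mul_cancel₀ hc0]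
      simp
    rw [complexAct, Units.val_inv_eq_inv_val, Units.val_mk0, hw, hc, hpz, zPart_add_wPart]
  · rw [Units.val_mk0, ← norm_coeComplex, hc, ← norm_mul, hpz]

end

section

/-! ### The Hilbert space of the torus and pointwise multiplication operators -/

variable {𝕃 : Type*}

theorem memℓp_two_of_norm_le {E F : Type*} [NormedAddCommGroup E] [NormedAddCommGroup F]
    {f : 𝕃 → E} (g : lp (fun _ : 𝕃 => F) 2) {C : ℝ} (h : ∀ k, ‖f k‖ ≤ C * ‖g k‖) :
    Memℓp f 2 := by
  rw [mem_ltwo_iff]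
  refine Summable.of_nonneg_of_le (fun k => by positivity) (fun k => ?_)
    (((mem_ltwo_iff _).1 (lp.memℓp g)).mul_left (C ^ 2))
  rw [← mul_pow]
  exact pow_le_pow_left₀ (norm_nonneg _) (h k) 2

theorem hasSum_norm_sq {E : Type*} [NormedAddCommGroup E] (f : lp (fun _ : 𝕃 => E) 2) :
    HasSum (fun k => ‖f k‖ ^ 2) (‖f‖ ^ 2) := by
  have h := lp.hasSum_norm (p := 2) (by norm_num) f
  simpa using h

theorem lp_norm_le_of_norm_le {E F : Type*} [NormedAddCommGroup E] [NormedAddCommGroup F]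
    (f : lp (fun _ : 𝕃 => E) 2) (g : lp (fun _ : 𝕃 => F) 2) {C : ℝ} (hC : 0 ≤ C)
    (h : ∀ k, ‖f k‖ ≤ C * ‖g k‖) : ‖f‖ ≤ C * ‖g‖ := by
  refine abs_le_of_sq_le_sq' ?_ (by positivity) |>.2
  rw [mul_pow]
  refine hasSum_le (fun k => ?_) (hasSum_norm_sq f) ((hasSum_norm_sq g).mul_left (C ^ 2))
  rw [← mul_pow]
  exact pow_le_pow_left₀ (norm_nonneg _) (h k) 2

theorem norm_apply_le (v : LTwo 𝕃) (k : 𝕃) : ‖v k‖ ≤ ‖v‖ :=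
  lp.norm_apply_le_norm (by norm_num) v k

variable (Λ : 𝕃 → ℍ[ℝ])

theorem weight_pos (k : 𝕃) : 0 < weight Λ k := one_pos.trans_le (one_le_weight Λ k)

theorem one_le_sqrt_weight (k : 𝕃) : 1 ≤ Real.sqrt (weight Λ k) :=
  Real.one_le_sqrt.2 (one_le_weight Λ k)

theorem norm_point_le (v : LTwo 𝕃) (k : 𝕃) :
    ‖point Λ v k‖ ≤ (2 + ‖v‖) * Real.sqrt (weight Λ k) := by
  refine (norm_add_le _ _).trans ?_
  nlinarith [norm_nonneg v, one_le_sqrt_weight Λ k, norm_le_sqrt_weight Λ k, norm_apply_le v k]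

theorem toLTwo_apply (t : TLie Λ) (k : 𝕃) :
    toLTwo Λ t k = Real.sqrt (weight Λ k) * t.seq k := rfl

theorem norm_toLTwo_apply (t : TLie Λ) (k : 𝕃) :
    ‖toLTwo Λ t k‖ = Real.sqrt (weight Λ k) * |t.seq k| := by
  rw [toLTwo_apply, norm_mul, Real.norm_eq_abs, Real.norm_eq_abs,
    abs_of_nonneg (Real.sqrt_nonneg _)]

variable {Λ}

theorem TLie.ext {s t : TLie Λ} (h : ∀ k, s.seq k = t.seq k) : s = t :=
  Subtype.ext (funext h)

@[simp] theorem TLie.seq_sub (s t : TLie Λ) (k : 𝕃) :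
    (s - t).seq k = s.seq k - t.seq k := rfl

theorem TLie.hasSum_norm_sq (t : TLie Λ) :
    HasSum (fun k => weight Λ k * t.seq k ^ 2) (‖t‖ ^ 2) := by
  have h := Hypertoric.hasSum_norm_sq (toLTwo Λ t)
  rw [← TLie.norm_eq] at h
  refine h.congr_fun ?_
  intro k
  rw [norm_toLTwo_apply, mul_pow, Real.sq_sqrt (weight_pos Λ k).le, sq_abs]

variable (Λ)

instance : InnerProductSpace ℝ (TLie Λ) :=
  { (inferInstance : NormedSpace ℝ (TLie Λ)) with
    inner := fun s t => inner ℝ (toLTwo Λ s) (toLTwo Λ t)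
    norm_sq_eq_re_inner := fun s => by
      rw [TLie.norm_eq]; exact InnerProductSpace.norm_sq_eq_re_inner _
    conj_inner_symm := fun s t => InnerProductSpace.conj_inner_symm _ _
    add_left := fun s t r => by rw [map_add]; exact InnerProductSpace.add_left _ _ _
    smul_left := fun s t r => by rw [map_smul]; exact InnerProductSpace.smul_left _ _ _ }

/-- The isometry of `𝔱_λ` with `ℓ²`. -/
def toLTwoEquiv : TLie Λ ≃ₗᵢ[ℝ] lp (fun _ : 𝕃 => ℝ) 2 where
  toLinearEquiv := LinearEquiv.ofBijective (toLTwo Λ) ⟨toLTwo_injective Λ, fun f => by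
    have hf : ∀ k, Real.sqrt (weight Λ k) * ((Real.sqrt (weight Λ k))⁻¹ * f k) = f k :=
      fun k => mul_inv_cancel_left₀ (by linarith [one_le_sqrt_weight Λ k]) _
    refine ⟨⟨fun k => (Real.sqrt (weight Λ k))⁻¹ * f k, ?_⟩, ?_⟩
    · change Memℓp (fun k => Real.sqrt (weight Λ k) * ((Real.sqrt (weight Λ k))⁻¹ * f k)) 2
      rw [funext hf]
      exact lp.memℓp f
    · ext k
      exact hf k⟩
  norm_map' t := rfl

theorem toLTwoEquiv_apply (t : TLie Λ) : toLTwoEquiv Λ t = toLTwo Λ t := rfl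

instance : CompleteSpace (TLie Λ) :=
  (toLTwoEquiv Λ).toIsometryEquiv.completeSpace_iff.2 inferInstance

theorem hasSum_smul_basisVec [DecidableEq 𝕃] (t : TLie Λ) :
    HasSum (fun k => t.seq k • basisVec Λ k) t := by
  have h := lp.hasSum_single (p := 2) (by norm_num) (toLTwo Λ t)
  have h2 := (toLTwoEquiv Λ).symm.toContinuousLinearEquiv.toContinuousLinearMap.hasSum h
  have e : (toLTwoEquiv Λ).symm (toLTwo Λ t) = t := (toLTwoEquiv Λ).symm_apply_apply t
  simp only [ContinuousLinearEquiv.coe_coe, LinearIsometryEquiv.coe_toContinuousLinearEquiv] at h2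
  rw [e] at h2
  refine h2.congr_fun fun k => ?_
  apply (toLTwoEquiv Λ).injective
  rw [LinearIsometryEquiv.apply_symm_apply, toLTwoEquiv_apply]
  ext l
  rw [toLTwo_apply, lp.single_apply, TLie.seq_smul]
  by_cases hl : l = k
  · subst hl
    simp [basisVec, TLie.seq, toLTwo_apply]
  · simp [basisVec, TLie.seq, hl]

/-- Multiplication of `t ∈ 𝔱_λ` by a sequence of growth at most `(1 + |λ_k|)^{1/2}`, as a
bounded operator from `𝔱_λ` to `ℓ²`. -/
def weightedMul {E : Type*} [NormedAddCommGroup E] [NormedSpace ℝ E] (a : 𝕃 → E) (C : ℝ)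
    (h : ∀ k, ‖a k‖ ≤ C * Real.sqrt (weight Λ k)) : TLie Λ →L[ℝ] lp (fun _ : 𝕃 => E) 2 :=
  have hb : ∀ (t : TLie Λ) (k : 𝕃), ‖t.seq k • a k‖ ≤ |C| * ‖toLTwo Λ t k‖ := by
    intro t k
    rw [norm_smul, norm_toLTwo_apply, Real.norm_eq_abs]
    calc |t.seq k| * ‖a k‖ ≤ |t.seq k| * (|C| * Real.sqrt (weight Λ k)) := by
          gcongr
          exact (h k).trans (by gcongr; exact le_abs_self C)
      _ = _ := by ring
  LinearMap.mkContinuous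
    { toFun := fun t => ⟨fun k => t.seq k • a k, memℓp_two_of_norm_le _ (hb t)⟩
      map_add' := fun s t => by ext k; exact add_smul _ _ _
      map_smul' := fun c t => by ext k; exact mul_smul _ _ _ }
    |C| (fun t => lp_norm_le_of_norm_le _ (toLTwo Λ t) (abs_nonneg C) (hb t))

@[simp] theorem weightedMul_apply {E : Type*} [NormedAddCommGroup E] [NormedSpace ℝ E]
    (a : 𝕃 → E) (C : ℝ) (h : ∀ k, ‖a k‖ ≤ C * Real.sqrt (weight Λ k)) (t : TLie Λ) (k : 𝕃) :
    weightedMul Λ a C h t k = t.seq k • a k := rfl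

/-- Pointwise multiplication `𝔱_λ × L²(ℍ) → L²(ℍ)`. -/
def mulLTwo : TLie Λ →L[ℝ] LTwo 𝕃 →L[ℝ] LTwo 𝕃 :=
  have hb : ∀ (t : TLie Λ) (v : LTwo 𝕃) (k : 𝕃), ‖t.seq k • v k‖ ≤ ‖t‖ * ‖v k‖ := by
    intro t v k
    rw [norm_smul, Real.norm_eq_abs]
    gcongr
    exact TLie.abs_seq_le t k
  LinearMap.mkContinuous₂
    (LinearMap.mk₂ ℝ
      (fun (t : TLie Λ) (v : LTwo 𝕃) =>
        (⟨fun k => t.seq k • v k, memℓp_two_of_norm_le v (hb t v)⟩ : LTwo 𝕃))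
      (fun s t v => by ext k : 2; exact add_smul _ _ _)
      (fun c t v => by ext k : 2; exact mul_smul _ _ _)
      (fun t v w => by ext k : 2; exact smul_add _ _ _)
      (fun c t v => by ext k : 2; exact smul_comm (t.seq k) c (v k)))
    1 (fun t v => by
      rw [one_mul]
      exact lp_norm_le_of_norm_le _ v (norm_nonneg t) (hb t v))

@[simp] theorem mulLTwo_apply (t : TLie Λ) (v : LTwo 𝕃) (k : 𝕃) :
    mulLTwo Λ t v k = t.seq k • v k := rfl

/-- Pointwise multiplication on `𝔱_λ`. -/
def mulTLie : TLie Λ →L[ℝ] TLie Λ →L[ℝ] TLie Λ :=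
  have hb : ∀ (s t : TLie Λ) (k : 𝕃),
      ‖Real.sqrt (weight Λ k) * (s.seq k * t.seq k)‖ ≤ ‖s‖ * ‖toLTwo Λ t k‖ := by
    intro s t k
    rw [norm_toLTwo_apply, norm_mul, norm_mul, Real.norm_eq_abs, Real.norm_eq_abs,
      Real.norm_eq_abs, abs_of_nonneg (Real.sqrt_nonneg _)]
    calc Real.sqrt (weight Λ k) * (|s.seq k| * |t.seq k|)
        ≤ Real.sqrt (weight Λ k) * (‖s‖ * |t.seq k|) := by
          gcongr
          exact TLie.abs_seq_le s k
      _ = _ := by ring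
  LinearMap.mkContinuous₂
    (LinearMap.mk₂ ℝ
      (fun (s t : TLie Λ) =>
        (⟨fun k => s.seq k * t.seq k, memℓp_two_of_norm_le (toLTwo Λ t) (hb s t)⟩ : TLie Λ))
      (fun s t v => TLie.ext fun k => add_mul _ _ _)
      (fun c t v => TLie.ext fun k => mul_assoc _ _ _)
      (fun t v w => TLie.ext fun k => mul_add _ _ _)
      (fun c t v => TLie.ext fun k => mul_left_comm _ _ _))
    1 (fun s t => by
      rw [one_mul]
      exact lp_norm_le_of_norm_le (toLTwo Λ _) (toLTwo Λ t) (norm_nonneg s) (hb s t))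

@[simp] theorem mulTLie_apply (s t : TLie Λ) (k : 𝕃) :
    (mulTLie Λ s t).seq k = s.seq k * t.seq k := rfl

/-- The projection of `L²(ℍ)` to the `z`-parts. -/
def zPartL (q : ComplexStructure) : LTwo 𝕃 →L[ℝ] LTwo 𝕃 :=
  have hb : ∀ (v : LTwo 𝕃) (k : 𝕃), ‖zPart q (v k)‖ ≤ 1 * ‖v k‖ := fun v k => by
    rw [one_mul]; exact norm_zPart_le q _
  LinearMap.mkContinuous
    { toFun := fun v => ⟨fun k => zPart q (v k), memℓp_two_of_norm_le v (hb v)⟩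
      map_add' := fun v w => by ext k : 2; exact zPart_add q _ _
      map_smul' := fun c v => by
        ext k : 2
        exact zPart_smul q c (v k) }
    1 (fun v => lp_norm_le_of_norm_le _ v zero_le_one (hb v))

@[simp] theorem zPartL_apply (q : ComplexStructure) (v : LTwo 𝕃) (k : 𝕃) :
    zPartL q v k = zPart q (v k) := rfl

/-! ### The Lie algebra as the kernel of a continuous map -/

variable {n : ℕ} {u : 𝕃 → Fin n → ℤ}

variable {Λ} in
theorem BetaContinuous.exists_hasSum (hβ : BetaContinuous Λ u) :
    ∃ β : TLie Λ →L[ℝ] (Fin n → ℝ),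
      ∀ t, HasSum (fun k => t.seq k • realVec u k) (β t) := by
  classical
  obtain ⟨β, h⟩ := hβ
  refine ⟨β, fun t => ?_⟩
  have := β.hasSum (hasSum_smul_basisVec Λ t)
  refine this.congr_fun fun k => ?_
  rw [map_smul]
  congr 1
  rw [← h k]

variable {Λ} in
theorem mem_nLie_iff {β : TLie Λ →L[ℝ] (Fin n → ℝ)}
    (hβ : ∀ t, HasSum (fun k => t.seq k • realVec u k) (β t)) (t : TLie Λ) :
    t ∈ nLie Λ u ↔ β t = 0 :=
  ⟨fun h => (hβ t).unique h, fun h => by have := hβ t; rwa [h] at this⟩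

variable {Λ} in
theorem completeSpace_nLie (hβ : BetaContinuous Λ u) : CompleteSpace (nLie Λ u) := by
  obtain ⟨β, hβ⟩ := hβ.exists_hasSum
  have h : IsClosed ((nLie Λ u : Submodule ℝ (TLie Λ)) : Set (TLie Λ)) := by
    have e : ((nLie Λ u : Submodule ℝ (TLie Λ)) : Set (TLie Λ)) = β ⁻¹' {0} := by
      ext t; exact mem_nLie_iff hβ t
    rw [e]
    exact isClosed_singleton.preimage β.continuous
  exact h.completeSpace_coe

end

section

/-! ### Points of the complex zero locus and the complex flats -/

variable {𝕃 : Type*} {n : ℕ} {u : 𝕃 → Fin n → ℤ} {Λ : 𝕃 → ℍ[ℝ]} {q : ComplexStructure}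

theorem hasSum_hyperMoment (v : LTwo 𝕃) (t : TLie Λ) :
    HasSum (fun k => t.seq k • momentCoeff Λ v k) (hyperMoment Λ v t) :=
  (moment_summable_and_bound Λ v t).1.of_norm.hasSum

theorem hyperMoment_re (v : LTwo 𝕃) (t : TLie Λ) : (hyperMoment Λ v t).re = 0 := by
  have h := (innerSL ℝ (1 : ℍ[ℝ])).hasSum (hasSum_hyperMoment v t)
  have e : ∀ p : ℍ[ℝ], innerSL ℝ (1 : ℍ[ℝ]) p = p.re := fun p => by
    rw [innerSL_apply_apply, Quaternion.inner_def, one_mul, Quaternion.re_star]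
  simp only [e, Quaternion.re_smul, momentCoeff_re, smul_zero] at h
  exact h.unique hasSum_zero

variable (q) in
/-- `transverse q` as a continuous linear map. -/
def transverseL : ℍ[ℝ] →L[ℝ] ℍ[ℝ] :=
  ContinuousLinearMap.id ℝ ℍ[ℝ] - (innerSL ℝ (q : ℍ[ℝ])).smulRight (q : ℍ[ℝ])

theorem transverseL_apply (p : ℍ[ℝ]) : transverseL q p = transverse q p := by
  simp [transverseL, transverse]

/-- The complex moment of a point of the complex zero locus annihilates `𝔫 = ker β`, hence
factors through `β`. -/
theorem exists_linearMap_of_mem_complexZero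
    (hspan : Submodule.span ℝ (Set.range (realVec u)) = ⊤) (hβ : BetaContinuous Λ u)
    {v : LTwo 𝕃} (hv : v ∈ complexZero q Λ u) :
    ∃ b : (Fin n → ℝ) →ₗ[ℝ] complexLine q,
      ∀ k, (b (realVec u k) : ℍ[ℝ]) = transverse q (momentCoeff Λ v k) := by
  classical
  obtain ⟨β, hβ⟩ := hβ.exists_hasSum
  have hβe : ∀ k, β (basisVec Λ k) = realVec u k := by
    intro k
    refine (hβ (basisVec Λ k)).unique ?_
    have := hasSum_single (f := fun l => (basisVec Λ k).seq l • realVec u l) k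
      (fun l hl => by simp [basisVec, TLie.seq, hl])
    simpa [basisVec, TLie.seq] using this
  have hsurj : (β : TLie Λ →ₗ[ℝ] (Fin n → ℝ)).range = ⊤ := by
    rw [eq_top_iff, ← hspan, Submodule.span_le]
    rintro _ ⟨k, rfl⟩
    exact ⟨basisVec Λ k, hβe k⟩
  obtain ⟨g, hg⟩ := LinearMap.exists_rightInverse_of_surjective _ hsurj
  have hg' : ∀ x, β (g x) = x := fun x => LinearMap.congr_fun hg x
  let T : TLie Λ →ₗ[ℝ] complexLine q :=
    LinearMap.codRestrict (complexLine q)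
      ((transverseL q).comp (hyperMoment Λ v) : TLie Λ →L[ℝ] ℍ[ℝ]).toLinearMap
      (fun t => by
        simp only [ContinuousLinearMap.coe_coe, ContinuousLinearMap.comp_apply, transverseL_apply]
        exact transverse_mem_complexLine q (hyperMoment_re v t))
  have hT : ∀ t, (T t : ℍ[ℝ]) = transverse q (hyperMoment Λ v t) := fun t =>
    transverseL_apply _
  refine ⟨T ∘ₗ g, fun k => ?_⟩
  have hker : g (realVec u k) - basisVec Λ k ∈ nLie Λ u := by
    rw [mem_nLie_iff hβ, map_sub, hg', hβe, sub_self]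
  have h0 : T (g (realVec u k) - basisVec Λ k) = 0 := by
    apply Subtype.ext
    rw [hT]
    exact hv ⟨_, hker⟩
  rw [LinearMap.comp_apply, show T (g (realVec u k)) = T (basisVec Λ k) by
    rw [← sub_eq_zero, ← map_sub, h0], hT]
  congr 1
  refine (hasSum_hyperMoment v (basisVec Λ k)).unique ?_
  have := hasSum_single (f := fun l => (basisVec Λ k).seq l • momentCoeff Λ v l) k
    (fun l hl => by simp [basisVec, TLie.seq, hl])
  simpa [basisVec, TLie.seq] using this

/-- If the flats are in general position, the vectors `u_k` of the flats through a common point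
are linearly independent: otherwise this point could be moved, keeping it on a dependent subset of
these flats, to a point on `n` further independent ones. -/
theorem linearIndepOn_of_flatsGeneric
    (hspan : Submodule.span ℝ (Set.range (realVec u)) = ⊤) (hflat : FlatsGeneric q Λ u)
    {b : (Fin n → ℝ) →ₗ[ℝ] complexLine q} {J : Set 𝕃}
    (hJ : ∀ k ∈ J, b ∈ complexFlat q Λ u k) : LinearIndepOn ℝ (realVec u) J := by
  classical
  obtain ⟨I, hIJ, -, hJI, hI⟩ :=
    exists_linearIndepOn_extension (linearIndepOn_empty ℝ (realVec u)) (Set.empty_subset J)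
  by_contra hne
  obtain ⟨k, hkJ, hkI⟩ : ∃ k ∈ J, k ∉ I := by
    by_contra! h
    exact hne (hI.mono h)
  have hk : realVec u k ∈ Submodule.span ℝ (realVec u '' I) := hJI ⟨k, hkJ, rfl⟩
  obtain ⟨B, -, hIB, hBspan, hB⟩ := exists_linearIndepOn_extension hI (Set.subset_univ I)
  have hkB : k ∉ B := by
    intro hkB
    have h1 := hB.mono (Set.insert_subset hkB hIB)
    exact ((linearIndepOn_insert hkI).1 h1).2 hk
  have htop : ⊤ ≤ Submodule.span ℝ (Set.range fun j : B => realVec u j) := by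
    rw [← hspan, Submodule.span_le, ← Set.image_univ, ← Set.image_eq_range]
    exact hBspan
  let bas : Module.Basis B ℝ (Fin n → ℝ) := Module.Basis.mk hB htop
  have : Finite B := Module.Finite.finite_basis bas
  have : Fintype B := Fintype.ofFinite B
  have hcard : B.toFinset.card = n := by
    rw [Set.toFinset_card, ← Module.finrank_eq_card_basis bas]; simp
  let b' : (Fin n → ℝ) →ₗ[ℝ] complexLine q := bas.constr ℝ
    (fun j : B => ⟨transverse q (lam Λ j), transverse_mem_complexLine q (lam_re Λ j)⟩)
  have hb' : ∀ j ∈ B, b' ∈ complexFlat q Λ u j := by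
    intro j hj
    have h1 : b' (bas ⟨j, hj⟩) = ⟨transverse q (lam Λ j),
      transverse_mem_complexLine q (lam_re Λ j)⟩ := Module.Basis.constr_basis _ _ _ _
    have h2 : bas ⟨j, hj⟩ = realVec u j := Module.Basis.mk_apply _ _ _
    rw [h2] at h1
    exact congrArg Subtype.val h1
  have hkb' : b' ∈ complexFlat q Λ u k := by
    have heq : Set.EqOn b' b (realVec u '' I) := by
      rintro _ ⟨j, hj, rfl⟩
      exact Subtype.ext ((hb' j (hIB hj)).trans (hJ j (hIJ hj)).symm)
    have := LinearMap.eqOn_span heq hk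
    exact (congrArg Subtype.val this).trans (hJ k hkJ)
  have hempty := hflat (insert k B.toFinset) (by
    rw [Finset.card_insert_of_notMem (by simpa using hkB), hcard])
  have hmem : b' ∈ ⋂ j ∈ insert k B.toFinset, complexFlat q Λ u j := by
    simp only [Set.mem_iInter, Finset.mem_insert, Set.mem_toFinset]
    rintro j (rfl | hj)
    · exact hkb'
    · exact hb' j hj
  rw [hempty] at hmem
  exact hmem

/-! ### The coercivity estimate -/

theorem zPart_point (v : LTwo 𝕃) (k : 𝕃) :
    zPart q (point Λ v k) = zPart q (Λ k) + zPart q (v k) := zPart_add q _ _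

theorem wPart_point (v : LTwo 𝕃) (k : 𝕃) :
    wPart q (point Λ v k) = wPart q (Λ k) + wPart q (v k) := wPart_add q _ _

theorem eventually_le_weight (hconv : Summable fun k => (1 + ‖lam Λ k‖)⁻¹) (R : ℝ) :
    ∀ᶠ k in cofinite, R ≤ weight Λ k := by
  have h : Tendsto (fun k => (weight Λ k)⁻¹) cofinite (𝓝 0) := hconv.tendsto_cofinite_zero
  have h2 := h.eventually (gt_mem_nhds (show (0 : ℝ) < (|R| + 1)⁻¹ by positivity))
  filter_upwards [h2] with k hk
  have := (inv_lt_inv₀ (weight_pos Λ k) (by positivity)).1 hk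
  linarith [le_abs_self R]

theorem norm_sq_zPart_add_norm_sq_wPart_eq_weight (k : 𝕃) :
    ‖zPart q (Λ k)‖ ^ 2 + ‖wPart q (Λ k)‖ ^ 2 = 2 * (weight Λ k - 1) := by
  rw [norm_sq_zPart_add_norm_sq_wPart, weight, norm_lam]; ring

/-- For commensurable growth, both parts of every point of `M_Λ` grow like the weight. -/
theorem exists_eventually_weight_le (hconv : Summable fun k => (1 + ‖lam Λ k‖)⁻¹)
    (hcom : Commensurable q Λ) (v : LTwo 𝕃) :
    ∃ c > 0, ∀ᶠ k in cofinite, c * weight Λ k ≤ ‖zPart q (point Λ v k)‖ ^ 2 ∧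
      c * weight Λ k ≤ ‖wPart q (point Λ v k)‖ ^ 2 := by
  obtain ⟨C₁, C₂, h1, h2, hC⟩ := hcom
  set c : ℝ := min (C₁ ^ 2 / (1 + C₁ ^ 2)) (1 / (1 + C₂ ^ 2)) with hc
  have hcpos : 0 < c := lt_min (by positivity) (by positivity)
  have hv : Tendsto (fun k => ‖v k‖ ^ 2) cofinite (𝓝 0) :=
    ((mem_ltwo_iff _).1 (lp.memℓp v)).tendsto_cofinite_zero
  have hv2 := hv.eventually (gt_mem_nhds (show (0 : ℝ) < c / 4 by positivity))
  refine ⟨c / 4, by positivity, ?_⟩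
  filter_upwards [hC, hv2, eventually_le_weight hconv 2] with k ⟨hk1, hk2⟩ hvk hw
  have hsum := norm_sq_zPart_add_norm_sq_wPart_eq_weight (q := q) (Λ := Λ) k
  have hone : ∀ a e : ℝ, ∀ p : ℍ[ℝ], ‖p‖ ≤ ‖v k‖ → c * weight Λ k ≤ a ^ 2 → 0 ≤ a → 0 ≤ e →
      a ≤ e + ‖p‖ → c / 4 * weight Λ k ≤ e ^ 2 := by
    intro a e p hp ha ha0 he hle
    have h3 : ‖p‖ ^ 2 ≤ ‖v k‖ ^ 2 := pow_le_pow_left₀ (norm_nonneg _) hp 2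
    have h4 : ‖p‖ ^ 2 ≤ (a / 2) ^ 2 := by nlinarith
    have h5 : ‖p‖ ≤ a / 2 := (sq_le_sq₀ (norm_nonneg _) (by positivity)).1 h4
    have h6 : a / 2 ≤ e := by linarith
    have := pow_le_pow_left₀ (by positivity) h6 2
    linarith
  constructor
  · refine hone ‖zPart q (Λ k)‖ _ (zPart q (v k)) (norm_zPart_le q _) ?_ (norm_nonneg _)
      (norm_nonneg _) ?_
    · have h3 : c ≤ C₁ ^ 2 / (1 + C₁ ^ 2) := min_le_left _ _
      rw [le_div_iff₀ (by positivity)] at h3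
      have h4 := pow_le_pow_left₀ (by positivity) hk1 2
      rw [mul_pow] at h4
      have h5 : C₁ ^ 2 * weight Λ k ≤ (1 + C₁ ^ 2) * ‖zPart q (Λ k)‖ ^ 2 := by
        nlinarith [sq_nonneg C₁]
      have h6 : (1 + C₁ ^ 2) * (c * weight Λ k) ≤ (1 + C₁ ^ 2) * ‖zPart q (Λ k)‖ ^ 2 := by
        nlinarith [weight_pos Λ k]
      exact le_of_mul_le_mul_left h6 (by positivity)
    · rw [zPart_point]
      have := norm_sub_le (zPart q (Λ k) + zPart q (v k)) (zPart q (v k))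
      rwa [add_sub_cancel_right] at this
  · refine hone ‖wPart q (Λ k)‖ _ (wPart q (v k)) (norm_wPart_le q _) ?_ (norm_nonneg _)
      (norm_nonneg _) ?_
    · have h3 : c ≤ 1 / (1 + C₂ ^ 2) := min_le_right _ _
      rw [le_div_iff₀ (by positivity)] at h3
      have h4 := pow_le_pow_left₀ (norm_nonneg _) hk2 2
      rw [mul_pow] at h4
      have h5 : weight Λ k ≤ (1 + C₂ ^ 2) * ‖wPart q (Λ k)‖ ^ 2 := by linarith
      have h6 : (1 + C₂ ^ 2) * (c * weight Λ k) ≤ (1 + C₂ ^ 2) * ‖wPart q (Λ k)‖ ^ 2 := by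
        nlinarith [weight_pos Λ k]
      exact le_of_mul_le_mul_left h6 (by positivity)
    · rw [wPart_point]
      have := norm_sub_le (wPart q (Λ k) + wPart q (v k)) (wPart q (v k))
      rwa [add_sub_cancel_right] at this

/-- A function which is positive on a set and bounded below by a positive constant off a finite
set is bounded below on the set by a positive constant. -/
theorem exists_pos_le_of_eventually_cofinite {f : 𝕃 → ℝ} {s : Set 𝕃} (hpos : ∀ k ∈ s, 0 < f k)
    {c : ℝ} (hc : 0 < c) (h : ∀ᶠ k in cofinite, c ≤ f k) : ∃ d > 0, ∀ k ∈ s, d ≤ f k := by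
  classical
  have hfin : {k | ¬ c ≤ f k}.Finite := h
  have hfin' := hfin.inter_of_left s
  rcases (({k | ¬ c ≤ f k} ∩ s).eq_empty_or_nonempty) with hem | hne
  · refine ⟨c, hc, fun k hk => ?_⟩
    by_contra hlt
    have : k ∈ {k | ¬ c ≤ f k} ∩ s := ⟨hlt, hk⟩
    rw [hem] at this
    exact this
  · obtain ⟨k₀, hk₀, hmin⟩ := Set.exists_min_image _ f hfin' hne
    refine ⟨min c (f k₀), lt_min hc (hpos k₀ hk₀.2), fun k hk => ?_⟩
    by_cases hk' : c ≤ f k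
    · exact (min_le_left _ _).trans hk'
    · exact (min_le_right _ _).trans (hmin k ⟨hk', hk⟩)

/-- If the `u_j`, `j ∈ J`, are linearly independent, then the norm of an element of `𝔫` is
controlled by its coordinates off `J`. -/
theorem exists_norm_sq_le_of_linearIndepOn (hβ : BetaContinuous Λ u) {J : Set 𝕃}
    (hJ : LinearIndepOn ℝ (realVec u) J) :
    ∃ C > 0, ∀ y ∈ nLie Λ u, ∃ y' : TLie Λ, ‖y‖ ^ 2 ≤ C * ‖y'‖ ^ 2 ∧ (∀ k ∈ J, y'.seq k = 0) ∧
      ∀ k ∉ J, y'.seq k = y.seq k := by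
  classical
  obtain ⟨β, hβ⟩ := hβ.exists_hasSum
  have : Finite J := LinearIndependent.finite hJ
  have : Fintype J := Fintype.ofFinite J
  let L : (J → ℝ) →ₗ[ℝ] (Fin n → ℝ) := Fintype.linearCombination ℝ (fun j : J => realVec u j)
  have hL : LinearMap.ker L = ⊥ := by
    exact LinearMap.ker_eq_bot.2 hJ.fintypeLinearCombination_injective
  obtain ⟨K, -, hK⟩ := L.exists_antilipschitzWith hL
  have hKL : ∀ x : J → ℝ, ‖x‖ ≤ K * ‖L x‖ := fun x => by
    have := hK.le_mul_dist x 0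
    simpa using this
  refine ⟨1 + (∑ j : J, weight Λ j) * (K * ‖β‖) ^ 2, ?_, fun y hy => ?_⟩
  · have : 0 ≤ ∑ j : J, weight Λ j := Finset.sum_nonneg fun j _ => (weight_pos Λ j).le
    positivity
  let y' : TLie Λ := ⟨fun k => if k ∈ J then 0 else y.seq k, by
    refine memℓp_two_of_norm_le (toLTwo Λ y) (C := 1) fun k => ?_
    rw [one_mul, toLTwo_apply]
    beta_reduce
    split_ifs
    · rw [mul_zero, norm_zero]
      exact norm_nonneg _
    · rfl⟩
  have hy'J : ∀ k ∈ J, y'.seq k = 0 := fun k hk => if_pos hk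
  have hy'J' : ∀ k ∉ J, y'.seq k = y.seq k := fun k hk => if_neg hk
  refine ⟨y', ?_, hy'J, hy'J'⟩
  have hsumJ : ∀ {E : Type} [NormedAddCommGroup E] (f : 𝕃 → E), (∀ k ∉ J, f k = 0) →
      HasSum f (∑ j : J, f j) := by
    intro E _ f hf
    have h1 : HasSum (fun j : J => f j) (∑ j : J, f j) := hasSum_fintype _
    exact (hasSum_subtype_iff_of_support_subset (by
      intro k hk
      by_contra hkJ
      exact hk (hf k hkJ))).1 h1
  -- the coordinates in `J` are determined by the others through `β(y) = 0`
  have hLy : L (fun j : J => y.seq j) = -β y' := by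
    have h1 := (hβ y).sub (hβ y')
    have h2 := hsumJ (fun k => y.seq k • realVec u k - y'.seq k • realVec u k)
      (fun k hk => by rw [hy'J' k hk, sub_self])
    rw [(mem_nLie_iff hβ y).1 hy, zero_sub] at h1
    rw [← h2.unique h1, Fintype.linearCombination_apply]
    refine Finset.sum_congr rfl fun j _ => ?_
    rw [hy'J j j.2, zero_smul, sub_zero]
  have hbound : ∀ j : J, |y.seq j| ≤ K * ‖β‖ * ‖y'‖ := by
    intro j
    have h1 := norm_le_pi_norm (fun j : J => y.seq j) j
    have h2 := hKL (fun j : J => y.seq j)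
    rw [hLy, norm_neg] at h2
    have h3 := mul_le_mul_of_nonneg_left (β.le_opNorm y') K.2
    rw [Real.norm_eq_abs] at h1
    calc |y.seq j| ≤ _ := h1
      _ ≤ _ := h2
      _ ≤ _ := h3
      _ = _ := by rw [NNReal.val_eq_coe]; ring
  have hdiff : ‖y‖ ^ 2 - ‖y'‖ ^ 2 = ∑ j : J, weight Λ j * y.seq j ^ 2 := by
    have h1 := y.hasSum_norm_sq.sub y'.hasSum_norm_sq
    have h2 := hsumJ (fun k => weight Λ k * y.seq k ^ 2 - weight Λ k * y'.seq k ^ 2)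
      (fun k hk => by rw [hy'J' k hk, sub_self])
    rw [h1.unique h2]
    refine Finset.sum_congr rfl fun j _ => ?_
    rw [hy'J j j.2]; ring
  have hle : ∑ j : J, weight Λ j * y.seq j ^ 2 ≤
      ∑ j : J, weight Λ j * (K * ‖β‖ * ‖y'‖) ^ 2 := by
    refine Finset.sum_le_sum fun j _ => mul_le_mul_of_nonneg_left ?_ (weight_pos Λ j).le
    rw [← sq_abs (y.seq j)]
    exact pow_le_pow_left₀ (abs_nonneg _) (hbound j) 2
  rw [← Finset.sum_mul] at hle
  rw [mul_pow _ ‖y'‖] at hle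
  linarith

variable (q Λ) in
/-- The smaller of `|z_k|²` and `|w_k|²`. -/
def minSq (v : LTwo 𝕃) (k : 𝕃) : ℝ :=
  min (‖zPart q (point Λ v k)‖ ^ 2) (‖wPart q (point Λ v k)‖ ^ 2)

theorem minSq_nonneg (v : LTwo 𝕃) (k : 𝕃) : 0 ≤ minSq Λ q v k :=
  le_min (by positivity) (by positivity)

/-- At a point of the complex zero locus, the quadratic form `∑ min(|z_k|², |w_k|²) y_k²` is
coercive on `𝔫`: the indices with `z_k = 0` or `w_k = 0` are those of flats through a common
point, so the corresponding coordinates are controlled by the others. -/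
theorem exists_coercive (hspan : Submodule.span ℝ (Set.range (realVec u)) = ⊤)
    (hconv : Summable fun k => (1 + ‖lam Λ k‖)⁻¹) (hβ : BetaContinuous Λ u)
    (hflat : FlatsGeneric q Λ u) (hcom : Commensurable q Λ) {v : LTwo 𝕃}
    (hv : v ∈ complexZero q Λ u) :
    ∃ c > 0, ∀ y ∈ nLie Λ u, ∀ (f : 𝕃 → ℝ) (S : ℝ), HasSum f S →
      (∀ k, minSq Λ q v k * y.seq k ^ 2 ≤ f k) → c * ‖y‖ ^ 2 ≤ S := by
  obtain ⟨b, hb⟩ := exists_linearMap_of_mem_complexZero hspan hβ hv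
  set J : Set 𝕃 := {k | zPart q (point Λ v k) = 0 ∨ wPart q (point Λ v k) = 0} with hJ
  have hli : LinearIndepOn ℝ (realVec u) J := by
    refine linearIndepOn_of_flatsGeneric hspan hflat (b := b) fun k hk => ?_
    refine (hb k).trans ?_
    rw [transverse_momentCoeff]
    rcases hk with hk | hk <;> simp [hk]
  obtain ⟨C, hC, hbd⟩ := exists_norm_sq_le_of_linearIndepOn hβ hli
  obtain ⟨c₀, hc₀, hev⟩ := exists_eventually_weight_le hconv hcom v
  obtain ⟨d, hd, hdle⟩ := exists_pos_le_of_eventually_cofinite (s := Jᶜ)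
    (f := fun k => minSq Λ q v k / weight Λ k) (c := c₀) (fun k hk => by
      have hk' : ¬ (zPart q (point Λ v k) = 0 ∨ wPart q (point Λ v k) = 0) := hk
      push Not at hk'
      have h1 := norm_pos_iff.2 hk'.1
      have h2 := norm_pos_iff.2 hk'.2
      exact div_pos (lt_min (by positivity) (by positivity)) (weight_pos Λ k)) hc₀ (by
      filter_upwards [hev] with k hk
      rw [le_div_iff₀ (weight_pos Λ k)]
      exact le_min hk.1 hk.2)
  refine ⟨d / C, by positivity, fun y hy f S hf hle => ?_⟩
  obtain ⟨y', hyy', hy0, hy1⟩ := hbd y hy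
  have h1 : d * ‖y'‖ ^ 2 ≤ S := by
    refine hasSum_le (fun k => ?_) (y'.hasSum_norm_sq.mul_left d) hf
    refine le_trans ?_ (hle k)
    by_cases hk : k ∈ J
    · rw [hy0 k hk]
      simpa using mul_nonneg (minSq_nonneg v k) (sq_nonneg (y.seq k))
    · rw [hy1 k hk, ← mul_assoc]
      have := hdle k hk
      rw [le_div_iff₀ (weight_pos Λ k)] at this
      gcongr
  calc d / C * ‖y‖ ^ 2 ≤ d / C * (C * ‖y'‖ ^ 2) := by gcongr
    _ = d * ‖y'‖ ^ 2 := by field_simp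
    _ ≤ S := h1

end

section

/-! ### Smoothness of the complexified action and of the moment map -/

theorem hasFDerivAt_of_norm_sub_le_sq {E F : Type*} [NormedAddCommGroup E] [NormedSpace ℝ E]
    [NormedAddCommGroup F] [NormedSpace ℝ F] {f : E → F} {f' : E →L[ℝ] F} {x : E} {C : ℝ}
    (h : ∀ e : E, ‖e‖ ≤ 1 / 2 → ‖f (x + e) - f x - f' e‖ ≤ C * ‖e‖ ^ 2) : HasFDerivAt f f' x := by
  rw [hasFDerivAt_iff_isLittleO_nhds_zero]
  refine (Asymptotics.IsBigO.of_bound C ?_).trans_isLittleO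
    (Asymptotics.isLittleO_norm_pow_id one_lt_two)
  filter_upwards [Metric.closedBall_mem_nhds (0 : E) one_half_pos] with e he
  rw [Real.norm_of_nonneg (by positivity)]
  exact h e (by simpa using he)

variable {𝕃 : Type*} {n : ℕ} {u : 𝕃 → Fin n → ℤ} {Λ : 𝕃 → ℍ[ℝ]} {q : ComplexStructure}

theorem norm_sqrt_weight_mul_exp_sub_one_le (y : TLie Λ) (k : 𝕃) :
    ‖Real.sqrt (weight Λ k) * (Real.exp (y.seq k) - 1)‖ ≤ Real.exp ‖y‖ * ‖toLTwo Λ y k‖ := by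
  rw [norm_toLTwo_apply, norm_mul, Real.norm_eq_abs, Real.norm_eq_abs,
    abs_of_nonneg (Real.sqrt_nonneg _)]
  calc Real.sqrt (weight Λ k) * |Real.exp (y.seq k) - 1|
      ≤ Real.sqrt (weight Λ k) * (Real.exp ‖y‖ * |y.seq k|) := by
        gcongr
        exact abs_exp_sub_one_le_mul (TLie.abs_seq_le y k)
    _ = _ := by ring

/-- The map `y ↦ e^y - 1` of `𝔱_λ` to itself. -/
def expSubOne (y : TLie Λ) : TLie Λ :=
  ⟨fun k => Real.exp (y.seq k) - 1,
    memℓp_two_of_norm_le (toLTwo Λ y) (norm_sqrt_weight_mul_exp_sub_one_le y)⟩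

@[simp] theorem expSubOne_seq (y : TLie Λ) (k : 𝕃) :
    (expSubOne y).seq k = Real.exp (y.seq k) - 1 := rfl

theorem hasFDerivAt_expSubOne (y : TLie Λ) :
    HasFDerivAt expSubOne (ContinuousLinearMap.id ℝ (TLie Λ) + mulTLie Λ (expSubOne y)) y := by
  refine hasFDerivAt_of_norm_sub_le_sq (C := Real.exp ‖y‖) fun h hh => ?_
  have hb : ∀ k, ‖toLTwo Λ (expSubOne (y + h) - expSubOne y -
      (ContinuousLinearMap.id ℝ (TLie Λ) + mulTLie Λ (expSubOne y)) h) k‖ ≤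
      Real.exp ‖y‖ * ‖h‖ * ‖toLTwo Λ h k‖ := by
    intro k
    have hk := TLie.abs_seq_le h k
    have hyk := TLie.abs_seq_le y k
    have h1 := Real.abs_exp_sub_one_sub_id_le (hk.trans (hh.trans (by norm_num)))
    rw [norm_toLTwo_apply, norm_toLTwo_apply]
    have e : (expSubOne (y + h) - expSubOne y -
        (ContinuousLinearMap.id ℝ (TLie Λ) + mulTLie Λ (expSubOne y)) h).seq k =
        Real.exp (y.seq k) * (Real.exp (h.seq k) - 1 - h.seq k) := by
      simp only [TLie.seq_sub, add_apply, ContinuousLinearMap.id_apply,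
        TLie.seq_add, mulTLie_apply, expSubOne_seq, Real.exp_add]
      ring
    rw [e, abs_mul, abs_of_pos (Real.exp_pos _)]
    have h2 : Real.exp (y.seq k) ≤ Real.exp ‖y‖ :=
      Real.exp_le_exp.2 ((le_abs_self _).trans hyk)
    have h3 : |Real.exp (h.seq k) - 1 - h.seq k| ≤ ‖h‖ * |h.seq k| := by
      refine h1.trans ?_
      rw [← sq_abs, sq]
      gcongr
    calc Real.sqrt (weight Λ k) * (Real.exp (y.seq k) * |Real.exp (h.seq k) - 1 - h.seq k|)
        ≤ Real.sqrt (weight Λ k) * (Real.exp ‖y‖ * (‖h‖ * |h.seq k|)) := by gcongr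
      _ = _ := by ring
  have := lp_norm_le_of_norm_le _ (toLTwo Λ h) (by positivity) hb
  rw [← TLie.norm_eq, ← TLie.norm_eq] at this
  rw [sq, ← mul_assoc]
  exact this

theorem contDiff_expSubOne : ContDiff ℝ ∞ (expSubOne : TLie Λ → TLie Λ) := by
  rw [contDiff_infty]
  intro m
  -- the derivative is a continuous affine function of the map itself
  induction m with
  | zero =>
    rw [Nat.cast_zero, contDiff_zero]
    exact continuous_iff_continuousAt.2 fun y => (hasFDerivAt_expSubOne y).continuousAt
  | succ m ih =>
    rw [Nat.cast_succ, contDiff_succ_iff_hasFDerivAt]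
    exact ⟨_, contDiff_const.add ((mulTLie Λ).contDiff.comp ih), hasFDerivAt_expSubOne⟩

theorem norm_zPart_le_sqrt_weight (k : 𝕃) :
    ‖zPart q (Λ k)‖ ≤ 2 * Real.sqrt (weight Λ k) :=
  (norm_zPart_le q _).trans (norm_le_sqrt_weight Λ k)

theorem norm_wPart_le_sqrt_weight (k : 𝕃) :
    ‖wPart q (Λ k)‖ ≤ 2 * Real.sqrt (weight Λ k) :=
  (norm_wPart_le q _).trans (norm_le_sqrt_weight Λ k)

theorem point_expMove (v : LTwo 𝕃) (y : TLie Λ) (k : 𝕃) :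
    point Λ (expMove q Λ v y) k = complexAct q (expUnit (y.seq k)) (point Λ v k) :=
  add_sub_cancel _ _

theorem zPart_point_expMove (v : LTwo 𝕃) (y : TLie Λ) (k : 𝕃) :
    zPart q (point Λ (expMove q Λ v y) k) = Real.exp (y.seq k) • zPart q (point Λ v k) := by
  rw [point_expMove, complexAct_expUnit, zPart_add, zPart_smul, zPart_smul, zPart_zPart,
    zPart_wPart, smul_zero, add_zero]

theorem wPart_point_expMove (v : LTwo 𝕃) (y : TLie Λ) (k : 𝕃) :
    wPart q (point Λ (expMove q Λ v y) k) = Real.exp (-y.seq k) • wPart q (point Λ v k) := by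
  rw [point_expMove, complexAct_expUnit, wPart_add, wPart_smul, wPart_smul, wPart_wPart,
    wPart_zPart, smul_zero, zero_add]

/-- The action of `e^y` in terms of the bounded bilinear multiplications. -/
theorem expMove_eq (v : LTwo 𝕃) (y : TLie Λ) :
    expMove q Λ v y = v +
      (weightedMul Λ (fun k => zPart q (Λ k)) 2 norm_zPart_le_sqrt_weight (expSubOne y) +
        mulLTwo Λ (expSubOne y) (zPartL q v)) +
      (weightedMul Λ (fun k => wPart q (Λ k)) 2 norm_wPart_le_sqrt_weight (expSubOne (-y)) +
        mulLTwo Λ (expSubOne (-y)) (v - zPartL q v)) := by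
  apply lp.ext
  funext k
  have hp : v k = zPart q (point Λ v k) + wPart q (point Λ v k) - Λ k := by
    rw [zPart_add_wPart, point]; abel
  have hw : wPart q (v k) = v k - zPart q (v k) := by
    rw [eq_sub_iff_add_eq, add_comm, zPart_add_wPart]
  have e1 : expMove q Λ v y k = complexAct q (expUnit (y.seq k)) (point Λ v k) - Λ k := rfl
  rw [e1, complexAct_expUnit]
  simp only [lp.coeFn_add, Pi.add_apply, weightedMul_apply, mulLTwo_apply, lp.coeFn_sub,
    Pi.sub_apply, zPartL_apply, expSubOne_seq, TLie.seq_neg, ← hw, ← smul_add, ← zPart_point,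
    ← wPart_point]
  conv_rhs => enter [1, 1]; rw [hp]
  module

theorem contDiff_expMove :
    ContDiff ℝ ∞ (fun p : LTwo 𝕃 × TLie Λ => expMove q Λ p.1 p.2) := by
  simp only [expMove_eq]
  have h1 : ContDiff ℝ ∞ (fun p : LTwo 𝕃 × TLie Λ => expSubOne p.2) :=
    contDiff_expSubOne.comp contDiff_snd
  have h2 : ContDiff ℝ ∞ (fun p : LTwo 𝕃 × TLie Λ => expSubOne (-p.2)) :=
    contDiff_expSubOne.comp contDiff_snd.neg
  have h3 : ContDiff ℝ ∞ (fun p : LTwo 𝕃 × TLie Λ => zPartL q p.1) :=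
    (zPartL q).contDiff.comp contDiff_fst
  refine (contDiff_fst.add (ContDiff.add ?_ ?_)).add (ContDiff.add ?_ ?_)
  · exact (ContinuousLinearMap.contDiff (weightedMul Λ (fun k => zPart q (Λ k)) 2
      norm_zPart_le_sqrt_weight)).comp h1
  · exact ((mulLTwo Λ).contDiff.comp h1).clm_apply h3
  · exact (ContinuousLinearMap.contDiff (weightedMul Λ (fun k => wPart q (Λ k)) 2
      norm_wPart_le_sqrt_weight)).comp h2
  · exact ((mulLTwo Λ).contDiff.comp h2).clm_apply (contDiff_fst.sub h3)

theorem norm_expMove_le (v : LTwo 𝕃) {y : TLie Λ} {R : ℝ} (hy : ‖y‖ ≤ R) :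
    ‖expMove q Λ v y‖ ≤ ‖v‖ + 2 * (2 + ‖v‖) * (Real.exp R * R) := by
  have hR : 0 ≤ R := (norm_nonneg y).trans hy
  have key : ∀ k, ‖expMove q Λ v y k - v k‖ ≤
      2 * (2 + ‖v‖) * Real.exp R * ‖toLTwo Λ y k‖ := by
    intro k
    have e1 : expMove q Λ v y k = complexAct q (expUnit (y.seq k)) (point Λ v k) - Λ k := rfl
    have e2 : expMove q Λ v y k - v k = (Real.exp (y.seq k) - 1) • zPart q (point Λ v k) +
        (Real.exp (-y.seq k) - 1) • wPart q (point Λ v k) := by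
      rw [e1, complexAct_expUnit]
      have hp : v k = zPart q (point Λ v k) + wPart q (point Λ v k) - Λ k := by
        rw [zPart_add_wPart, point]; abel
      conv_lhs => rw [hp]
      module
    have hk := (TLie.abs_seq_le y k).trans hy
    have h1 := abs_exp_sub_one_le_mul hk
    have h2 := abs_exp_sub_one_le_mul (y := -y.seq k) (c := R) (by rwa [abs_neg])
    rw [abs_neg] at h2
    have hx := norm_point_le Λ v k
    rw [e2, norm_toLTwo_apply]
    refine (norm_add_le _ _).trans ?_
    rw [norm_smul, norm_smul, Real.norm_eq_abs, Real.norm_eq_abs]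
    have h3 := mul_le_mul h1 ((norm_zPart_le q _).trans hx) (norm_nonneg _) (by positivity)
    have h4 := mul_le_mul h2 ((norm_wPart_le q _).trans hx) (norm_nonneg _) (by positivity)
    calc _ ≤ _ := add_le_add h3 h4
      _ = _ := by ring
  have h1 := lp_norm_le_of_norm_le (expMove q Λ v y - v) (toLTwo Λ y) (by positivity) key
  rw [← TLie.norm_eq] at h1
  have h2 : ‖expMove q Λ v y‖ ≤ ‖v‖ + ‖expMove q Λ v y - v‖ := by
    have := norm_add_le v (expMove q Λ v y - v)
    rwa [add_sub_cancel] at this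
  have h3 : 2 * (2 + ‖v‖) * Real.exp R * ‖y‖ ≤ 2 * (2 + ‖v‖) * (Real.exp R * R) := by
    rw [← mul_assoc]; gcongr
  linarith

theorem hasSum_realMoment (v : LTwo 𝕃) (η : nLie Λ u) :
    HasSum (fun k => (η : TLie Λ).seq k * (inner ℝ (q : ℍ[ℝ]) (lam Λ k) +
      1 / 2 * (‖zPart q (point Λ v k)‖ ^ 2 - ‖wPart q (point Λ v k)‖ ^ 2)))
      (realMoment q Λ u v η) := by
  have h := (innerSL ℝ (q : ℍ[ℝ])).hasSum (hasSum_hyperMoment v (η : TLie Λ))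
  simp only [innerSL_apply_apply, inner_smul_right, inner_momentCoeff] at h
  exact h

theorem norm_realMoment_le (v : LTwo 𝕃) : ‖realMoment q Λ u v‖ ≤ (2 + ‖v‖) * ‖v‖ := by
  refine ContinuousLinearMap.opNorm_le_bound _ (by positivity) fun η => ?_
  have h1 : ‖realMoment q Λ u v η‖ ≤ ‖(q : ℍ[ℝ])‖ * ‖hyperMoment Λ v η‖ :=
    norm_inner_le_norm (𝕜 := ℝ) (q : ℍ[ℝ]) (hyperMoment Λ v η)
  rw [norm_complexStructure, one_mul] at h1
  refine h1.trans ?_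
  have h2 : ‖hyperMoment Λ v (η : TLie Λ)‖ ≤ ((2 + ‖v‖) * ‖v‖) * ‖(η : TLie Λ)‖ :=
    (norm_tsum_le_tsum_norm (moment_summable_and_bound Λ v η).1).trans
      (moment_summable_and_bound Λ v η).2
  exact h2

theorem inner_zPart_sub_wPart_comm (x y : ℍ[ℝ]) :
    inner ℝ x (zPart q y - wPart q y) = inner ℝ y (zPart q x - wPart q x) := by
  have e : ∀ p : ℍ[ℝ], zPart q p - wPart q p = -(unitI * p * q) := by
    intro p
    rw [zPart, wPart, ← smul_sub]
    module
  rw [e, e, Quaternion.inner_def, Quaternion.inner_def, star_neg, star_neg, star_mul, star_mul,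
    star_mul, star_mul, star_complexStructure, star_unitI]
  have hq := complexStructure_re q
  simp [hq]
  ring

theorem norm_sq_zPart_sub_norm_sq_wPart (x : ℍ[ℝ]) :
    ‖zPart q x‖ ^ 2 - ‖wPart q x‖ ^ 2 = inner ℝ x (zPart q x - wPart q x) := by
  nth_rewrite 3 [← zPart_add_wPart q x]
  rw [inner_add_left, inner_sub_right, inner_sub_right, inner_zPart_wPart,
    real_inner_comm (zPart q x) (wPart q x), inner_zPart_wPart, real_inner_self_eq_norm_sq,
    real_inner_self_eq_norm_sq]
  ring

theorem norm_zPart_sub_wPart_le_sqrt_weight (k : 𝕃) :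
    ‖zPart q (Λ k) - wPart q (Λ k)‖ ≤ 4 * Real.sqrt (weight Λ k) := by
  have h1 := norm_zPart_le_sqrt_weight (q := q) (Λ := Λ) k
  have h2 := norm_wPart_le_sqrt_weight (q := q) (Λ := Λ) k
  linarith [norm_sub_le (zPart q (Λ k)) (wPart q (Λ k))]

/-- The real moment map as a continuous quadratic map of `v`. -/
theorem realMoment_eq (v : LTwo 𝕃) :
    realMoment q Λ u v = ((innerSL ℝ v).comp
      (weightedMul Λ (fun k => zPart q (Λ k) - wPart q (Λ k)) 4
        norm_zPart_sub_wPart_le_sqrt_weight +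
      (1 / 2 : ℝ) • (mulLTwo Λ).flip ((2 : ℝ) • zPartL q v - v))).comp (nLie Λ u).subtypeL := by
  ext η
  refine (hasSum_realMoment v η).unique ?_
  have h := lp.hasSum_inner (𝕜 := ℝ) v ((weightedMul Λ (fun k => zPart q (Λ k) - wPart q (Λ k)) 4
        norm_zPart_sub_wPart_le_sqrt_weight +
      (1 / 2 : ℝ) • (mulLTwo Λ).flip ((2 : ℝ) • zPartL q v - v)) (η : TLie Λ))
  refine h.congr_fun fun k => ?_
  have e : ((weightedMul Λ (fun k => zPart q (Λ k) - wPart q (Λ k)) 4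
        norm_zPart_sub_wPart_le_sqrt_weight +
      (1 / 2 : ℝ) • (mulLTwo Λ).flip ((2 : ℝ) • zPartL q v - v)) (η : TLie Λ)) k =
      (η : TLie Λ).seq k • ((zPart q (Λ k) - wPart q (Λ k)) +
        (1 / 2 : ℝ) • (zPart q (v k) - wPart q (v k))) := by
    have hw : wPart q (v k) = v k - zPart q (v k) := by
      rw [eq_sub_iff_add_eq, add_comm, zPart_add_wPart]
    have e0 : ((weightedMul Λ (fun k => zPart q (Λ k) - wPart q (Λ k)) 4
        norm_zPart_sub_wPart_le_sqrt_weight +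
      (1 / 2 : ℝ) • (mulLTwo Λ).flip ((2 : ℝ) • zPartL q v - v)) (η : TLie Λ)) k =
      (η : TLie Λ).seq k • (zPart q (Λ k) - wPart q (Λ k)) +
      (1 / 2 : ℝ) • ((η : TLie Λ).seq k • ((2 : ℝ) • zPart q (v k) - v k)) := rfl
    rw [e0, hw]
    module
  have h1 := norm_sq_zPart_sub_norm_sq_wPart (q := q) (point Λ v k)
  have h2 := norm_sq_zPart_sub_norm_sq_wPart (q := q) (Λ k)
  have h3 := inner_zPart_sub_wPart_comm (q := q) (Λ k) (v k)
  rw [e, inner_smul_right, inner_add_right, inner_smul_right, inner_lam, h1, h2, zPart_point,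
    wPart_point, point, add_sub_add_comm, inner_add_left, inner_add_right, inner_add_right, h3]
  ring

theorem contDiff_realMoment : ContDiff ℝ ∞ (realMoment q Λ u) := by
  have e : realMoment q Λ u = fun v => ((innerSL ℝ v).comp
      (weightedMul Λ (fun k => zPart q (Λ k) - wPart q (Λ k)) 4
        norm_zPart_sub_wPart_le_sqrt_weight +
      (1 / 2 : ℝ) • (mulLTwo Λ).flip ((2 : ℝ) • zPartL q v - v))).comp (nLie Λ u).subtypeL :=
    funext realMoment_eq
  rw [e]
  refine ContDiff.clm_comp (ContDiff.clm_comp (innerSL ℝ).contDiff (contDiff_const.add ?_))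
    contDiff_const
  exact ((mulLTwo Λ).flip.contDiff.comp
    (((zPartL q).contDiff.const_smul (2 : ℝ)).sub contDiff_id)).const_smul (1 / 2 : ℝ)

theorem contDiff_expMove_nLie :
    ContDiff ℝ ∞ (fun p : LTwo 𝕃 × nLie Λ u => expMove q Λ p.1 (p.2 : TLie Λ)) := by
  have h0 : ContDiff ℝ ∞ (fun p : LTwo 𝕃 × nLie Λ u => (p.1, (p.2 : TLie Λ))) :=
    contDiff_fst.prodMk
      ((ContinuousLinearMap.contDiff (nLie Λ u).subtypeL).comp contDiff_snd)
  exact ContDiff.comp (g := fun p : LTwo 𝕃 × TLie Λ => expMove q Λ p.1 p.2)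
    (f := fun p : LTwo 𝕃 × nLie Λ u => (p.1, (p.2 : TLie Λ))) contDiff_expMove h0

theorem contDiff_orbitMoment :
    ContDiff ℝ ∞ (fun p : LTwo 𝕃 × nLie Λ u => orbitMoment q Λ u p.1 p.2) :=
  contDiff_realMoment.comp contDiff_expMove_nLie

end

section

/-! ### Strongly monotone maps from a Hilbert space to its dual -/

section StronglyMonotone

variable {V : Type*} [NormedAddCommGroup V] [InnerProductSpace ℝ V] {g : V → StrongDual ℝ V}
  {c : ℝ}

theorem coercive_of_hasFDerivAt (hmono : ∀ y y', c * ‖y - y'‖ ^ 2 ≤ (g y - g y') (y - y'))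
    {D : V →L[ℝ] StrongDual ℝ V} {y : V} (hD : HasFDerivAt g D y) (h : V) :
    c * ‖h‖ ^ 2 ≤ D h h := by
  have h1 : HasDerivAt (fun t : ℝ => y + t • h) h 0 := by
    simpa using ((hasDerivAt_id (0 : ℝ)).smul_const h).const_add y
  have hD' : HasFDerivAt g D (y + (0 : ℝ) • h) := by simpa using hD
  have h2 : HasDerivAt (fun t : ℝ => g (y + t • h)) (D h) 0 := hD'.comp_hasDerivAt 0 h1
  have h3 : HasDerivAt (fun t : ℝ => g (y + t • h) h) (D h h) 0 := by
    simpa using h2.clm_apply (hasDerivAt_const (0 : ℝ) h)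
  have h4 : Tendsto (slope (fun t : ℝ => g (y + t • h) h) 0) (𝓝[>] 0) (𝓝 (D h h)) :=
    (hasDerivAt_iff_tendsto_slope.1 h3).mono_left
      (nhdsWithin_mono _ fun t ht => ne_of_gt ht)
  refine ge_of_tendsto h4 ?_
  filter_upwards [self_mem_nhdsWithin] with t ht
  have ht' : 0 < t := ht
  have h5 := hmono (y + t • h) y
  rw [add_sub_cancel_left, norm_smul, Real.norm_of_nonneg ht'.le, map_smul, sub_apply,
    smul_eq_mul] at h5
  rw [slope_def_field, zero_smul, add_zero, sub_zero, le_div_iff₀ ht']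
  have h6 : t * (c * ‖h‖ ^ 2 * t) ≤ t * (g (y + t • h) h - g y h) := by nlinarith
  exact le_of_mul_le_mul_left h6 ht'

/-- The Lax–Milgram theorem, for bilinear forms as maps to the dual space. -/
theorem isInvertible_of_coercive [CompleteSpace V] (hc : 0 < c) {D : V →L[ℝ] StrongDual ℝ V}
    (hD : ∀ h, c * ‖h‖ ^ 2 ≤ D h h) : D.IsInvertible := by
  have hco : IsCoercive D := ⟨c, hc, fun h => by rw [mul_assoc, ← sq]; exact hD h⟩
  have hker : D.ker = ⊥ := by
    rw [LinearMap.ker_eq_bot']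
    intro h hh
    have h1 := hD h
    rw [show D h = 0 from hh] at h1
    have h2 : ‖h‖ ^ 2 ≤ 0 := by
      by_contra! hlt
      have := mul_pos hc hlt
      simp at h1
      linarith
    exact norm_eq_zero.1 (pow_eq_zero_iff two_ne_zero |>.1 (le_antisymm h2 (by positivity)))
  have hrange : D.range = ⊤ := by
    rw [LinearMap.range_eq_top]
    intro ξ
    refine ⟨hco.continuousLinearEquivOfBilin.symm ((InnerProductSpace.toDual ℝ V).symm ξ), ?_⟩
    ext w
    have := hco.continuousLinearEquivOfBilin_apply
      (hco.continuousLinearEquivOfBilin.symm ((InnerProductSpace.toDual ℝ V).symm ξ)) w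
    rw [ContinuousLinearEquiv.apply_symm_apply, InnerProductSpace.toDual_symm_apply] at this
    exact this.symm
  exact ⟨ContinuousLinearEquiv.ofBijective D hker hrange, by ext; rfl⟩

/-- A strongly monotone `C¹` map from a Hilbert space to its dual is surjective: its range is
open by the inverse function theorem and closed by the monotonicity estimate. -/
theorem surjective_of_stronglyMonotone [CompleteSpace V] (hg : ContDiff ℝ 1 g) (hc : 0 < c)
    (hmono : ∀ y y', c * ‖y - y'‖ ^ 2 ≤ (g y - g y') (y - y')) : Function.Surjective g := by
  have hlip : ∀ y y', ‖y - y'‖ ≤ c⁻¹ * ‖g y - g y'‖ := by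
    intro y y'
    rw [le_inv_mul_iff₀ hc]
    have h1 := (hmono y y').trans ((le_abs_self _).trans ((g y - g y').le_opNorm (y - y')))
    rcases (norm_nonneg (y - y')).eq_or_lt with h0 | h0
    · rw [← h0, mul_zero]; exact norm_nonneg _
    · refine le_of_mul_le_mul_right ?_ h0
      rwa [mul_assoc, ← sq]
  have hopen : IsOpen (Set.range g) := by
    rw [isOpen_iff_mem_nhds]
    rintro _ ⟨y, rfl⟩
    have hs : HasStrictFDerivAt g (fderiv ℝ g y) y := hg.contDiffAt.hasStrictFDerivAt one_ne_zero
    obtain ⟨e, he⟩ := isInvertible_of_coercive hc (coercive_of_hasFDerivAt hmono hs.hasFDerivAt)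
    rw [← he] at hs
    rw [← hs.map_nhds_eq_of_equiv]
    exact mem_map.2 (univ_mem' fun z => Set.mem_range_self z)
  have hclosed : IsClosed (Set.range g) := by
    refine isClosed_of_closure_subset fun ξ hξ => ?_
    obtain ⟨x, hx, hlim⟩ := mem_closure_iff_seq_limit.1 hξ
    choose y hy using hx
    have hcau : CauchySeq y := by
      rw [Metric.cauchySeq_iff]
      intro ε hε
      obtain ⟨N, hN⟩ := Metric.cauchySeq_iff.1 hlim.cauchySeq (c * ε) (by positivity)
      refine ⟨N, fun m hm l hl => ?_⟩
      have h1 := hN m hm l hl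
      rw [← hy m, ← hy l, dist_eq_norm] at h1
      rw [dist_eq_norm]
      refine (hlip _ _).trans_lt ?_
      rwa [inv_mul_lt_iff₀ hc]
    obtain ⟨z, hz⟩ := cauchySeq_tendsto_of_complete hcau
    refine ⟨z, tendsto_nhds_unique ((hg.continuous.tendsto z).comp hz) ?_⟩
    have e : g ∘ y = x := funext hy
    rwa [e]
  have huniv := IsClopen.eq_univ ⟨hclosed, hopen⟩ (Set.range_nonempty g)
  exact Set.range_eq_univ.1 huniv

theorem tendsto_div_norm_of_stronglyMonotone (hc : 0 < c)
    (hmono : ∀ y y', c * ‖y - y'‖ ^ 2 ≤ (g y - g y') (y - y')) :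
    Tendsto (fun y => g y y / ‖y‖) (Bornology.cobounded V) atTop := by
  have h1 : Tendsto (fun y : V => c * ‖y‖ - ‖g 0‖) (Bornology.cobounded V) atTop :=
    tendsto_atTop_add_const_right _ _ (tendsto_norm_cobounded_atTop.const_mul_atTop hc)
  refine tendsto_atTop_mono (fun y => ?_) h1
  rcases (norm_nonneg y).eq_or_lt with h0 | h0
  · rw [← h0, mul_zero, zero_sub, div_zero]
    exact neg_nonpos.2 (norm_nonneg _)
  · rw [le_div_iff₀ h0]
    have h2 := hmono y 0
    rw [sub_zero, sub_apply] at h2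
    have h3 := (g 0).le_opNorm y
    have h4 := neg_abs_le (g 0 y)
    rw [Real.norm_eq_abs] at h3
    nlinarith

/-- The implicit function theorem at a parameter for which the map is strongly monotone. The
solution is smooth at all nearby parameters (being smooth at one point says less, as the
neighbourhoods on which finitely many derivatives exist may shrink). -/
theorem exists_contDiffAt_of_stronglyMonotone [CompleteSpace V] {E : Type*}
    [NormedAddCommGroup E] [NormedSpace ℝ E] [CompleteSpace E] {f : E × V → StrongDual ℝ V}
    (hf : ContDiff ℝ ∞ f) {x : E} (hc : 0 < c)
    (hmono : ∀ y y', c * ‖y - y'‖ ^ 2 ≤ (f (x, y) - f (x, y')) (y - y')) (y : V) :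
    ∃ Y : E → V, (∀ᶠ x' in 𝓝 x, ContDiffAt ℝ ∞ Y x') ∧ Y x = y ∧
      ∀ᶠ x' in 𝓝 x, f (x', Y x') = f (x, y) := by
  have cdf : ∀ p, ContDiffAt ℝ ∞ f p := fun p => hf.contDiffAt
  have hne : (∞ : WithTop ℕ∞) ≠ 0 := by simp
  have hD : HasFDerivAt (fun y' => f (x, y'))
      (fderiv ℝ f (x, y) ∘L ContinuousLinearMap.inr ℝ E V) y :=
    HasFDerivAt.comp (g := f) y ((cdf _).differentiableAt (by simp)).hasFDerivAt
      (hasFDerivAt_prodMk_right x y)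
  have hinv := isInvertible_of_coercive hc (coercive_of_hasFDerivAt hmono hD)
  set Y := (cdf (x, y)).implicitFunction hne hinv with hY
  have hYx : Y x = y := (cdf (x, y)).implicitFunction_apply_self hne hinv
  have hYsol : ∀ᶠ x' in 𝓝 x, f (x', Y x') = f (x, y) :=
    (cdf (x, y)).eventually_apply_implicitFunction hne hinv
  have hYuniq : ∀ᶠ p in 𝓝 (x, y), f p = f (x, y) ↔ Y p.1 = p.2 :=
    (cdf (x, y)).eventually_apply_eq_iff_implicitFunction hne hinv
  have hYcont : ContinuousAt Y x :=
    ((cdf (x, y)).contDiffAt_implicitFunction hne hinv).continuousAt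
  have hgraph : Tendsto (fun x' => (x', Y x')) (𝓝 x) (𝓝 (x, y)) := by
    have := continuousAt_id.prodMk hYcont
    rwa [ContinuousAt, id, hYx] at this
  have hopen : ∀ᶠ p in 𝓝 (x, y),
      (fderiv ℝ f p ∘L ContinuousLinearMap.inr ℝ E V).IsInvertible := by
    have hcont : Continuous fun p => fderiv ℝ f p ∘L ContinuousLinearMap.inr ℝ E V :=
      (hf.continuous_fderiv (by simp)).clm_comp continuous_const
    obtain ⟨e, he⟩ := hinv
    have h1 := ContinuousLinearEquiv.nhds e
    rw [he] at h1
    exact hcont.continuousAt.eventually h1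
  refine ⟨Y, ?_, hYx, hYsol⟩
  filter_upwards [hgraph.eventually hopen, hgraph.eventually hYuniq.eventually_nhds, hYsol]
    with x' hinv' huniq' hsol'
  -- near `x'` the solution agrees with the implicit function based at `(x', Y x')`
  have hc' := (cdf (x', Y x')).contDiffAt_implicitFunction hne hinv'
  have hgraph' : Tendsto (fun z => (z, (cdf (x', Y x')).implicitFunction hne hinv' z))
      (𝓝 x') (𝓝 (x', Y x')) := by
    have := continuousAt_id.prodMk hc'.continuousAt
    rwa [ContinuousAt, id, (cdf (x', Y x')).implicitFunction_apply_self hne hinv'] at this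
  refine hc'.congr_of_eventuallyEq ?_
  filter_upwards [hgraph'.eventually huniq',
    (cdf (x', Y x')).eventually_apply_implicitFunction hne hinv'] with z h1 h2
  exact h1.1 (h2.trans hsol')

end StronglyMonotone

/-! ### The real moment map along an orbit -/

theorem sq_sub_le_sinh_sub_mul (a b : ℝ) :
    (a - b) ^ 2 ≤ (a - b) * (Real.sinh a - Real.sinh b) := by
  rcases le_total b a with h | h
  · have := Real.sinh_sub_id_strictMono.monotone h
    beta_reduce at this
    nlinarith
  · have := Real.sinh_sub_id_strictMono.monotone h
    beta_reduce at this
    nlinarith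

/-- Replacing both coefficients by their minimum leaves a multiple of `sinh (2 a) - sinh (2 b)`. -/
theorem two_mul_min_mul_sq_le {A B : ℝ} (hA : 0 ≤ A) (hB : 0 ≤ B) (a b : ℝ) :
    2 * (min A B * (a - b) ^ 2) ≤ 1 / 2 * ((a - b) * (A * (Real.exp (2 * a) - Real.exp (2 * b)) +
      B * (Real.exp (-2 * b) - Real.exp (-2 * a)))) := by
  have h12 : 0 ≤ (a - b) * (Real.exp (2 * a) - Real.exp (2 * b)) ∧
      0 ≤ (a - b) * (Real.exp (-2 * b) - Real.exp (-2 * a)) := by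
    rcases le_total b a with h | h
    · have h1 := Real.exp_le_exp.2 (show 2 * b ≤ 2 * a by linarith)
      have h2 := Real.exp_le_exp.2 (show -2 * a ≤ -2 * b by linarith)
      constructor <;> apply mul_nonneg <;> linarith
    · have h1 := Real.exp_le_exp.2 (show 2 * a ≤ 2 * b by linarith)
      have h2 := Real.exp_le_exp.2 (show -2 * b ≤ -2 * a by linarith)
      constructor <;> apply mul_nonneg_of_nonpos_of_nonpos <;> linarith
  have h3 := sq_sub_le_sinh_sub_mul (2 * a) (2 * b)
  rw [Real.sinh_eq, Real.sinh_eq, ← neg_mul, ← neg_mul] at h3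
  have h4 := mul_le_mul_of_nonneg_right (min_le_left A B) h12.1
  have h5 := mul_le_mul_of_nonneg_right (min_le_right A B) h12.2
  have h6 := mul_le_mul_of_nonneg_left h3 (le_min hA hB)
  nlinarith

variable {𝕃 : Type*} {n : ℕ} {u : 𝕃 → Fin n → ℤ} {Λ : 𝕃 → ℍ[ℝ]} {q : ComplexStructure}

theorem hasSum_orbitMoment (v : LTwo 𝕃) (y η : nLie Λ u) :
    HasSum (fun k => (η : TLie Λ).seq k * (inner ℝ (q : ℍ[ℝ]) (lam Λ k) +
      1 / 2 * (‖zPart q (point Λ v k)‖ ^ 2 * Real.exp (2 * (y : TLie Λ).seq k) -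
        ‖wPart q (point Λ v k)‖ ^ 2 * Real.exp (-2 * (y : TLie Λ).seq k))))
      (orbitMoment q Λ u v y η) := by
  refine (hasSum_realMoment (expMove q Λ v (y : TLie Λ)) η).congr_fun fun k => ?_
  have e1 : Real.exp (2 * (y : TLie Λ).seq k) = Real.exp ((y : TLie Λ).seq k) ^ 2 := by
    rw [← Real.exp_nat_mul]; norm_num
  have e2 : Real.exp (-2 * (y : TLie Λ).seq k) = Real.exp (-(y : TLie Λ).seq k) ^ 2 := by
    rw [← Real.exp_nat_mul]; congr 1; push_cast; ring
  rw [zPart_point_expMove, wPart_point_expMove, norm_smul, norm_smul, mul_pow, mul_pow,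
    Real.norm_eq_abs, Real.norm_eq_abs, sq_abs, sq_abs, e1, e2]
  ring

/-- Along the orbit of a point of the complex zero locus the real moment map is strongly
monotone. -/
theorem exists_stronglyMonotone (hspan : Submodule.span ℝ (Set.range (realVec u)) = ⊤)
    (hconv : Summable fun k => (1 + ‖lam Λ k‖)⁻¹) (hβ : BetaContinuous Λ u)
    (hflat : FlatsGeneric q Λ u) (hcom : Commensurable q Λ) {v : LTwo 𝕃}
    (hv : v ∈ complexZero q Λ u) :
    ∃ c > 0, ∀ y y' : nLie Λ u,
      c * ‖y - y'‖ ^ 2 ≤ (orbitMoment q Λ u v y - orbitMoment q Λ u v y') (y - y') := by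
  obtain ⟨c, hc, h⟩ := exists_coercive hspan hconv hβ hflat hcom hv
  refine ⟨c, hc, fun y y' => ?_⟩
  have h1 := (hasSum_orbitMoment (q := q) v y (y - y')).sub
    (hasSum_orbitMoment (q := q) v y' (y - y'))
  refine h _ (y - y').2 _ _ h1 fun k => ?_
  have h2 := two_mul_min_mul_sq_le (sq_nonneg ‖zPart q (point Λ v k)‖)
    (sq_nonneg ‖wPart q (point Λ v k)‖) ((y : TLie Λ).seq k) ((y' : TLie Λ).seq k)
  have h3 : 0 ≤ minSq Λ q v k := minSq_nonneg v k
  rw [← minSq] at h2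
  have e : ((y - y' : nLie Λ u) : TLie Λ).seq k = (y : TLie Λ).seq k - (y' : TLie Λ).seq k := rfl
  rw [e]
  nlinarith [mul_nonneg h3 (sq_nonneg ((y : TLie Λ).seq k - (y' : TLie Λ).seq k))]

theorem norm_sq_point_le (v : LTwo 𝕃) (k : 𝕃) :
    ‖point Λ v k‖ ^ 2 ≤ (2 + ‖v‖) ^ 2 * weight Λ k := by
  have := pow_le_pow_left₀ (norm_nonneg _) (norm_point_le Λ v k) 2
  rwa [mul_pow, Real.sq_sqrt (weight_pos Λ k).le] at this

variable (q Λ) in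
/-- The `k`-th term of the convex functional whose derivative is the real moment map along the
orbit. -/
def energyTerm (v : LTwo 𝕃) (k : 𝕃) (t : ℝ) : ℝ :=
  (1 / 4 : ℝ) * (‖zPart q (point Λ v k)‖ ^ 2 * Real.exp (2 * t) +
    ‖wPart q (point Λ v k)‖ ^ 2 * Real.exp (-2 * t) -
    (‖zPart q (point Λ v k)‖ ^ 2 + ‖wPart q (point Λ v k)‖ ^ 2) +
    4 * inner ℝ (q : ℍ[ℝ]) (lam Λ k) * t)

/-- The remainder of the first order expansion of a term of the functional. -/
theorem abs_energyTerm_sub_le (v : LTwo 𝕃) (k : 𝕃) {R t h : ℝ} (ht : |t| ≤ R)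
    (hh : |h| ≤ 1 / 2) :
    |energyTerm Λ q v k (t + h) - energyTerm Λ q v k t - h * (inner ℝ (q : ℍ[ℝ]) (lam Λ k) +
      1 / 2 * (‖zPart q (point Λ v k)‖ ^ 2 * Real.exp (2 * t) -
        ‖wPart q (point Λ v k)‖ ^ 2 * Real.exp (-2 * t)))| ≤
    (2 + ‖v‖) ^ 2 * Real.exp (2 * R) * (weight Λ k * h ^ 2) := by
  set A := ‖zPart q (point Λ v k)‖ ^ 2 with hA
  set B := ‖wPart q (point Λ v k)‖ ^ 2 with hB
  have hAB : A + B ≤ (2 + ‖v‖) ^ 2 * weight Λ k := by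
    rw [hA, hB, norm_sq_zPart_add_norm_sq_wPart]
    exact norm_sq_point_le v k
  have hA0 : 0 ≤ A := by positivity
  have hB0 : 0 ≤ B := by positivity
  have e : energyTerm Λ q v k (t + h) - energyTerm Λ q v k t -
      h * (inner ℝ (q : ℍ[ℝ]) (lam Λ k) +
        1 / 2 * (A * Real.exp (2 * t) - B * Real.exp (-2 * t))) =
      1 / 4 * (A * Real.exp (2 * t) * (Real.exp (2 * h) - 1 - 2 * h) +
        B * Real.exp (-2 * t) * (Real.exp (-2 * h) - 1 - -2 * h)) := by
    rw [energyTerm, energyTerm, mul_add 2 t h, mul_add (-2) t h, Real.exp_add, Real.exp_add]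
    ring
  rw [e]
  have h1 : |Real.exp (2 * h) - 1 - 2 * h| ≤ 4 * h ^ 2 := by
    refine (Real.abs_exp_sub_one_sub_id_le ?_).trans (by nlinarith)
    rw [abs_mul, abs_two]; linarith
  have h2 : |Real.exp (-2 * h) - 1 - -2 * h| ≤ 4 * h ^ 2 := by
    refine (Real.abs_exp_sub_one_sub_id_le ?_).trans (by nlinarith)
    rw [abs_mul, abs_neg, abs_two]; linarith
  have h3 : Real.exp (2 * t) ≤ Real.exp (2 * R) :=
    Real.exp_le_exp.2 (by linarith [le_abs_self t])
  have h4 : Real.exp (-2 * t) ≤ Real.exp (2 * R) :=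
    Real.exp_le_exp.2 (by linarith [neg_abs_le t])
  have h5 : |A * Real.exp (2 * t) * (Real.exp (2 * h) - 1 - 2 * h)| ≤
      A * Real.exp (2 * R) * (4 * h ^ 2) := by
    rw [abs_mul, abs_of_nonneg (by positivity : 0 ≤ A * Real.exp (2 * t))]
    gcongr
  have h6 : |B * Real.exp (-2 * t) * (Real.exp (-2 * h) - 1 - -2 * h)| ≤
      B * Real.exp (2 * R) * (4 * h ^ 2) := by
    rw [abs_mul, abs_of_nonneg (by positivity : 0 ≤ B * Real.exp (-2 * t))]
    gcongr
  rw [abs_mul, abs_of_pos (by norm_num : (0 : ℝ) < 1 / 4)]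
  have h7 := (abs_add_le _ _).trans (add_le_add h5 h6)
  calc _ ≤ 1 / 4 * (A * Real.exp (2 * R) * (4 * h ^ 2) + B * Real.exp (2 * R) * (4 * h ^ 2)) := by
        gcongr
    _ = (A + B) * (Real.exp (2 * R) * h ^ 2) := by ring
    _ ≤ ((2 + ‖v‖) ^ 2 * weight Λ k) * (Real.exp (2 * R) * h ^ 2) := by gcongr
    _ = _ := by ring

theorem TLie.tendsto_seq (t : TLie Λ) : Tendsto t.seq cofinite (𝓝 0) := by
  have h := t.hasSum_norm_sq.summable.tendsto_cofinite_zero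
  have h2 : Tendsto (fun k => t.seq k ^ 2) cofinite (𝓝 0) :=
    squeeze_zero (fun k => sq_nonneg _)
      (fun k => le_mul_of_one_le_left (sq_nonneg _) (one_le_weight Λ k)) h
  have h3 := h2.sqrt
  simp only [Real.sqrt_sq_eq_abs, Real.sqrt_zero] at h3
  exact (tendsto_zero_iff_abs_tendsto_zero _).2 h3

theorem summable_energyTerm (v : LTwo 𝕃) (y : nLie Λ u) :
    Summable fun k => energyTerm Λ q v k ((y : TLie Λ).seq k) := by
  have h1 := (hasSum_orbitMoment (q := q) v 0 y).summable
  have h2 : Summable fun k => energyTerm Λ q v k ((y : TLie Λ).seq k) -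
      (y : TLie Λ).seq k * (inner ℝ (q : ℍ[ℝ]) (lam Λ k) +
      1 / 2 * (‖zPart q (point Λ v k)‖ ^ 2 * Real.exp (2 * ((0 : nLie Λ u) : TLie Λ).seq k) -
        ‖wPart q (point Λ v k)‖ ^ 2 * Real.exp (-2 * ((0 : nLie Λ u) : TLie Λ).seq k))) := by
    refine Summable.of_norm_bounded_eventually
      ((y : TLie Λ).hasSum_norm_sq.summable.mul_left ((2 + ‖v‖) ^ 2 * Real.exp (2 * 0))) ?_
    have hev := (y : TLie Λ).tendsto_seq.eventually (Metric.closedBall_mem_nhds 0 one_half_pos)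
    filter_upwards [hev] with k hk
    have hk' : |(y : TLie Λ).seq k| ≤ 1 / 2 := by simpa using hk
    have h3 := abs_energyTerm_sub_le (q := q) (Λ := Λ) v k (R := 0) (t := 0) (by simp) hk'
    have h4 : energyTerm Λ q v k 0 = 0 := by simp [energyTerm]
    rw [zero_add, h4, sub_zero] at h3
    exact h3
  simpa using h1.add h2

variable (q u) in
/-- The convex functional on `𝔫` whose derivative is the real moment map along the orbit of
`Λ + v`. -/
def energy (v : LTwo 𝕃) (y : nLie Λ u) : ℝ :=
  ∑' k, energyTerm Λ q v k ((y : TLie Λ).seq k)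

theorem hasSum_energy (v : LTwo 𝕃) (y : nLie Λ u) :
    HasSum (fun k => energyTerm Λ q v k ((y : TLie Λ).seq k)) (energy u q v y) :=
  (summable_energyTerm v y).hasSum

theorem hasFDerivAt_energy (v : LTwo 𝕃) (y : nLie Λ u) :
    HasFDerivAt (energy u q v) (orbitMoment q Λ u v y) y := by
  refine hasFDerivAt_of_norm_sub_le_sq
    (C := (2 + ‖v‖) ^ 2 * Real.exp (2 * ‖(y : TLie Λ)‖)) fun h hh => ?_
  have h1 := ((hasSum_energy (q := q) v (y + h)).sub (hasSum_energy (q := q) v y)).sub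
    (hasSum_orbitMoment (q := q) v y h)
  refine h1.norm_le_of_bounded ((h : TLie Λ).hasSum_norm_sq.mul_left _) fun k => ?_
  exact abs_energyTerm_sub_le v k (TLie.abs_seq_le (y : TLie Λ) k)
    ((TLie.abs_seq_le (h : TLie Λ) k).trans hh)

theorem convexOn_energyTerm (v : LTwo 𝕃) (k : 𝕃) :
    ConvexOn ℝ Set.univ (energyTerm Λ q v k) := by
  have hexp : ∀ s : ℝ, ConvexOn ℝ Set.univ (fun t : ℝ => Real.exp (s * t)) := fun s =>
    convexOn_exp.comp_linearMap (LinearMap.mulLeft ℝ s)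
  have hA : (0 : ℝ) ≤ ‖zPart q (point Λ v k)‖ ^ 2 := by positivity
  have hB : (0 : ℝ) ≤ ‖wPart q (point Λ v k)‖ ^ 2 := by positivity
  refine ⟨convex_univ, fun s _ t _ a b ha hb hab => ?_⟩
  have h1 := mul_le_mul_of_nonneg_left ((hexp 2).2 (Set.mem_univ s) (Set.mem_univ t) ha hb hab) hA
  have h2 := mul_le_mul_of_nonneg_left
    ((hexp (-2)).2 (Set.mem_univ s) (Set.mem_univ t) ha hb hab) hB
  simp only [smul_eq_mul] at h1 h2
  obtain rfl : b = 1 - a := by linarith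
  simp only [energyTerm, smul_eq_mul]
  linarith

theorem convexOn_energy (v : LTwo 𝕃) :
    ConvexOn ℝ Set.univ (energy u q v : nLie Λ u → ℝ) := by
  refine ⟨convex_univ, fun y _ y' _ a b ha hb hab => ?_⟩
  refine hasSum_le (fun k => ?_) (hasSum_energy v (a • y + b • y'))
    (((hasSum_energy v y).mul_left a).add ((hasSum_energy v y').mul_left b))
  exact (convexOn_energyTerm v k).2 (Set.mem_univ _) (Set.mem_univ _) ha hb hab

theorem isBounded_image_orbitMoment (v : LTwo 𝕃) {B : Set (nLie Λ u)}
    (hB : Bornology.IsBounded B) : Bornology.IsBounded (orbitMoment q Λ u v '' B) := by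
  obtain ⟨R, hR⟩ := hB.exists_norm_le
  set S := ‖v‖ + 2 * (2 + ‖v‖) * (Real.exp R * R) with hS
  refine (isBounded_iff_forall_norm_le (E := StrongDual ℝ (nLie Λ u))).2 ⟨(2 + S) * S, ?_⟩
  rintro _ ⟨y, hy, rfl⟩
  have h1 : ‖expMove q Λ v (y : TLie Λ)‖ ≤ S := norm_expMove_le v (hR y hy)
  refine (norm_realMoment_le _).trans ?_
  have h0 := norm_nonneg (expMove q Λ v (y : TLie Λ))
  have hS0 : 0 ≤ S := h0.trans h1
  exact mul_le_mul (by linarith) h1 h0 (by linarith)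

theorem contDiff_orbitMoment_right (v : LTwo 𝕃) : ContDiff ℝ ∞ (orbitMoment q Λ u v) :=
  ContDiff.comp (g := fun p : LTwo 𝕃 × nLie Λ u => orbitMoment q Λ u p.1 p.2)
    (f := fun y : nLie Λ u => (v, y)) contDiff_orbitMoment (contDiff_const.prodMk contDiff_id)

/-- The implicit function theorem for `μ^ℝ(e^y · x) = ξ`: near a point of the complex zero locus,
the solution `y` extends to a smooth function of `x`. -/
theorem exists_contDiffAt_orbitMoment_eq (hβ : BetaContinuous Λ u) {v : LTwo 𝕃} {c : ℝ}
    (hc : 0 < c) (hmono : ∀ y y' : nLie Λ u,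
      c * ‖y - y'‖ ^ 2 ≤ (orbitMoment q Λ u v y - orbitMoment q Λ u v y') (y - y'))
    {y : nLie Λ u} {ξ : StrongDual ℝ (nLie Λ u)} (hy : orbitMoment q Λ u v y = ξ) :
    ∃ Y : LTwo 𝕃 → nLie Λ u, (∀ᶠ v' in 𝓝 v, ContDiffAt ℝ ∞ Y v') ∧ Y v = y ∧
      ∀ᶠ v' in 𝓝 v, orbitMoment q Λ u v' (Y v') = ξ := by
  have := completeSpace_nLie hβ
  subst hy
  exact exists_contDiffAt_of_stronglyMonotone
    (f := fun p : LTwo 𝕃 × nLie Λ u => orbitMoment q Λ u p.1 p.2) contDiff_orbitMoment hc hmono y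

end

section

/-! ### The group orbits and the moment maps -/

variable {𝕃 : Type*} {n : ℕ} {u : 𝕃 → Fin n → ℤ} {Λ : 𝕃 → ℍ[ℝ]} {q : ComplexStructure}

theorem coe_expUnit (r : ℝ) : ((expUnit r : ℂˣ) : ℂ) = Complex.exp r := rfl

theorem expUnit_mem_torusC (s : TLie Λ) : (fun k => expUnit (s.seq k)) ∈ torusC Λ := by
  change Summable fun k => weight Λ k * ‖1 - Complex.exp (s.seq k)‖ ^ 2
  refine (expSubOne s).hasSum_norm_sq.summable.congr fun k => ?_
  rw [expSubOne_seq, norm_sub_rev, ← Complex.ofReal_exp, ← Complex.ofReal_one,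
    ← Complex.ofReal_sub, Complex.norm_real, Real.norm_eq_abs, sq_abs]

theorem mem_torus_of_eq_exp {g : 𝕃 → ℂˣ} {θ : TLie Λ}
    (hg : ∀ k, (g k : ℂ) = Complex.exp (Complex.I * (θ.seq k : ℂ))) : g ∈ torus Λ := by
  constructor
  · change Summable fun k => weight Λ k * ‖1 - (g k : ℂ)‖ ^ 2
    refine Summable.of_nonneg_of_le
      (fun k => mul_nonneg (weight_pos Λ k).le (sq_nonneg _)) (fun k => ?_)
      θ.hasSum_norm_sq.summable
    have h := Real.norm_exp_I_mul_ofReal_sub_one_le (x := θ.seq k)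
    rw [norm_sub_rev, hg k, ← sq_abs (θ.seq k)]
    exact mul_le_mul_of_nonneg_left (pow_le_pow_left₀ (norm_nonneg _) h 2) (weight_pos Λ k).le
  · intro k
    rw [hg k, mul_comm, Complex.norm_exp_ofReal_mul_I]

theorem norm_eq_one_of_mem_groupN {g : 𝕃 → ℂˣ} (hg : g ∈ groupN Λ u) (k : 𝕃) :
    ‖(g k : ℂ)‖ = 1 := hg.1.2 k

theorem groupN_le_groupNC : groupN Λ u ≤ groupNC Λ u := by
  rintro g ⟨hg, θ, hθ, m, hm⟩
  refine ⟨hg.1, θ, 0, fun k => ?_, m, hm, (nLie Λ u).zero_mem⟩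
  rw [hθ k]; simp

theorem expUnit_mem_groupNC (s : nLie Λ u) :
    (fun k => expUnit ((s : TLie Λ).seq k)) ∈ groupNC Λ u := by
  refine ⟨expUnit_mem_torusC _, 0, -(s : TLie Λ), fun k => ?_, 0, ?_, (nLie Λ u).neg_mem s.2⟩
  · change Complex.exp _ = _
    congr 1
    rw [TLie.seq_zero, TLie.seq_neg]
    push_cast
    linear_combination ((s : TLie Λ).seq k : ℂ) * Complex.I_mul_I
  · have e : (fun i : Fin n => 2 * Real.pi * ((0 : Fin n → ℤ) i : ℝ)) = 0 := by ext; simp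
    rw [e]
    exact (nLie Λ u).zero_mem

/-- The polar decomposition `N^ℂ = N · exp(i 𝔫)`. -/
theorem exists_eq_mul_expUnit {g : 𝕃 → ℂˣ} (hg : g ∈ groupNC Λ u) :
    ∃ h ∈ groupN Λ u, ∃ s : nLie Λ u, ∀ k, g k = h k * expUnit ((s : TLie Λ).seq k) := by
  obtain ⟨-, θ, s, hθ, m, hm, hs⟩ := hg
  let h : 𝕃 → ℂˣ := fun k =>
    Units.mk0 (Complex.exp (Complex.I * (θ.seq k : ℂ))) (Complex.exp_ne_zero _)
  have hh : ∀ k, (h k : ℂ) = Complex.exp (Complex.I * (θ.seq k : ℂ)) := fun k => rfl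
  refine ⟨h, ⟨mem_torus_of_eq_exp hh, θ, hh, m, hm⟩, ⟨-s, (nLie Λ u).neg_mem hs⟩,
    fun k => Units.ext ?_⟩
  rw [Units.val_mul, hθ k, hh, coe_expUnit, ← Complex.exp_add, TLie.seq_neg]
  congr 1
  push_cast
  linear_combination (s.seq k : ℂ) * Complex.I_mul_I

theorem NRel.ncRel {v v' : LTwo 𝕃} (h : NRel Λ u v v') : NCRel q Λ u v v' := by
  obtain ⟨g, hg, h⟩ := h
  refine ⟨g, groupN_le_groupNC hg, fun k => ?_⟩
  rw [complexAct_of_norm_eq_one q (norm_eq_one_of_mem_groupN hg k), h]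

theorem ncRel_expMove (v : LTwo 𝕃) (y : nLie Λ u) :
    NCRel q Λ u v (expMove q Λ v (y : TLie Λ)) :=
  ⟨_, expUnit_mem_groupNC y, fun k => point_expMove v _ k⟩

theorem NCRel.exists_nRel_expMove {v v' : LTwo 𝕃} (h : NCRel q Λ u v v') :
    ∃ y : nLie Λ u, NRel Λ u (expMove q Λ v (y : TLie Λ)) v' := by
  obtain ⟨g, hg, h⟩ := h
  obtain ⟨e, he, s, hs⟩ := exists_eq_mul_expUnit hg
  refine ⟨s, e, he, fun k => ?_⟩
  rw [h, hs, complexAct_mul, ← point_expMove,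
    complexAct_of_norm_eq_one q (norm_eq_one_of_mem_groupN he k)]

theorem NRel.momentCoeff_eq {v v' : LTwo 𝕃} (h : NRel Λ u v v') (k : 𝕃) :
    momentCoeff Λ v' k = momentCoeff Λ v k := by
  obtain ⟨g, hg, h⟩ := h
  have h1 : star ((g k : ℂ) : ℍ[ℝ]) * ((g k : ℂ) : ℍ[ℝ]) = 1 := by
    rw [Quaternion.star_mul_self, Quaternion.normSq_eq_norm_mul_self, norm_coeComplex,
      norm_eq_one_of_mem_groupN hg]
    simp
  rw [momentCoeff, momentCoeff, h k, star_mul]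
  congr 2
  calc star (point Λ v k) * star ((g k : ℂ) : ℍ[ℝ]) * unitI * (((g k : ℂ) : ℍ[ℝ]) * point Λ v k)
      = star (point Λ v k) * (star ((g k : ℂ) : ℍ[ℝ]) * (unitI * ((g k : ℂ) : ℍ[ℝ]))) *
          point Λ v k := by simp only [mul_assoc]
    _ = star (point Λ v k) * ((star ((g k : ℂ) : ℍ[ℝ]) * ((g k : ℂ) : ℍ[ℝ])) * unitI) *
          point Λ v k := by rw [coeComplex_mul_unitI, mul_assoc (star ((g k : ℂ) : ℍ[ℝ]))]
    _ = _ := by rw [h1, one_mul]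

/-- The moment map for `N` is `N`-invariant. -/
theorem NRel.nMoment_eq {v v' : LTwo 𝕃} (h : NRel Λ u v v') :
    nMoment Λ u v' = nMoment Λ u v := by
  ext1 η
  exact (hasSum_hyperMoment v' (η : TLie Λ)).unique
    ((hasSum_hyperMoment v (η : TLie Λ)).congr_fun fun k => by rw [h.momentCoeff_eq k])

theorem NRel.realMoment_eq {v v' : LTwo 𝕃} (h : NRel Λ u v v') :
    realMoment q Λ u v' = realMoment q Λ u v := by
  rw [realMoment, realMoment, h.nMoment_eq]

theorem hasSum_transverse_nMoment (v : LTwo 𝕃) (η : nLie Λ u) :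
    HasSum (fun k => (η : TLie Λ).seq k • transverse q (momentCoeff Λ v k))
      (transverse q (nMoment Λ u v η)) := by
  have h := (transverseL q).hasSum (hasSum_hyperMoment v (η : TLie Λ))
  simp only [transverseL_apply, transverse_smul] at h
  exact h

/-- The complex moment map for `N` is `N^ℂ`-invariant. -/
theorem NCRel.mem_complexZero {v v' : LTwo 𝕃} (h : NCRel q Λ u v v')
    (hv : v ∈ complexZero q Λ u) : v' ∈ complexZero q Λ u := by
  obtain ⟨g, hg, h⟩ := h
  intro η
  rw [← hv η]
  refine (hasSum_transverse_nMoment v' η).unique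
    ((hasSum_transverse_nMoment v η).congr_fun fun k => ?_)
  rw [transverse_momentCoeff, transverse_momentCoeff, h k, star_wPart_mul_zPart_complexAct]

theorem mem_hyperZero_iff {v : LTwo 𝕃} :
    v ∈ hyperZero Λ u ↔ v ∈ complexZero q Λ u ∧ realMoment q Λ u v = 0 := by
  refine ⟨fun h => ⟨hyperZero_subset_complexZero q Λ u h, ?_⟩, fun ⟨h1, h2⟩ => ?_⟩
  · rw [realMoment, show nMoment Λ u v = 0 from h, ContinuousLinearMap.comp_zero]
  · change nMoment Λ u v = 0
    ext1 η
    have h3 := h1 η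
    have h4 : inner ℝ (q : ℍ[ℝ]) (nMoment Λ u v η) = 0 := DFunLike.congr_fun h2 η
    rw [transverse, h4, zero_smul, sub_zero] at h3
    rw [h3, zero_apply]

/-- By strong monotonicity the `N^ℂ`-orbit meets each level set of the real moment map in at most
one `N`-orbit. -/
theorem nRel_expMove_congr {v v' : LTwo 𝕃} {c : ℝ} (hc : 0 < c)
    (hmono : ∀ y y' : nLie Λ u,
      c * ‖y - y'‖ ^ 2 ≤ (orbitMoment q Λ u v y - orbitMoment q Λ u v y') (y - y'))
    {y : nLie Λ u} (h : NCRel q Λ u v v')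
    (hreal : realMoment q Λ u v' = orbitMoment q Λ u v y) :
    NRel Λ u (expMove q Λ v (y : TLie Λ)) v' := by
  obtain ⟨y', hy'⟩ := h.exists_nRel_expMove
  rw [hy'.realMoment_eq (q := q)] at hreal
  have h1 := hmono y' y
  rw [show orbitMoment q Λ u v y' = orbitMoment q Λ u v y from hreal, sub_self] at h1
  have h2 : ‖y' - y‖ ^ 2 ≤ 0 := by
    have h3 : c * ‖y' - y‖ ^ 2 ≤ 0 := h1
    by_contra! h4
    linarith [mul_pos hc h4]
  have h5 : y' - y = 0 :=
    norm_eq_zero.1 (pow_eq_zero_iff two_ne_zero |>.1 (le_antisymm h2 (by positivity)))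
  rwa [← sub_eq_zero.1 h5]

/-! ### The diffeomorphism of the hyperkähler with the complex quotient -/

/-- The map of quotients which is induced by the inclusion of the zero loci. -/
def quotientMap (q : ComplexStructure) (Λ : 𝕃 → ℍ[ℝ]) (u : 𝕃 → Fin n → ℤ) :
    HyperQuotient Λ u → ComplexQuotient q Λ u :=
  Quotient.map (fun v => ⟨v, hyperZero_subset_complexZero q Λ u v.2⟩) fun _ _ h => NRel.ncRel h

theorem quotientMap_mk (v : hyperZero Λ u) :
    quotientMap q Λ u (Quotient.mk (hyperSetoid Λ u) v) =
      Quotient.mk (complexSetoid q Λ u) ⟨v, hyperZero_subset_complexZero q Λ u v.2⟩ := rfl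

theorem continuous_quotientMap : Continuous (quotientMap q Λ u) :=
  Continuous.quotient_map' (Continuous.subtype_mk continuous_subtype_val _) _

/-- Near a point of the complex zero locus, moving along the orbits to the zero locus of the real
moment map is the restriction of a smooth map. -/
theorem exists_smooth_retraction (hspan : Submodule.span ℝ (Set.range (realVec u)) = ⊤)
    (hconv : Summable fun k => (1 + ‖lam Λ k‖)⁻¹) (hβ : BetaContinuous Λ u)
    (hflat : FlatsGeneric q Λ u) (hcom : Commensurable q Λ) {v : LTwo 𝕃}
    (hv : v ∈ complexZero q Λ u) :
    ∃ R : LTwo 𝕃 → LTwo 𝕃, ∀ᶠ v' in 𝓝 v, ContDiffAt ℝ ∞ R v' ∧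
      (v' ∈ complexZero q Λ u → R v' ∈ hyperZero Λ u ∧ NCRel q Λ u v' (R v')) := by
  have := completeSpace_nLie hβ
  obtain ⟨c, hc, hmono⟩ := exists_stronglyMonotone hspan hconv hβ hflat hcom hv
  obtain ⟨y, hy⟩ := surjective_of_stronglyMonotone
    ((contDiff_orbitMoment_right v).of_le (by simp)) hc hmono 0
  obtain ⟨Y, hYd, -, hY0⟩ := exists_contDiffAt_orbitMoment_eq hβ hc hmono hy
  refine ⟨fun v' => expMove q Λ v' (Y v' : TLie Λ), ?_⟩
  filter_upwards [hYd, hY0] with v' h1 h2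
  constructor
  · exact ContDiffAt.comp (g := fun p : LTwo 𝕃 × nLie Λ u => expMove q Λ p.1 (p.2 : TLie Λ))
      (f := fun w => (w, Y w)) v' contDiff_expMove_nLie.contDiffAt (contDiffAt_id.prodMk h1)
  · intro hv'
    have h3 := ncRel_expMove (q := q) v' (Y v')
    exact ⟨mem_hyperZero_iff.2 ⟨h3.mem_complexZero hv', h2⟩, h3⟩

theorem quotientMap_injective (hspan : Submodule.span ℝ (Set.range (realVec u)) = ⊤)
    (hconv : Summable fun k => (1 + ‖lam Λ k‖)⁻¹) (hβ : BetaContinuous Λ u)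
    (hflat : FlatsGeneric q Λ u) (hcom : Commensurable q Λ) :
    Function.Injective (quotientMap q Λ u) := by
  intro a b hab
  induction a using Quotient.inductionOn with | _ v
  induction b using Quotient.inductionOn with | _ v'
  have h : NCRel q Λ u v v' := Quotient.exact hab
  have hv := (mem_hyperZero_iff (q := q)).1 v.2
  have hv' := (mem_hyperZero_iff (q := q)).1 v'.2
  obtain ⟨c, hc, hmono⟩ := exists_stronglyMonotone hspan hconv hβ hflat hcom hv.1
  have h0 : expMove q Λ (v : LTwo 𝕃) ((0 : nLie Λ u) : TLie Λ) = v := by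
    apply lp.ext
    funext k
    change complexAct q (expUnit 0) (point Λ v k) - Λ k = (v : LTwo 𝕃) k
    rw [complexAct_expUnit, neg_zero, Real.exp_zero, one_smul, one_smul, zPart_add_wPart, point]
    abel
  have h1 := nRel_expMove_congr hc hmono (y := 0) h (by
    rw [orbitMoment, h0, hv.2, hv'.2])
  rw [h0] at h1
  exact Quotient.sound h1

theorem quotientMap_surjective (hspan : Submodule.span ℝ (Set.range (realVec u)) = ⊤)
    (hconv : Summable fun k => (1 + ‖lam Λ k‖)⁻¹) (hβ : BetaContinuous Λ u)
    (hflat : FlatsGeneric q Λ u) (hcom : Commensurable q Λ) :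
    Function.Surjective (quotientMap q Λ u) := by
  intro b
  induction b using Quotient.inductionOn with | _ v
  obtain ⟨R, hR⟩ := exists_smooth_retraction hspan hconv hβ hflat hcom v.2
  obtain ⟨h1, h2⟩ := hR.self_of_nhds.2 v.2
  exact ⟨Quotient.mk _ ⟨R v, h1⟩, Quotient.sound ((NCRel.equivalence q Λ u).symm h2)⟩

/-- The homeomorphism of the hyperkähler with the complex quotient. -/
def quotientHomeo (hspan : Submodule.span ℝ (Set.range (realVec u)) = ⊤)
    (hconv : Summable fun k => (1 + ‖lam Λ k‖)⁻¹) (hβ : BetaContinuous Λ u)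
    (hflat : FlatsGeneric q Λ u) (hcom : Commensurable q Λ) :
    HyperQuotient Λ u ≃ₜ ComplexQuotient q Λ u :=
  have hbij : Function.Bijective (quotientMap q Λ u) :=
    ⟨quotientMap_injective hspan hconv hβ hflat hcom,
      quotientMap_surjective hspan hconv hβ hflat hcom⟩
  { Equiv.ofBijective (quotientMap q Λ u) hbij with
    continuous_toFun := continuous_quotientMap
    continuous_invFun := by
      change Continuous (Equiv.ofBijective (quotientMap q Λ u) hbij).symm
      set e := Equiv.ofBijective (quotientMap q Λ u) hbij with he
      refine isQuotientMap_quotient_mk'.continuous_iff.2 (continuous_iff_continuousAt.2 fun v => ?_)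
      obtain ⟨R, hR⟩ := exists_smooth_retraction hspan hconv hβ hflat hcom v.2
      have hinv : ∀ (x : complexZero q Λ u) (h : R x ∈ hyperZero Λ u) (_ : NCRel q Λ u x (R x)),
          e.symm (Quotient.mk _ x) = Quotient.mk _ ⟨R x, h⟩ := by
        intro x h h'
        rw [Equiv.symm_apply_eq]
        exact Quotient.sound h'
      obtain ⟨h1, h2⟩ := hR.self_of_nhds.2 v.2
      change Tendsto _ _ (𝓝 (e.symm (Quotient.mk _ v)))
      rw [hinv v h1 h2, tendsto_nhds]
      intro U hU hmem
      obtain ⟨W, hW, hWU⟩ := isOpen_induced_iff.1 (hU.preimage continuous_quotient_mk')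
      have hRW : R v ∈ W := by
        have : (⟨R v, h1⟩ : hyperZero Λ u) ∈ Subtype.val ⁻¹' W := by rw [hWU]; exact hmem
        exact this
      have hev : ∀ᶠ v' in 𝓝 (v : LTwo 𝕃), R v' ∈ W :=
        hR.self_of_nhds.1.continuousAt.eventually (hW.mem_nhds hRW)
      have hsub : Tendsto (Subtype.val : complexZero q Λ u → LTwo 𝕃) (𝓝 v) (𝓝 v) :=
        continuous_subtype_val.continuousAt
      filter_upwards [hsub.eventually hR, hsub.eventually hev] with x hx1 hx2
      obtain ⟨h3, h4⟩ := hx1.2 x.2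
      change e.symm (Quotient.mk _ x) ∈ U
      rw [hinv x h3 h4]
      have : (⟨R x, h3⟩ : hyperZero Λ u) ∈ Subtype.val ⁻¹' W := hx2
      rwa [hWU] at this }

/-- A function which is smooth on the hyperkähler quotient pulls back to the complex zero locus
through the local smooth retractions. -/
theorem isDiffeo_quotientHomeo (hspan : Submodule.span ℝ (Set.range (realVec u)) = ⊤)
    (hconv : Summable fun k => (1 + ‖lam Λ k‖)⁻¹) (hβ : BetaContinuous Λ u)
    (hflat : FlatsGeneric q Λ u) (hcom : Commensurable q Λ) :
    IsDiffeo (quotientHomeo hspan hconv hβ hflat hcom) := by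
  intro U hU f
  constructor
  · intro h x hx
    obtain ⟨W, hW, hxW, F, hF, hfF⟩ :=
      h ⟨x, hyperZero_subset_complexZero q Λ u x.2⟩ hx
    exact ⟨W, hW, hxW, F, hF, fun y hy hyU =>
      hfF ⟨y, hyperZero_subset_complexZero q Λ u y.2⟩ hy hyU⟩
  · intro h x hx
    obtain ⟨R, hR⟩ := exists_smooth_retraction hspan hconv hβ hflat hcom x.2
    obtain ⟨O, hOR, hO, hxO⟩ := mem_nhds_iff.1 hR
    have hmk : ∀ (y : complexZero q Λ u) (hy : (y : LTwo 𝕃) ∈ O),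
        quotientMap q Λ u (Quotient.mk _ ⟨R y, ((hOR hy).2 y.2).1⟩) = Quotient.mk _ y :=
      fun y hy => Quotient.sound ((NCRel.equivalence q Λ u).symm ((hOR hy).2 y.2).2)
    have hmem : ∀ (y : complexZero q Λ u) (hy : (y : LTwo 𝕃) ∈ O), Quotient.mk _ y ∈ U →
        quotientMap q Λ u (Quotient.mk _ ⟨R y, ((hOR hy).2 y.2).1⟩) ∈ U := by
      intro y hy hyU
      rwa [hmk y hy]
    obtain ⟨W, hW, hxW, F, hF, hfF⟩ := h ⟨R x, ((hOR hxO).2 x.2).1⟩ (hmem x hxO hx)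
    have hRO : ContDiffOn ℝ ∞ R O := fun v hv => (hOR hv).1.contDiffWithinAt
    refine ⟨O ∩ R ⁻¹' W, hRO.continuousOn.isOpen_inter_preimage hO hW, ⟨hxO, hxW⟩, F ∘ R,
      hF.comp (hRO.mono Set.inter_subset_left) (fun v hv => hv.2), fun y hy hyU => ?_⟩
    have h1 := hfF ⟨R y, ((hOR hy.1).2 y.2).1⟩ hy.2 (hmem y hy.1 hyU)
    rw [← hmk y hy.1]
    exact h1

end

section

/-! ### Diffeomorphisms of quotients -/

section Quotients

variable {V V' V'' : Type*} [NormedAddCommGroup V] [NormedSpace ℝ V] [NormedAddCommGroup V']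
  [NormedSpace ℝ V'] [NormedAddCommGroup V''] [NormedSpace ℝ V''] {S : Set V} {S' : Set V'}
  {S'' : Set V''} {s : Setoid S} {s' : Setoid S'} {s'' : Setoid S''}

theorem IsDiffeo.trans {φ : Quotient s ≃ₜ Quotient s'} {ψ : Quotient s' ≃ₜ Quotient s''}
    (hφ : IsDiffeo φ) (hψ : IsDiffeo ψ) : IsDiffeo (φ.trans ψ) := by
  intro U hU f
  exact (hψ U hU f).trans (hφ (ψ ⁻¹' U) (hU.preimage ψ.continuous) (f ∘ ψ))

theorem QuotSmoothOn.comp_smooth {ψ : V → V'} (hψ : ContDiff ℝ ∞ ψ) (hS : ∀ v ∈ S, ψ v ∈ S')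
    {φ : Quotient s → Quotient s'}
    (hφ : ∀ v : S, φ (Quotient.mk s v) = Quotient.mk s' ⟨ψ v, hS v v.2⟩)
    {f : Quotient s' → ℝ} {U : Set (Quotient s')} (h : QuotSmoothOn s' f U) :
    QuotSmoothOn s (f ∘ φ) (φ ⁻¹' U) := by
  intro x hx
  rw [Set.mem_preimage, hφ] at hx
  obtain ⟨W, hW, hxW, F, hF, hfF⟩ := h _ hx
  refine ⟨ψ ⁻¹' W, hW.preimage hψ.continuous, hxW, F ∘ ψ,
    hF.comp hψ.contDiffOn (fun v hv => hv), fun y hy hyU => ?_⟩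
  rw [Set.mem_preimage, hφ] at hyU
  rw [Function.comp_apply, hφ]
  exact hfF ⟨ψ y, hS y y.2⟩ hy hyU

/-- Mutually inverse smooth maps which preserve the equivalence relations induce a diffeomorphism
of the quotients. -/
theorem exists_isDiffeo_of_smooth_maps {ψ : V → V'} {ψ' : V' → V} (hψ : ContDiff ℝ ∞ ψ)
    (hψ' : ContDiff ℝ ∞ ψ') (hS : ∀ v ∈ S, ψ v ∈ S') (hS' : ∀ v ∈ S', ψ' v ∈ S)
    (hrel : ∀ v w : S, s v w → s' ⟨ψ v, hS v v.2⟩ ⟨ψ w, hS w w.2⟩)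
    (hrel' : ∀ v w : S', s' v w → s ⟨ψ' v, hS' v v.2⟩ ⟨ψ' w, hS' w w.2⟩)
    (hinv : ∀ v, ψ' (ψ v) = v) (hinv' : ∀ v, ψ (ψ' v) = v) :
    ∃ φ : Quotient s ≃ₜ Quotient s', IsDiffeo φ := by
  let φ : Quotient s ≃ₜ Quotient s' :=
    { toFun := Quotient.map (fun v => ⟨ψ v, hS v v.2⟩) fun v w h => hrel v w h
      invFun := Quotient.map (fun v => ⟨ψ' v, hS' v v.2⟩) fun v w h => hrel' v w h
      left_inv := by
        intro a
        induction a using Quotient.inductionOn with | _ v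
        exact congrArg _ (Subtype.ext (hinv v))
      right_inv := by
        intro a
        induction a using Quotient.inductionOn with | _ v
        exact congrArg _ (Subtype.ext (hinv' v))
      continuous_toFun := Continuous.quotient_map'
        (Continuous.subtype_mk (hψ.continuous.comp continuous_subtype_val) _) _
      continuous_invFun := Continuous.quotient_map'
        (Continuous.subtype_mk (hψ'.continuous.comp continuous_subtype_val) _) _ }
  refine ⟨φ, fun U hU f => ⟨fun h => h.comp_smooth hψ hS fun _ => rfl, fun h => ?_⟩⟩
  have h1 := h.comp_smooth (φ := φ.symm) hψ' hS' fun _ => rfl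
  have e1 : (f ∘ φ) ∘ φ.symm = f := by ext x; simp
  have e2 : φ.symm ⁻¹' (φ ⁻¹' U) = U := by ext x; simp
  rwa [e1, e2] at h1

end Quotients

/-! ### Dependence on the weights -/

variable {𝕃 : Type*} {n : ℕ} {u : 𝕃 → Fin n → ℤ} {Λ Λ' : 𝕃 → ℍ[ℝ]} {q : ComplexStructure}

theorem norm_sqrt_weight_mul_seq_le {C : ℝ} (hC : ∀ k, weight Λ' k ≤ C * weight Λ k)
    (t : TLie Λ) (k : 𝕃) :
    ‖Real.sqrt (weight Λ' k) * t.seq k‖ ≤ Real.sqrt C * ‖toLTwo Λ t k‖ := by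
  have hC0 : 0 ≤ C := by
    by_contra! h
    have h1 := hC k
    nlinarith [weight_pos Λ k, weight_pos Λ' k]
  rw [norm_toLTwo_apply, norm_mul, Real.norm_eq_abs, Real.norm_eq_abs,
    abs_of_nonneg (Real.sqrt_nonneg _), ← mul_assoc, ← Real.sqrt_mul hC0]
  gcongr
  exact hC k

theorem TLie.seq_mem_lieSubmodule {C : ℝ} (hC : ∀ k, weight Λ' k ≤ C * weight Λ k) (t : TLie Λ) :
    t.seq ∈ lieSubmodule Λ' := by
  have h : Memℓp (fun k => Real.sqrt (weight Λ' k) * t.seq k) 2 :=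
    memℓp_two_of_norm_le (toLTwo Λ t) (norm_sqrt_weight_mul_seq_le hC t)
  exact h

theorem TLie.seq_mk (f : 𝕃 → ℝ) (hf : f ∈ lieSubmodule Λ) : TLie.seq (Λ := Λ) ⟨f, hf⟩ = f := rfl

/-- An element of the Lie algebra `𝔱_λ`, as an element of `𝔱_λ'`, where the weight of `λ'` is
bounded by a multiple of that of `λ`. -/
def TLie.transfer {C : ℝ} (hC : ∀ k, weight Λ' k ≤ C * weight Λ k) (t : TLie Λ) : TLie Λ' :=
  ⟨t.seq, t.seq_mem_lieSubmodule hC⟩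

@[simp] theorem TLie.transfer_seq {C : ℝ} (hC : ∀ k, weight Λ' k ≤ C * weight Λ k) (t : TLie Λ)
    (k : 𝕃) : (t.transfer hC).seq k = t.seq k :=
  -- a bare `rfl` would make the kernel compare the definitions of the two weights
  congrFun (TLie.seq_mk t.seq (t.seq_mem_lieSubmodule hC)) k

theorem TLie.norm_transfer_le {C : ℝ} (hC : ∀ k, weight Λ' k ≤ C * weight Λ k) (t : TLie Λ) :
    ‖t.transfer hC‖ ≤ Real.sqrt C * ‖t‖ := by
  have h : ∀ k, ‖toLTwo Λ' (t.transfer hC) k‖ ≤ Real.sqrt C * ‖toLTwo Λ t k‖ := by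
    intro k
    rw [toLTwo_apply, TLie.transfer_seq]
    exact norm_sqrt_weight_mul_seq_le hC t k
  have h' := lp_norm_le_of_norm_le _ _ (Real.sqrt_nonneg C) h
  rwa [← TLie.norm_eq, ← TLie.norm_eq] at h'

theorem TLie.transfer_add {C : ℝ} (hC : ∀ k, weight Λ' k ≤ C * weight Λ k) (s t : TLie Λ) :
    (s + t).transfer hC = s.transfer hC + t.transfer hC :=
  TLie.ext fun k => (TLie.transfer_seq hC (s + t) k).trans <| (TLie.seq_add s t k).trans <|
    (congrArg₂ (· + ·) (TLie.transfer_seq hC s k) (TLie.transfer_seq hC t k)).symm.trans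
      (TLie.seq_add _ _ k).symm

theorem TLie.transfer_smul {C : ℝ} (hC : ∀ k, weight Λ' k ≤ C * weight Λ k) (c : ℝ) (t : TLie Λ) :
    (c • t).transfer hC = c • t.transfer hC :=
  TLie.ext fun k => (TLie.transfer_seq hC (c • t) k).trans <| (TLie.seq_smul c t k).trans <|
    (congrArg (c * ·) (TLie.transfer_seq hC t k)).symm.trans (TLie.seq_smul c _ k).symm

/-- For comparable weights the inclusion of the Lie algebras is continuous. -/
theorem exists_transferL {C : ℝ} (hC : ∀ k, weight Λ' k ≤ C * weight Λ k) :
    ∃ T : TLie Λ →L[ℝ] TLie Λ', ∀ t, T t = t.transfer hC := by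
  have h : IsLinearMap ℝ (TLie.transfer hC) := ⟨TLie.transfer_add hC, TLie.transfer_smul hC⟩
  exact ⟨h.mk'.mkContinuous (Real.sqrt C) (TLie.norm_transfer_le hC), fun _ => rfl⟩

theorem basisVec_seq [DecidableEq 𝕃] (k : 𝕃) : (basisVec Λ k).seq = Pi.single k 1 := rfl

theorem TLie.transfer_basisVec [DecidableEq 𝕃] {C : ℝ} (hC : ∀ k, weight Λ' k ≤ C * weight Λ k)
    (k : 𝕃) : (basisVec Λ k).transfer hC = basisVec Λ' k :=
  TLie.ext fun l => (TLie.transfer_seq hC _ l).trans <|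
    (congrFun (basisVec_seq k) l).trans (congrFun (basisVec_seq k) l).symm

theorem BetaContinuous.transfer {C : ℝ} (hC : ∀ k, weight Λ k ≤ C * weight Λ' k)
    (hβ : BetaContinuous Λ u) : BetaContinuous Λ' u := by
  classical
  obtain ⟨β, hβ⟩ := hβ
  obtain ⟨T, hT⟩ := exists_transferL hC
  refine ⟨β.comp T, fun k => ?_⟩
  rw [← hβ k, ContinuousLinearMap.comp_apply, hT]
  exact congrArg β (TLie.transfer_basisVec hC k)

theorem groupNC_le_of_weight_le {C : ℝ} (hC : ∀ k, weight Λ' k ≤ C * weight Λ k) :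
    groupNC Λ u ≤ groupNC Λ' u := by
  rintro g ⟨hg, θ, s, hθ, m, hm, hs⟩
  refine ⟨?_, θ.transfer hC, s.transfer hC, fun k => ?_, m, ?_, ?_⟩
  rotate_left
  · simpa only [TLie.transfer_seq] using hθ k
  · simpa only [TLie.transfer_seq] using hm
  · simpa only [TLie.transfer_seq] using hs
  have hg' : Summable fun k => weight Λ k * ‖1 - (g k : ℂ)‖ ^ 2 := hg
  change Summable fun k => weight Λ' k * ‖1 - (g k : ℂ)‖ ^ 2
  refine Summable.of_nonneg_of_le
    (fun k => mul_nonneg (weight_pos Λ' k).le (sq_nonneg _)) (fun k => ?_) (hg'.mul_left C)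
  rw [← mul_assoc]
  exact mul_le_mul_of_nonneg_right (hC k) (sq_nonneg _)

theorem mem_complexZero_transfer {C : ℝ} (hC : ∀ k, weight Λ k ≤ C * weight Λ' k)
    {v v' : LTwo 𝕃}
    (h : ∀ k, transverse q (momentCoeff Λ' v' k) = transverse q (momentCoeff Λ v k))
    (hv : v ∈ complexZero q Λ u) : v' ∈ complexZero q Λ' u := by
  intro η
  have hη : (η : TLie Λ').transfer hC ∈ nLie Λ u := by
    have h0 : HasSum (fun k => (η : TLie Λ').seq k • realVec u k) 0 := η.2
    change HasSum (fun k => ((η : TLie Λ').transfer hC).seq k • realVec u k) 0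
    simpa only [TLie.transfer_seq] using h0
  rw [← hv ⟨_, hη⟩]
  refine (hasSum_transverse_nMoment v' η).unique
    ((hasSum_transverse_nMoment v ⟨_, hη⟩).congr_fun fun k => ?_)
  rw [h, TLie.transfer_seq]

/-! ### Transport along a bounded gauge transformation -/

/-- The action of a bounded sequence in `ℂ*` with bounded inverse on `L²(ℍ)`. -/
def complexActL (q : ComplexStructure) (c : 𝕃 → ℂˣ) (M : ℝ)
    (hM : ∀ k, ‖(c k : ℂ)‖ + ‖(c k : ℂ)‖⁻¹ ≤ M) : LTwo 𝕃 →L[ℝ] LTwo 𝕃 :=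
  have hb : ∀ (v : LTwo 𝕃) (k : 𝕃), ‖complexAct q (c k) (v k)‖ ≤ |M| * ‖v k‖ := fun v k =>
    (norm_complexAct_le q _ _).trans
      (mul_le_mul_of_nonneg_right ((hM k).trans (le_abs_self M)) (norm_nonneg _))
  LinearMap.mkContinuous
    { toFun := fun v => ⟨fun k => complexAct q (c k) (v k), memℓp_two_of_norm_le v (hb v)⟩
      map_add' := fun v w => by
        ext k : 2
        exact complexAct_add q (c k) (v k) (w k)
      map_smul' := fun r v => by
        ext k : 2
        change complexAct q (c k) (r • v k) = r • complexAct q (c k) (v k)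
        simp only [complexAct, zPart_smul, wPart_smul, mul_smul_comm, smul_add] }
    |M| (fun v => lp_norm_le_of_norm_le _ v (abs_nonneg M) (hb v))

/-- If `Λ'` agrees with the transform of `Λ` by a bounded gauge transformation up to finitely many
terms, this gauge transformation induces a smooth map from `M_Λ` to `M_Λ'`. -/
theorem exists_smooth_transport {c : 𝕃 → ℂˣ} {M : ℝ}
    (hM : ∀ k, ‖(c k : ℂ)‖ + ‖(c k : ℂ)‖⁻¹ ≤ M)
    (hc : ∀ᶠ k in cofinite, complexAct q (c k) (Λ k) = Λ' k) :
    ∃ ψ : LTwo 𝕃 → LTwo 𝕃, ContDiff ℝ ∞ ψ ∧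
      ∀ v k, point Λ' (ψ v) k = complexAct q (c k) (point Λ v k) := by
  have hfin : Memℓp (fun k => complexAct q (c k) (Λ k) - Λ' k) 2 := by
    rw [mem_ltwo_iff]
    refine summable_of_hasFiniteSupport (Set.Finite.subset hc fun k hk h => hk ?_)
    have h' : complexAct q (c k) (Λ k) = Λ' k := h
    change ‖complexAct q (c k) (Λ k) - Λ' k‖ ^ 2 = 0
    rw [h', sub_self, norm_zero, zero_pow two_ne_zero]
  have hd : ContDiff ℝ ∞ (complexActL q c M hM) := ContinuousLinearMap.contDiff _
  let d : LTwo 𝕃 := ⟨fun k => complexAct q (c k) (Λ k) - Λ' k, hfin⟩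
  refine ⟨fun v => complexActL q c M hM v + d, hd.add contDiff_const, fun v k => ?_⟩
  change Λ' k + (complexAct q (c k) (v k) + (complexAct q (c k) (Λ k) - Λ' k)) = _
  rw [point, complexAct_add]
  abel

theorem lTwo_ext_of_point {v w : LTwo 𝕃} (h : ∀ k, point Λ v k = point Λ w k) : v = w := by
  apply lp.ext
  funext k
  exact add_left_cancel (h k)

/-- Parameters with the same complex part and comparable weights which are related by a bounded
gauge transformation, up to finitely many terms, have diffeomorphic complex quotients. -/
theorem exists_isDiffeo_complexQuotient {C C' : ℝ} (hC : ∀ k, weight Λ' k ≤ C * weight Λ k)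
    (hC' : ∀ k, weight Λ k ≤ C' * weight Λ' k)
    (hlam : ∀ k, transverse q (lam Λ' k) = transverse q (lam Λ k)) {c : 𝕃 → ℂˣ} {M : ℝ}
    (hM : ∀ k, ‖(c k : ℂ)‖ + ‖(c k : ℂ)‖⁻¹ ≤ M)
    (hc : ∀ᶠ k in cofinite, complexAct q (c k) (Λ k) = Λ' k) :
    ∃ φ : ComplexQuotient q Λ u ≃ₜ ComplexQuotient q Λ' u, IsDiffeo φ := by
  have hM' : ∀ k, ‖((c⁻¹) k : ℂ)‖ + ‖((c⁻¹) k : ℂ)‖⁻¹ ≤ M := by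
    intro k
    rw [Pi.inv_apply, Units.val_inv_eq_inv_val, norm_inv, inv_inv, add_comm]
    exact hM k
  have hc' : ∀ᶠ k in cofinite, complexAct q ((c⁻¹) k) (Λ' k) = Λ k := by
    filter_upwards [hc] with k hk
    rw [← hk, ← complexAct_mul, Pi.inv_apply, inv_mul_cancel, complexAct_one]
  obtain ⟨ψ, hψ, hψp⟩ := exists_smooth_transport hM hc
  obtain ⟨ψ', hψ', hψp'⟩ := exists_smooth_transport hM' hc'
  have hrel : ∀ v w, NCRel q Λ u v w → NCRel q Λ' u (ψ v) (ψ w) := by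
    rintro v w ⟨g, hg, h⟩
    refine ⟨g, groupNC_le_of_weight_le hC hg, fun k => ?_⟩
    rw [hψp, hψp, h, ← complexAct_mul, ← complexAct_mul, mul_comm]
  have hrel' : ∀ v w, NCRel q Λ' u v w → NCRel q Λ u (ψ' v) (ψ' w) := by
    rintro v w ⟨g, hg, h⟩
    refine ⟨g, groupNC_le_of_weight_le hC' hg, fun k => ?_⟩
    rw [hψp', hψp', h, ← complexAct_mul, ← complexAct_mul, mul_comm]
  refine exists_isDiffeo_of_smooth_maps hψ hψ' (fun v hv => ?_) (fun v hv => ?_)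
    (fun v w h => hrel v w h) (fun v w h => hrel' v w h) (fun v => ?_) (fun v => ?_)
  · refine mem_complexZero_transfer hC' (fun k => ?_) hv
    rw [transverse_momentCoeff, transverse_momentCoeff, hψp, star_wPart_mul_zPart_complexAct, hlam]
  · refine mem_complexZero_transfer hC (fun k => ?_) hv
    rw [transverse_momentCoeff, transverse_momentCoeff, hψp', star_wPart_mul_zPart_complexAct,
      hlam]
  · refine lTwo_ext_of_point (Λ := Λ) fun k => ?_
    rw [hψp', hψp, ← complexAct_mul, Pi.inv_apply, inv_mul_cancel, complexAct_one]
  · refine lTwo_ext_of_point (Λ := Λ') fun k => ?_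
    rw [hψp, hψp', ← complexAct_mul, Pi.inv_apply, mul_inv_cancel, complexAct_one]

/-! ### Replacing the real part of the parameters by zero -/

theorem norm_transverse_le (p : ℍ[ℝ]) : ‖transverse q p‖ ≤ ‖p‖ := by
  have h1 : p = transverse q p + inner ℝ (q : ℍ[ℝ]) p • (q : ℍ[ℝ]) := by rw [transverse]; abel
  have h2 : ‖p‖ ^ 2 = ‖transverse q p‖ ^ 2 + ‖inner ℝ (q : ℍ[ℝ]) p • (q : ℍ[ℝ])‖ ^ 2 := by
    conv_lhs => rw [h1]
    rw [norm_add_sq_real, inner_smul_right, real_inner_comm (q : ℍ[ℝ]) (transverse q p),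
      inner_transverse]
    ring
  have h3 := sq_nonneg ‖inner ℝ (q : ℍ[ℝ]) p • (q : ℍ[ℝ])‖
  exact (sq_le_sq₀ (norm_nonneg _) (norm_nonneg _)).1 (by linarith)

theorem norm_transverse_lam (k : 𝕃) :
    ‖transverse q (lam Λ k)‖ = ‖zPart q (Λ k)‖ * ‖wPart q (Λ k)‖ := by
  rw [transverse_lam, norm_neg, norm_mul, norm_mul, norm_star, norm_complexStructure]
  ring

theorem weight_le_of_lam_eq_transverse (hlam : ∀ k, lam Λ' k = transverse q (lam Λ k))
    (k : 𝕃) : weight Λ' k ≤ 1 * weight Λ k := by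
  rw [one_mul, weight, weight, hlam]
  linarith [norm_transverse_le (q := q) (lam Λ k)]

/-- Commensurability bounds `|Λ_k|² = |z_k|² + |w_k|²` by a multiple of `|z_k| |w_k| = |λ_k^ℂ|`. -/
theorem exists_weight_le_of_lam_eq_transverse (hlam : ∀ k, lam Λ' k = transverse q (lam Λ k))
    (hcom : Commensurable q Λ) :
    ∃ C, ∀ k, weight Λ k ≤ C * weight Λ' k := by
  obtain ⟨C₁, C₂, h1, h2, hC⟩ := hcom
  obtain ⟨d, hd, hle⟩ := exists_pos_le_of_eventually_cofinite (s := Set.univ)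
    (f := fun k => weight Λ' k / weight Λ k) (c := (1 + C₁⁻¹ + C₂)⁻¹)
    (fun k _ => div_pos (weight_pos Λ' k) (weight_pos Λ k)) (by positivity) (by
      filter_upwards [hC] with k ⟨hk1, hk2⟩
      rw [le_div_iff₀ (weight_pos Λ k), inv_mul_le_iff₀ (by positivity)]
      have h3 := norm_sq_zPart_add_norm_sq_wPart_eq_weight (q := q) (Λ := Λ) k
      have h4 : weight Λ' k = 1 + ‖zPart q (Λ k)‖ * ‖wPart q (Λ k)‖ := by
        rw [weight, hlam, norm_transverse_lam]
      have hz := norm_nonneg (zPart q (Λ k))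
      have hw := norm_nonneg (wPart q (Λ k))
      have h5 : ‖zPart q (Λ k)‖ ^ 2 ≤ C₂ * (‖zPart q (Λ k)‖ * ‖wPart q (Λ k)‖) := by nlinarith
      have h6 : ‖wPart q (Λ k)‖ ^ 2 ≤ C₁⁻¹ * (‖zPart q (Λ k)‖ * ‖wPart q (Λ k)‖) := by
        rw [← div_eq_inv_mul, le_div_iff₀ h1]; nlinarith
      have h7 : 0 ≤ C₁⁻¹ := by positivity
      rw [h4]
      nlinarith [mul_nonneg hz hw])
  refine ⟨d⁻¹, fun k => ?_⟩
  have := hle k (Set.mem_univ k)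
  rw [le_div_iff₀ (weight_pos Λ k)] at this
  rwa [le_inv_mul_iff₀ hd]

theorem norm_zPart_eq_norm_wPart_of_lam_eq_transverse
    (hlam : ∀ k, lam Λ' k = transverse q (lam Λ k)) (k : 𝕃) :
    ‖zPart q (Λ' k)‖ = ‖wPart q (Λ' k)‖ := by
  have h := inner_lam q Λ' k
  rw [hlam, inner_transverse] at h
  exact (sq_eq_sq₀ (norm_nonneg _) (norm_nonneg _)).1 (by linarith)

theorem commensurable_of_lam_eq_transverse (hlam : ∀ k, lam Λ' k = transverse q (lam Λ k)) :
    Commensurable q Λ' :=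
  ⟨1, 1, one_pos, one_pos, Eventually.of_forall fun k => by
    rw [norm_zPart_eq_norm_wPart_of_lam_eq_transverse hlam k]; simp⟩

theorem flatsGeneric_of_lam_eq_transverse (hlam : ∀ k, lam Λ' k = transverse q (lam Λ k))
    (hflat : FlatsGeneric q Λ u) :
    FlatsGeneric q Λ' u := by
  intro J hJ
  rw [← hflat J hJ]
  refine Set.iInter₂_congr fun k _ => ?_
  simp only [complexFlat, hlam, transverse_transverse]

theorem summable_of_lam_eq_transverse (hlam : ∀ k, lam Λ' k = transverse q (lam Λ k))
    (hcom : Commensurable q Λ)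
    (hconv : Summable fun k => (1 + ‖lam Λ k‖)⁻¹) : Summable fun k => (1 + ‖lam Λ' k‖)⁻¹ := by
  obtain ⟨C, hC⟩ := exists_weight_le_of_lam_eq_transverse hlam hcom
  refine Summable.of_nonneg_of_le (fun k => by positivity) (fun k => ?_) (hconv.mul_left C)
  change (weight Λ' k)⁻¹ ≤ C * (weight Λ k)⁻¹
  rw [← div_eq_mul_inv, le_div_iff₀ (weight_pos Λ k), inv_mul_le_iff₀ (weight_pos Λ' k), mul_comm]
  exact hC k

/-- Off a finite set, `Λ'` is the transform of `Λ` by the gauge transformation with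
`|c_k|² = |w_k| / |z_k|`, which is bounded by commensurability. -/
theorem exists_gauge_of_lam_eq_transverse (hlam : ∀ k, lam Λ' k = transverse q (lam Λ k))
    (hcom : Commensurable q Λ)
    (hconv : Summable fun k => (1 + ‖lam Λ k‖)⁻¹) :
    ∃ (c : 𝕃 → ℂˣ) (M : ℝ), (∀ k, ‖(c k : ℂ)‖ + ‖(c k : ℂ)‖⁻¹ ≤ M) ∧
      ∀ᶠ k in cofinite, complexAct q (c k) (Λ k) = Λ' k := by
  obtain ⟨C₁, C₂, h1, h2, hC⟩ := hcom
  have hex : ∀ k, ∃ c : ℂˣ, ‖(c : ℂ)‖ + ‖(c : ℂ)‖⁻¹ ≤ 2 + C₁⁻¹ + C₂ ∧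
      ((C₁ * ‖wPart q (Λ k)‖ ≤ ‖zPart q (Λ k)‖ ∧ ‖zPart q (Λ k)‖ ≤ C₂ * ‖wPart q (Λ k)‖) →
        2 ≤ weight Λ k → complexAct q c (Λ k) = Λ' k) := by
    intro k
    by_cases hk : (C₁ * ‖wPart q (Λ k)‖ ≤ ‖zPart q (Λ k)‖ ∧
      ‖zPart q (Λ k)‖ ≤ C₂ * ‖wPart q (Λ k)‖) ∧ 2 ≤ weight Λ k
    swap
    -- at the finitely many exceptional indices any value will do
    · refine ⟨1, ?_, fun h3 h4 => absurd ⟨h3, h4⟩ hk⟩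
      have : 0 < C₁⁻¹ := by positivity
      simp
      linarith
    obtain ⟨⟨hk1, hk2⟩, hw2⟩ := hk
    have h3 := norm_sq_zPart_add_norm_sq_wPart_eq_weight (q := q) (Λ := Λ) k
    have hw : 0 < ‖wPart q (Λ k)‖ := by
      rcases (norm_nonneg (wPart q (Λ k))).eq_or_lt with h | h
      · rw [← h, mul_zero] at hk2
        have h4 : ‖zPart q (Λ k)‖ = 0 := le_antisymm hk2 (norm_nonneg _)
        rw [h4, ← h] at h3
        linarith
      · exact h
    have hz : 0 < ‖zPart q (Λ k)‖ := (mul_pos h1 hw).trans_le hk1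
    have hprod : ‖zPart q (Λ' k)‖ * ‖wPart q (Λ' k)‖ = ‖zPart q (Λ k)‖ * ‖wPart q (Λ k)‖ := by
      rw [← norm_transverse_lam, ← norm_transverse_lam, hlam, transverse_transverse]
    have heq := norm_zPart_eq_norm_wPart_of_lam_eq_transverse hlam k
    have hz' : 0 < ‖zPart q (Λ' k)‖ := by
      rcases (norm_nonneg (zPart q (Λ' k))).eq_or_lt with h | h
      · rw [← h, zero_mul] at hprod
        exact absurd hprod.symm (mul_pos hz hw).ne'
      · exact h
    have hq : (q : ℍ[ℝ]) ≠ 0 := by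
      intro h
      have := norm_complexStructure q
      rw [h, norm_zero] at this
      exact zero_ne_one this
    obtain ⟨c, hc, hcn⟩ := exists_complexAct_eq q (x := Λ k) (x' := Λ' k) (norm_pos_iff.1 hz)
      (norm_pos_iff.1 hz') (by
        have h4 := transverse_lam q Λ' k
        rw [hlam, transverse_transverse, transverse_lam, neg_inj] at h4
        exact (mul_right_cancel₀ hq h4).symm)
    refine ⟨c, ?_, fun _ _ => hc⟩
    have hc0 : 0 < ‖(c : ℂ)‖ := norm_pos_iff.2 c.ne_zero
    -- the `z`- and `w`-parts of `Λ'_k` have equal norms, with the same product as those of `Λ_k`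
    have hsq : ‖(c : ℂ)‖ ^ 2 * ‖zPart q (Λ k)‖ = ‖wPart q (Λ k)‖ := by
      have h5 : (‖(c : ℂ)‖ * ‖zPart q (Λ k)‖) * (‖(c : ℂ)‖ * ‖zPart q (Λ k)‖) =
          ‖zPart q (Λ k)‖ * ‖wPart q (Λ k)‖ := by
        rw [hcn, ← hprod, ← heq]
      apply mul_left_cancel₀ hz.ne'
      rw [← h5]; ring
    have h6 : ‖(c : ℂ)‖ ^ 2 ≤ C₁⁻¹ := by
      rw [← one_div, le_div_iff₀ h1]
      refine le_of_mul_le_mul_right ?_ hw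
      calc ‖(c : ℂ)‖ ^ 2 * C₁ * ‖wPart q (Λ k)‖ = ‖(c : ℂ)‖ ^ 2 * (C₁ * ‖wPart q (Λ k)‖) := by
            ring
        _ ≤ ‖(c : ℂ)‖ ^ 2 * ‖zPart q (Λ k)‖ := by gcongr
        _ = 1 * ‖wPart q (Λ k)‖ := by rw [hsq, one_mul]
    have h7 : (‖(c : ℂ)‖⁻¹) ^ 2 ≤ C₂ := by
      rw [inv_pow, inv_le_iff_one_le_mul₀ (by positivity)]
      refine le_of_mul_le_mul_right ?_ hz
      calc 1 * ‖zPart q (Λ k)‖ ≤ C₂ * ‖wPart q (Λ k)‖ := by rwa [one_mul]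
        _ = C₂ * ‖(c : ℂ)‖ ^ 2 * ‖zPart q (Λ k)‖ := by rw [← hsq]; ring
    nlinarith [sq_nonneg (‖(c : ℂ)‖ - 1), sq_nonneg (‖(c : ℂ)‖⁻¹ - 1)]
  choose c hM hc using hex
  refine ⟨c, _, hM, ?_⟩
  filter_upwards [hC, eventually_le_weight hconv 2] with k hk1 hk2
  exact hc k hk1 hk2

/-- The component of the parameters along `q` may be replaced by zero: the complex quotients are
transported to each other by a gauge transformation, and each is diffeomorphic to the hyperkähler
quotient. -/
theorem diffeomorphic_of_lam_eq_transverse (hlam : ∀ k, lam Λ' k = transverse q (lam Λ k))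
    (hspan : Submodule.span ℝ (Set.range (realVec u)) = ⊤)
    (hconv : Summable fun k => (1 + ‖lam Λ k‖)⁻¹) (hβ : BetaContinuous Λ u)
    (hflat : FlatsGeneric q Λ u) (hcom : Commensurable q Λ) : Diffeomorphic Λ Λ' u := by
  obtain ⟨C, hC⟩ := exists_weight_le_of_lam_eq_transverse hlam hcom
  obtain ⟨c, M, hM, hc⟩ := exists_gauge_of_lam_eq_transverse hlam hcom hconv
  obtain ⟨φ, hφ⟩ := exists_isDiffeo_complexQuotient (u := u)
    (weight_le_of_lam_eq_transverse hlam) hC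
    (fun k => by rw [hlam, transverse_transverse]) hM hc
  have h1 := isDiffeo_quotientHomeo hspan hconv hβ hflat hcom
  have h2 := isDiffeo_quotientHomeo hspan (summable_of_lam_eq_transverse hlam hcom hconv)
    (hβ.transfer hC) (flatsGeneric_of_lam_eq_transverse hlam hflat)
    (commensurable_of_lam_eq_transverse hlam)
  exact ⟨_, (h1.trans hφ).trans h2.symm⟩

theorem Diffeomorphic.trans {Λ'' : 𝕃 → ℍ[ℝ]} (h : Diffeomorphic Λ Λ' u)
    (h' : Diffeomorphic Λ' Λ'' u) : Diffeomorphic Λ Λ'' u := by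
  obtain ⟨φ, hφ⟩ := h
  obtain ⟨ψ, hψ⟩ := h'
  exact ⟨_, hφ.trans hψ⟩

/-! ### The coordinate complex structures -/

theorem transverse_structK {p : ℍ[ℝ]} (hp : p.re = 0) :
    transverse structK p = ⟨0, p.imI, p.imJ, 0⟩ := by
  have h : inner ℝ (structK : ℍ[ℝ]) p = p.imK := by
    rw [Quaternion.inner_def]; simp [structK]
  rw [transverse, h]
  ext <;> simp [structK, hp]

theorem transverse_structJ {p : ℍ[ℝ]} (hp : p.re = 0) :
    transverse structJ p = ⟨0, p.imI, 0, p.imK⟩ := by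
  have h : inner ℝ (structJ : ℍ[ℝ]) p = p.imJ := by
    rw [Quaternion.inner_def]; simp [structJ]
  rw [transverse, h]
  ext <;> simp [structJ, hp]

end

end Hypertoric

end

theorem mainTheorem2 {𝕃 : Type*} [Countable 𝕃] {n : ℕ} (u : 𝕃 → Fin n → ℤ) (Λ : 𝕃 → ℍ[ℝ])
    (hprim : ∀ k, Hypertoric.Primitive (u k))
    (hspan : Submodule.span ℝ (Set.range (Hypertoric.realVec u)) = ⊤)
    (hconv : Summable fun k => (1 + ‖Hypertoric.lam Λ k‖)⁻¹)
    (hβ : Hypertoric.BetaContinuous Λ u) :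
    -- the hyperkähler and the complex quotient, for an arbitrary complex structure
    (∀ q : Hypertoric.ComplexStructure,
      Hypertoric.FlatsGeneric q Λ u → Hypertoric.Commensurable q Λ →
      (∀ v ∈ Hypertoric.complexZero q Λ u,
        -- the real moment map along the orbit is the gradient of a convex functional
        (∃ F : Hypertoric.nLie Λ u → ℝ,
          (∀ y : Hypertoric.nLie Λ u, HasSum (fun k =>
            (1 / 4 : ℝ) *
              (‖Hypertoric.zPart q (Hypertoric.point Λ v k)‖ ^ 2 *
                  Real.exp (2 * (y : Hypertoric.TLie Λ).seq k)
                + ‖Hypertoric.wPart q (Hypertoric.point Λ v k)‖ ^ 2 *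
                  Real.exp (-2 * (y : Hypertoric.TLie Λ).seq k)
                - (‖Hypertoric.zPart q (Hypertoric.point Λ v k)‖ ^ 2
                  + ‖Hypertoric.wPart q (Hypertoric.point Λ v k)‖ ^ 2)
                + 4 * inner ℝ (q : ℍ[ℝ]) (Hypertoric.lam Λ k) *
                  (y : Hypertoric.TLie Λ).seq k)) (F y)) ∧
          ConvexOn ℝ Set.univ F ∧
          ∀ y, HasFDerivAt F (Hypertoric.orbitMoment q Λ u v y) y) ∧
        -- it is monotone
        (∀ y y', 0 ≤ (Hypertoric.orbitMoment q Λ u v y - Hypertoric.orbitMoment q Λ u v y')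
          (y - y')) ∧
        -- it maps bounded sets to bounded sets
        (∀ B : Set (Hypertoric.nLie Λ u), Bornology.IsBounded B →
          Bornology.IsBounded (Hypertoric.orbitMoment q Λ u v '' B)) ∧
        -- it is coercive
        Tendsto (fun y => Hypertoric.orbitMoment q Λ u v y y / ‖y‖)
          (Bornology.cobounded (Hypertoric.nLie Λ u)) atTop ∧
        -- it is surjective
        Function.Surjective (Hypertoric.orbitMoment q Λ u v) ∧
        -- the orbit meets each level set in exactly one `N`-orbit
        (∀ ξ : StrongDual ℝ (Hypertoric.nLie Λ u),
          ∃ v', ∀ v'', (Hypertoric.NCRel q Λ u v v'' ∧ Hypertoric.realMoment q Λ u v'' = ξ) ↔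
            Hypertoric.NRel Λ u v' v'')) ∧
      -- the inclusion of zero loci induces a diffeomorphism of the quotients
      ∃ Φ : Hypertoric.HyperQuotient Λ u ≃ₜ Hypertoric.ComplexQuotient q Λ u,
        (∀ v : Hypertoric.hyperZero Λ u,
          Φ (Quotient.mk (Hypertoric.hyperSetoid Λ u) v) =
            Quotient.mk (Hypertoric.complexSetoid q Λ u)
              ⟨v, Hypertoric.hyperZero_subset_complexZero q Λ u v.2⟩) ∧
        Hypertoric.IsDiffeo Φ) ∧
    -- the component of `λ` along the chosen complex structure may be replaced by zero
    (∀ q : Hypertoric.ComplexStructure,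
      Hypertoric.FlatsGeneric q Λ u → Hypertoric.Commensurable q Λ →
      ∀ Λ' : 𝕃 → ℍ[ℝ],
        (∀ k, Hypertoric.lam Λ' k = Hypertoric.transverse q (Hypertoric.lam Λ k)) →
        Hypertoric.Diffeomorphic Λ Λ' u) ∧
    -- `M(λ¹, λ², λ³) ≅ M(λ¹, λ², 0) ≅ M(λ¹, 0, 0)`
    (∀ Λ' Λ'' : 𝕃 → ℍ[ℝ],
      (∀ k, Hypertoric.lam Λ' k =
        ⟨0, (Hypertoric.lam Λ k).imI, (Hypertoric.lam Λ k).imJ, 0⟩) →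
      (∀ k, Hypertoric.lam Λ'' k = ⟨0, (Hypertoric.lam Λ k).imI, 0, 0⟩) →
      Hypertoric.FlatsGeneric Hypertoric.structK Λ u →
      Hypertoric.Commensurable Hypertoric.structK Λ →
      Hypertoric.Diffeomorphic Λ Λ' u ∧
        (Hypertoric.FlatsGeneric Hypertoric.structJ Λ' u →
          Hypertoric.Commensurable Hypertoric.structJ Λ' →
          Hypertoric.Diffeomorphic Λ' Λ'' u ∧ Hypertoric.Diffeomorphic Λ Λ'' u)) := by
  open Hypertoric in
  refine ⟨fun q hflat hcom => ⟨fun v hv => ?_, quotientHomeo hspan hconv hβ hflat hcom,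
    quotientMap_mk, isDiffeo_quotientHomeo hspan hconv hβ hflat hcom⟩, ?_, ?_⟩
  · have := completeSpace_nLie hβ
    obtain ⟨c, hc, hmono⟩ := exists_stronglyMonotone hspan hconv hβ hflat hcom hv
    have hsurj : Function.Surjective (orbitMoment q Λ u v) :=
      surjective_of_stronglyMonotone ((contDiff_orbitMoment_right v).of_le (by simp)) hc hmono
    refine ⟨⟨energy u q v, hasSum_energy v, convexOn_energy v, hasFDerivAt_energy v⟩,
      fun y y' => (mul_nonneg hc.le (sq_nonneg _)).trans (hmono y y'),
      fun B hB => isBounded_image_orbitMoment v hB,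
      tendsto_div_norm_of_stronglyMonotone hc hmono, hsurj, fun ξ => ?_⟩
    obtain ⟨y, rfl⟩ := hsurj ξ
    refine ⟨expMove q Λ v (y : TLie Λ), fun v'' => ⟨fun h => nRel_expMove_congr hc hmono h.1 h.2,
      fun h => ⟨(NCRel.equivalence q Λ u).trans (ncRel_expMove v y) h.ncRel, h.realMoment_eq⟩⟩⟩
  · exact fun q hflat hcom Λ' hlam =>
      diffeomorphic_of_lam_eq_transverse hlam hspan hconv hβ hflat hcom
  · intro Λ' Λ'' hΛ' hΛ'' hflat hcom
    have hlam : ∀ k, lam Λ' k = transverse structK (lam Λ k) := fun k => by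
      rw [hΛ', transverse_structK (lam_re Λ k)]
    have hlam' : ∀ k, lam Λ'' k = transverse structJ (lam Λ' k) := fun k => by
      rw [hΛ'', transverse_structJ (lam_re Λ' k), hΛ']
    obtain ⟨C, hC⟩ := exists_weight_le_of_lam_eq_transverse hlam hcom
    have h1 := diffeomorphic_of_lam_eq_transverse hlam hspan hconv hβ hflat hcom
    refine ⟨h1, fun hflat' hcom' => ?_⟩
    have h2 := diffeomorphic_of_lam_eq_transverse hlam' hspan
      (summable_of_lam_eq_transverse hlam hcom hconv) (hβ.transfer hC) hflat' hcom'
    exact ⟨h2, h1.trans h2⟩
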